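/- Let $Q$ be a smooth (finite-dimensional, Hausdorff, second countable) manifold with a Riemannian metric $\langle\cdot,\cdot\rangle$, let $V\in C^\infty(Q)$, and let $D\subset TQ$ be a regular smooth distribution of rank $r$; they define the nonholonomic system with Lagrangian $L=\tfrac12\langle\dot q,\dot q\rangle-V(q)$ and constraints $\dot q\in D$. Let $\tau:D^*\to Q$ be the dual bundle, $\mathrm{Leg}_c:D\to D^*$, $v\mapsto\langle v,\cdot\rangle|_D$, the constrained Legendre transform, and $H_c(\pi)=\tfrac12\langle v,v\rangle+V(\tau(\pi))$, with $v=\mathrm{Leg}_c^{-1}(\pi)$, the constrained Hamiltonian on $D^*$. For a section $Z$ of $D$ let $p_Z\in C^\infty(D^*)$, $p_Z(\pi)=\pi(Z)$. For a local basis $\{X_\alpha\}$ of sections of $D$, with $X_\alpha=\rho^i_\alpha\partial_{q^i}$, let $(q^i,\pi_\alpha)$, $\pi_\alpha=p_{X_\alpha}$, be the induced coordinates on $D^*$, and let $C_{\alpha\beta}^\gamma$ be defined by $[X_\alpha,X_\beta]\equiv C_{\alpha\beta}^\gamma X_\gamma \pmod{D^\perp}$. The nonholonomic bivector on $D^*$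 is $$\Pi_{nh}=\rho^i_\alpha\,\partial_{q^i}\wedge\partial_{\pi_\alpha}-\tfrac12\,C_{\alpha\beta}^\gamma\pi_\gamma\,\partial_{\pi_\alpha}\wedge\partial_{\pi_\beta},$$ and the dynamics is given by the vector field $X_{nh}=\Pi_{nh}^\sharp(dH_c)$. Here $\Pi^\sharp(b)=\Pi(\cdot,b)$ for a bivector $\Pi$, $\{f,h\}=\Pi(df,dh)$ is the bracket of functions defined by $\Pi$, and $\Xi^\flat(X)=\Xi(\cdot,X)$ for a 2-form $\Xi$. Let $G$ be a Lie group acting smoothly and properly on $Q$ and preserving $\langle\cdot,\cdot\rangle$, $V$ and $D$. It acts on $D$ by tangent lift, and on $D^*$ through $\mathrm{Leg}_c$. Assume that the set $Q_f\subset Q$ of points with trivial isotropy is dense, and fix a $G$-invariant smooth subbundle $W$ with $TQ=D\oplus W$. Let $Z_1,\dots,Z_\ell$ be $G$-equivariant smooth sections of $D$ over $Q$ which over $Q_f$ are pointwise linearly independent and generate gauge momenta: for $q\in Q_f$ one has $Z_b(q)\in D_q\cap(\mathfrak g\cdot q)$, and $\pi_b:=p_{Z_b}$ satisfies $d\pi_b(X_{nh})=0$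 over $Q_f$. An adapted basis on an open set $U\subset Q_f$ is a basis $\{X_\alpha\}=\{Z_b,Y_I\}$ of sections of $D|_U$ that consists of the $Z_b$ and of further smooth $G$-equivariant sections $Y_I$. Let $\Lambda$ be a smooth 3-form on $Q$ whose restriction to $Q_f$ is $G$-invariant, vanishes upon contraction with elements of $W$, and satisfies, for every adapted basis on an open subset of $Q_f$, $$\Lambda(Z_b,X_\alpha,X_\beta)=\langle[Z_b,X_\alpha],X_\beta\rangle,\qquad 1\le b\le\ell,\ 1\le\alpha,\beta\le r.$$ Let $\Xi$ be the 2-form on $D^*$ obtained by contracting $\tau^*\Lambda$ (in its first argument) with any vector field $Y$ on $D^*$ such that $T\tau(Y(\pi))=\mathrm{Leg}_c^{-1}(\pi)$, and let $\Pi_{nh}^\Lambda$ be the bivector on $D^*$ with $$(\Pi_{nh}^\Lambda)^\sharp=(\mathrm{Id}_{TD^*}+\Pi_{nh}^\sharp\circ\Xi^\flat)^{-1}\circ\Pi_{nh}^\sharp .$$ Then $\Pi_{nh}^\Lambda$ is $G$-invariant. Consequently, calling a function on $D^*/G$ smooth if its pull-back to $D^*$ is smooth, $\Pi_{nh}^\Lambda$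 induces a bracket of smooth functions on $D^*/G$, whose pull-back is the bracket of the pull-backs. Moreover, each $\pi_b$, $b=1,\dots,\ell$, is the pull-back of a smooth function on $D^*/G$, and this function is a Casimir of the induced bracket: its bracket with every smooth function on $D^*/G$ is zero. -/

import Mathlib

open Bundle Manifold Module
open scoped ContDiff Manifold Topology

noncomputable section

namespace Nonholonomic

section Basic

variable {E Q : Type*} [NormedAddCommGroup E] [NormedSpace ℝ E]
  [TopologicalSpace Q] [ChartedSpace E Q] [IsManifold 𝓘(ℝ, E) ∞ Q]

/-- A family `Λ` of alternating 3-forms on the tangent spaces of `Q` is a smooth 3-form if it gives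
a smooth function when it is evaluated on any three smooth local vector fields. -/
def IsSmoothThreeForm (Λ : ∀ q : Q, TangentSpace 𝓘(ℝ, E) q [⋀^Fin 3]→L[ℝ] ℝ) : Prop :=
  ∀ (U : Set Q), IsOpen U → ∀ X : Fin 3 → ∀ q : Q, TangentSpace 𝓘(ℝ, E) q,
    (∀ i, ContMDiffOn 𝓘(ℝ, E) 𝓘(ℝ, E).tangent ∞
      (fun q => (⟨q, X i q⟩ : TangentBundle 𝓘(ℝ, E) Q)) U) →
    ContMDiffOn 𝓘(ℝ, E) 𝓘(ℝ, ℝ) ∞ (fun q => Λ q (fun i => X i q)) U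

/-- A family `W` of subspaces of the tangent spaces of `Q` is a smooth subbundle of `TQ` if it has
a smooth frame near each point. -/
def IsSmoothSubbundle (W : ∀ q : Q, Submodule ℝ (TangentSpace 𝓘(ℝ, E) q)) : Prop :=
  ∀ q₀ : Q, ∃ U : Set Q, IsOpen U ∧ q₀ ∈ U ∧ ∃ (k : ℕ)
    (X : Fin k → ∀ q : Q, TangentSpace 𝓘(ℝ, E) q),
    (∀ i, ContMDiffOn 𝓘(ℝ, E) 𝓘(ℝ, E).tangent ∞
      (fun q => (⟨q, X i q⟩ : TangentBundle 𝓘(ℝ, E) Q)) U) ∧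
    ∀ q ∈ U, LinearIndependent ℝ (fun i => X i q) ∧
      Submodule.span ℝ (Set.range fun i => X i q) = W q

end Basic

section Action

variable (E : Type*) {Q : Type*} [NormedAddCommGroup E] [NormedSpace ℝ E]
  [TopologicalSpace Q] [ChartedSpace E Q] {G : Type*} [Group G] [MulAction G Q]

/-- The tangent lift `T_q Q → T_{g • q} Q` of the action of `g` on `Q`. -/
def tangentAction (g : G) (q : Q) :
    TangentSpace 𝓘(ℝ, E) q →L[ℝ] TangentSpace 𝓘(ℝ, E) (g • q) :=
  mfderiv 𝓘(ℝ, E) 𝓘(ℝ, E) (fun x : Q => g • x) q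

/-- The tangent space `𝔤 · q` at `q` of the `G`-orbit through `q`, i.e. the image of the Lie
algebra `T_1 G` under the derivative at `1` of the orbit map `g ↦ g • q`. That derivative takes
values in the tangent space at `1 • q`, which is identified with the one at `q` by the tangent
lift of the action of `1`. -/
def orbitTangent (EG : Type*) [NormedAddCommGroup EG] [NormedSpace ℝ EG]
    (G : Type*) [Group G] [TopologicalSpace G] [ChartedSpace EG G] [MulAction G Q]
    (q : Q) : Submodule ℝ (TangentSpace 𝓘(ℝ, E) q) :=
  (LinearMap.range
    (mfderiv 𝓘(ℝ, EG) 𝓘(ℝ, E) (fun g : G => g • q) 1).toLinearMap).comap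
    (tangentAction E (1 : G) q).toLinearMap

/-- The set `Q_f` of points of `Q` with trivial isotropy. -/
def freePoints (G Q : Type*) [Group G] [MulAction G Q] : Set Q :=
  {q | MulAction.stabilizer G q = ⊥}

end Action

/-- The phase space `D*`: the total space of the dual of the vector bundle `D → Q` with
typical fibre `F`. It is a manifold, modelled on `E × F*` if `Q` is modelled on `E`. -/
abbrev PhaseSpace {Q : Type*} (F : Type*) [NormedAddCommGroup F] [NormedSpace ℝ F]
    (D : Q → Type*) [∀ q, AddCommGroup (D q)] [∀ q, Module ℝ (D q)]
    [∀ q, TopologicalSpace (D q)] : Type _ :=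
  TotalSpace (F →L[ℝ] ℝ) (fun q : Q => D q →L[ℝ] Bundle.Trivial Q ℝ q)

section System

variable (E : Type*) {Q : Type*} (F : Type*) (D : Q → Type*)
  [NormedAddCommGroup E] [NormedSpace ℝ E]
  [TopologicalSpace Q] [ChartedSpace E Q] [IsManifold 𝓘(ℝ, E) ∞ Q]
  [NormedAddCommGroup F] [NormedSpace ℝ F]
  [TopologicalSpace (TotalSpace F D)]
  [∀ q, AddCommGroup (D q)] [∀ q, Module ℝ (D q)] [∀ q, TopologicalSpace (D q)]
  [FiberBundle F D]

/-- A mechanical system on `Q` with Lagrangian `½ ⟨q̇, q̇⟩ - V(q)` and linear constraints given by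
a regular distribution `D ⊆ TQ`. The distribution is presented as a smooth vector bundle `D → Q`
together with its inclusion in `TQ`, a smooth injective morphism of vector bundles over `Q`. -/
structure System where
  /-- the kinetic energy metric -/
  metric : ContMDiffRiemannianMetric 𝓘(ℝ, E) ∞ E (fun q : Q => TangentSpace 𝓘(ℝ, E) q)
  /-- the potential energy `V` -/
  potential : Q → ℝ
  contMDiff_potential : ContMDiff 𝓘(ℝ, E) 𝓘(ℝ, ℝ) ∞ potential
  /-- the inclusion of the constraint distribution in `TQ` -/
  incl : ∀ q : Q, D q →L[ℝ] TangentSpace 𝓘(ℝ, E) q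
  incl_injective : ∀ q, Function.Injective (incl q)
  contMDiff_incl : ContMDiff (𝓘(ℝ, E).prod 𝓘(ℝ, F)) 𝓘(ℝ, E).tangent ∞
    (fun u : TotalSpace F D => (⟨u.proj, incl u.proj u.2⟩ : TangentBundle 𝓘(ℝ, E) Q))

variable {E F D}

/-- The contraction `i_u Λ` of an alternating 3-form with a vector `u`, as a bilinear form. -/
def contract {V : Type*} [AddCommGroup V] [Module ℝ V] [TopologicalSpace V]
    (Λ : V [⋀^Fin 3]→L[ℝ] ℝ) (u : V) : V →ₗ[ℝ] V →ₗ[ℝ] ℝ :=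
  have e1 : ∀ y z : V, Function.update ![u, 0, y] 1 z = ![u, z, y] := fun y z => by
    ext i; fin_cases i <;> rfl
  have e2 : ∀ x z : V, Function.update ![u, x, 0] 2 z = ![u, x, z] := fun x z => by
    ext i; fin_cases i <;> rfl
  LinearMap.mk₂ ℝ (fun x y => Λ ![u, x, y])
    (fun x x' y => by rw [← e1, Λ.map_update_add, e1, e1])
    (fun c x y => by rw [← e1, Λ.map_update_smul, e1])
    (fun x y y' => by rw [← e2, Λ.map_update_add, e2, e2])
    (fun c x y => by rw [← e2, Λ.map_update_smul, e2])

namespace System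

/-- The constrained Legendre transform on the fibre over `q`, as a linear map:
`v ↦ ⟨v, ·⟩` restricted to `D_q`. -/
def legendreMap (S : System E F D) (q : Q) :
    D q →ₗ[ℝ] (D q →L[ℝ] Bundle.Trivial Q ℝ q) where
  toFun v := (S.metric.inner q (S.incl q v)).comp (S.incl q)
  map_add' v w := by ext; simp
  map_smul' c v := by ext; simp

theorem legendreMap_injective (S : System E F D) (q : Q) :
    Function.Injective (S.legendreMap q) := by
  rw [← LinearMap.ker_eq_bot, LinearMap.ker_eq_bot']
  intro v hv
  by_contra hne
  have h1 : S.incl q v ≠ 0 := fun h => hne (S.incl_injective q (by simpa using h))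
  have h2 := S.metric.pos q _ h1
  have h3 := DFunLike.congr_fun hv v
  exact absurd h3 h2.ne'

variable [VectorBundle ℝ F D] [FiniteDimensional ℝ F]

theorem legendreMap_bijective (S : System E F D) (q : Q) :
    Function.Bijective (S.legendreMap q) := by
  let e := (trivializationAt F D q).continuousLinearEquivAt ℝ q
    (FiberBundle.mem_baseSet_trivializationAt' q)
  let e' : (F →L[ℝ] ℝ) ≃ₗ[ℝ] (D q →L[ℝ] Bundle.Trivial Q ℝ q) :=
    { toFun := fun l => l.comp (e : D q →L[ℝ] F)
      invFun := fun l => l.comp (e.symm : F →L[ℝ] D q)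
      map_add' := fun _ _ => rfl
      map_smul' := fun _ _ => rfl
      left_inv := fun l => by ext x; simp
      right_inv := fun l => by ext x; simp }
  have i1 : FiniteDimensional ℝ (D q) := e.symm.toLinearEquiv.finiteDimensional
  have i2 : FiniteDimensional ℝ (D q →L[ℝ] Bundle.Trivial Q ℝ q) := e'.finiteDimensional
  have hd : finrank ℝ (D q) = finrank ℝ (D q →L[ℝ] Bundle.Trivial Q ℝ q) := by
    rw [e.toLinearEquiv.finrank_eq, ← e'.finrank_eq,
      ← (LinearMap.toContinuousLinearMap (𝕜 := ℝ) (E := F) (F' := ℝ)).finrank_eq]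
    exact (Subspace.dual_finrank_eq).symm
  exact ⟨S.legendreMap_injective q,
    (LinearMap.injective_iff_surjective_of_finrank_eq_finrank hd).1 (S.legendreMap_injective q)⟩

/-- The constrained Legendre transform `D_q ≃ D_q*`. -/
def legendre (S : System E F D) (q : Q) :
    D q ≃ₗ[ℝ] (D q →L[ℝ] Bundle.Trivial Q ℝ q) :=
  LinearEquiv.ofBijective (S.legendreMap q) (S.legendreMap_bijective q)

/-- The velocity `Leg_c⁻¹(p) ∈ D_q` of `p ∈ D_q*`. -/
def velocity (S : System E F D) (p : PhaseSpace F D) : D p.proj :=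
  (S.legendre p.proj).symm p.2

/-- The constrained Hamiltonian `H_c = π_β v^β - L_c(q, v)` with `v = Leg_c⁻¹(π)`. -/
def hamiltonian (S : System E F D) (p : PhaseSpace F D) : ℝ :=
  p.2 (S.velocity p) -
    (1 / 2 * S.metric.inner p.proj (S.incl p.proj (S.velocity p)) (S.incl p.proj (S.velocity p))
      - S.potential p.proj)

end System

variable [VectorBundle ℝ F D] [FiniteDimensional ℝ F]

/-- The linear function `p_Z` on `D*` generated by a section `Z` of `D`. -/
def momentum (Z : ∀ q, D q) (p : PhaseSpace F D) : ℝ := p.2 (Z p.proj)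

variable (E) in
/-- The tangent space of `D*` at `p`. -/
abbrev PhaseTangent (p : PhaseSpace F D) : Type _ :=
  TangentSpace (𝓘(ℝ, E).prod 𝓘(ℝ, F →L[ℝ] ℝ)) p

variable (E) in
/-- The differential at `p` of a function on `D*`. -/
def differential (f : PhaseSpace F D → ℝ) (p : PhaseSpace F D) : Dual ℝ (PhaseTangent E p) :=
  (show PhaseTangent E p →L[ℝ] ℝ from
    mfderiv (𝓘(ℝ, E).prod 𝓘(ℝ, F →L[ℝ] ℝ)) 𝓘(ℝ, ℝ) f p).toLinearMap

variable (E) in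
/-- The smooth functions on `D*`. -/
def IsSmooth (f : PhaseSpace F D → ℝ) : Prop :=
  ContMDiff (𝓘(ℝ, E).prod 𝓘(ℝ, F →L[ℝ] ℝ)) 𝓘(ℝ, ℝ) ∞ f

variable (E) in
/-- The derivative at `p` of the projection `τ : D* → Q`. -/
def projDeriv (p : PhaseSpace F D) : PhaseTangent E p →ₗ[ℝ] TangentSpace 𝓘(ℝ, E) p.proj :=
  (mfderiv (𝓘(ℝ, E).prod 𝓘(ℝ, F →L[ℝ] ℝ)) 𝓘(ℝ, E)
    (fun x : PhaseSpace F D => x.proj) p).toLinearMap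

variable (E) in
/-- The vertical tangent vector at `p = (q, π)` given by `l ∈ D_q*`: the velocity at `t = 0` of the
curve `t ↦ (q, π + t l)`, which is at `p` at that time. -/
def vertical (p : PhaseSpace F D) (l : D p.proj →L[ℝ] Bundle.Trivial Q ℝ p.proj) :
    PhaseTangent E p :=
  mfderiv 𝓘(ℝ, ℝ) (𝓘(ℝ, E).prod 𝓘(ℝ, F →L[ℝ] ℝ))
    (fun t : ℝ => (⟨p.proj, p.2 + t • l⟩ : PhaseSpace F D)) 0 (1 : ℝ)

/-- The local basis of sections `X_α` of `D` near `q₀` which is given by the bundle chart of `D`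
at `q₀` and a fixed basis of the typical fibre. -/
def frame (q₀ : Q) (α : Fin (finrank ℝ F)) : ∀ q, D q :=
  (trivializationAt F D q₀).localFrame (finBasis ℝ F) α

/-- The value at `q₀` of the member `μ^α` of the local basis of sections of `D*` which is dual
to `frame q₀`. -/
def coframe (q₀ : Q) (α : Fin (finrank ℝ F)) : D q₀ →L[ℝ] Bundle.Trivial Q ℝ q₀ :=
  (LinearMap.toContinuousLinearMap ((finBasis ℝ F).coord α)).comp
    ((trivializationAt F D q₀).continuousLinearMapAt ℝ q₀)

/-- The local section of `D*` near `q₀ = p.proj` which passes through `p` and along which all the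
momenta `π_α`, i.e. the components with respect to the frame `frame q₀`, are constant. -/
def constantSection (p : PhaseSpace F D) (q : Q) : PhaseSpace F D :=
  ⟨q, (p.2.comp ((trivializationAt F D p.proj).symmL ℝ p.proj)).comp
    ((trivializationAt F D p.proj).continuousLinearMapAt ℝ q)⟩

variable (E) in
/-- The vector `∂/∂π_α` at `p`, in the coordinates `(q^i, π_α)` of the frame `frame p.proj`. -/
def partialMomentum (p : PhaseSpace F D) (α : Fin (finrank ℝ F)) : PhaseTangent E p :=
  vertical E p (coframe p.proj α)

namespace System

/-- The local basis of sections `X_α` of `D`, as vector fields on `Q`. -/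
def frameField (S : System E F D) (q₀ : Q) (α : Fin (finrank ℝ F)) (q : Q) :
    TangentSpace 𝓘(ℝ, E) q :=
  S.incl q (frame q₀ α q)

/-- The vector `ρ_α^i ∂/∂q^i` at `p`, in the coordinates `(q^i, π_α)` of the frame `frame p.proj`:
the image of `X_α` under the derivative of the section `π_α = const` through `p`. -/
def partialBase (S : System E F D) (p : PhaseSpace F D) (α : Fin (finrank ℝ F)) :
    PhaseTangent E p :=
  mfderiv 𝓘(ℝ, E) (𝓘(ℝ, E).prod 𝓘(ℝ, F →L[ℝ] ℝ)) (constantSection p) p.proj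
    (S.frameField p.proj α p.proj)

/-- The function `C_{αβ}^γ π_γ = ⟨[X_α, X_β], v⟩` at `p`, where `v = Leg_c⁻¹(π)`. Here
`[X_α, X_β] = C_{αβ}^γ X_γ` modulo the orthogonal complement of `D`. -/
def structureTerm (S : System E F D) (p : PhaseSpace F D) (α β : Fin (finrank ℝ F)) : ℝ :=
  S.metric.inner p.proj
    (VectorField.mlieBracket 𝓘(ℝ, E) (S.frameField p.proj α) (S.frameField p.proj β) p.proj)
    (S.incl p.proj (S.velocity p))

/-- The map `Π_nh^♯ : T_p* D* → T_p D*` of the nonholonomic bivector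
`Π_nh = ρ_α^i ∂/∂q^i ∧ ∂/∂π_α - ½ C_{αβ}^γ π_γ ∂/∂π_α ∧ ∂/∂π_β`.
The convention is `Π^♯(b) = Π(·, b)`, so that `Π(df, dh) = df(Π^♯ dh)`. -/
def nhSharp (S : System E F D) (p : PhaseSpace F D) :
    Dual ℝ (PhaseTangent E p) →ₗ[ℝ] PhaseTangent E p :=
  ∑ α, ((Dual.eval ℝ _ (partialMomentum E p α)).smulRight (S.partialBase p α)
      - (Dual.eval ℝ _ (S.partialBase p α)).smulRight (partialMomentum E p α))
    - ∑ α, ∑ β, S.structureTerm p α β •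
      (Dual.eval ℝ _ (partialMomentum E p β)).smulRight (partialMomentum E p α)

/-- The vector field `X_nh = Π_nh^♯(dH_c)` on `D*` which describes the nonholonomic dynamics. -/
def nhField (S : System E F D) (p : PhaseSpace F D) : PhaseTangent E p :=
  S.nhSharp p (differential E S.hamiltonian p)

/-- The map `Ξ^♭ : T_p D* → T_p* D*` of the 2-form `Ξ = i_Z τ^*Λ` on `D*`, where `Z` is any second
order vector field, i.e. `Tτ(Z(p)) = Leg_c⁻¹(p)`. The convention is `Ξ^♭(X) = Ξ(·, X)`, so that
`Ξ^♭(X)(Y) = Λ(Leg_c⁻¹(p), Tτ Y, Tτ X)`. -/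
def xiFlat (S : System E F D) (Λ : ∀ q : Q, TangentSpace 𝓘(ℝ, E) q [⋀^Fin 3]→L[ℝ] ℝ)
    (p : PhaseSpace F D) : PhaseTangent E p →ₗ[ℝ] Dual ℝ (PhaseTangent E p) :=
  ((contract (Λ p.proj) (S.incl p.proj (S.velocity p))).compl₁₂
    (projDeriv E p) (projDeriv E p)).flip

theorem xiFlat_apply (S : System E F D)
    (Λ : ∀ q : Q, TangentSpace 𝓘(ℝ, E) q [⋀^Fin 3]→L[ℝ] ℝ)
    (p : PhaseSpace F D) (X Y : PhaseTangent E p) :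
    S.xiFlat Λ p X Y =
      Λ p.proj ![S.incl p.proj (S.velocity p), projDeriv E p Y, projDeriv E p X] := rfl

/-- The endomorphism `Id + Π_nh^♯ ∘ Ξ^♭` of `T_p D*`. -/
def gaugeEndomorphism (S : System E F D)
    (Λ : ∀ q : Q, TangentSpace 𝓘(ℝ, E) q [⋀^Fin 3]→L[ℝ] ℝ) (p : PhaseSpace F D) :
    Module.End ℝ (PhaseTangent E p) :=
  1 + S.nhSharp p ∘ₗ S.xiFlat Λ p

/-- The vectors `∂/∂π_α` are vertical. -/
theorem projDeriv_partialMomentum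
    (p : PhaseSpace F D) (α : Fin (finrank ℝ F)) :
    projDeriv E p (partialMomentum E p α) = 0 := by
  let γ : ℝ → PhaseSpace F D := fun t => ⟨p.proj, p.2 + t • coframe p.proj α⟩
  have hγ : γ 0 = p := by simp [γ]
  by_cases hd : MDifferentiableAt 𝓘(ℝ, ℝ) (𝓘(ℝ, E).prod 𝓘(ℝ, F →L[ℝ] ℝ)) γ 0
  · have hτ : MDifferentiableAt (𝓘(ℝ, E).prod 𝓘(ℝ, F →L[ℝ] ℝ)) 𝓘(ℝ, E)
        (fun x : PhaseSpace F D => x.proj) (γ 0) :=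
      (contMDiff_proj (n := ∞) (IB := 𝓘(ℝ, E))
        (fun q : Q => D q →L[ℝ] Bundle.Trivial Q ℝ q)).mdifferentiable (by simp) _
    have h := mfderiv_comp (0 : ℝ) hτ hd
    have hc : ((fun x : PhaseSpace F D => x.proj) ∘ γ) = fun _ => p.proj := rfl
    rw [hc, mfderiv_const] at h
    have h' := DFunLike.congr_fun h (1 : ℝ)
    rw [hγ] at h'
    exact h'.symm
  · have : partialMomentum E p α = 0 := by
      have := mfderiv_zero_of_not_mdifferentiableAt hd
      exact DFunLike.congr_fun this (1 : ℝ)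
    rw [this, map_zero]

/-- The endomorphism `Id + Π_nh^♯ ∘ Ξ^♭` is invertible. -/
theorem isUnit_gaugeEndomorphism (S : System E F D)
    (Λ : ∀ q : Q, TangentSpace 𝓘(ℝ, E) q [⋀^Fin 3]→L[ℝ] ℝ) (p : PhaseSpace F D) :
    IsUnit (S.gaugeEndomorphism Λ p) := by
  have h0 : ∀ a : PhaseTangent E p, projDeriv E p (S.nhSharp p (S.xiFlat Λ p a)) = 0 := by
    intro a
    have : ∀ α, S.xiFlat Λ p a (partialMomentum E p α) = 0 := by
      intro α
      rw [xiFlat_apply, projDeriv_partialMomentum]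
      exact (Λ p.proj).map_coord_zero 1 (by simp)
    have h2 : S.nhSharp p (S.xiFlat Λ p a) =
        -∑ α, S.xiFlat Λ p a (S.partialBase p α) • partialMomentum E p α := by
      simp [nhSharp, this]
    rw [h2, map_neg, map_sum]
    simp only [map_smul, projDeriv_partialMomentum, smul_zero, Finset.sum_const_zero, neg_zero]
  have h1 : (S.nhSharp p ∘ₗ S.xiFlat Λ p) * (S.nhSharp p ∘ₗ S.xiFlat Λ p) = 0 := by
    ext a
    have : S.xiFlat Λ p (S.nhSharp p (S.xiFlat Λ p a)) = 0 := by
      ext b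
      rw [xiFlat_apply, h0]
      exact (Λ p.proj).map_coord_zero 2 (by simp)
    simp [this]
  exact IsNilpotent.isUnit_one_add ⟨2, by rw [pow_two, h1]⟩

/-- The map `(Π_nh^Λ)^♯ = (Id + Π_nh^♯ ∘ Ξ^♭)⁻¹ ∘ Π_nh^♯` of the gauge transformed bivector. -/
def gaugeSharp (S : System E F D)
    (Λ : ∀ q : Q, TangentSpace 𝓘(ℝ, E) q [⋀^Fin 3]→L[ℝ] ℝ) (p : PhaseSpace F D) :
    Dual ℝ (PhaseTangent E p) →ₗ[ℝ] PhaseTangent E p :=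
  ((S.isUnit_gaugeEndomorphism Λ p).unit⁻¹ : (Module.End ℝ (PhaseTangent E p))ˣ).val ∘ₗ
    S.nhSharp p

end System

/-- The bracket `{f, h} = Π(df, dh) = df(Π^♯(dh))` of functions on `D*` given by a bivector `Π`. -/
def bracket (P : ∀ p : PhaseSpace F D, Dual ℝ (PhaseTangent E p) →ₗ[ℝ] PhaseTangent E p)
    (f h : PhaseSpace F D → ℝ) (p : PhaseSpace F D) : ℝ :=
  differential E f p (P p (differential E h p))

section Symmetry

variable {EG : Type*} [NormedAddCommGroup EG] [NormedSpace ℝ EG]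
  (G : Type*) [Group G] [TopologicalSpace G] [ChartedSpace EG G] [MulAction G Q]

namespace System

/-- The action of `G` on `Q` preserves the Lagrangian and the constraint distribution. -/
structure IsSymmetric (S : System E F D) : Prop where
  metric_invariant : ∀ (g : G) (q : Q) (v w : TangentSpace 𝓘(ℝ, E) q),
    S.metric.inner (g • q) (tangentAction E g q v) (tangentAction E g q w) = S.metric.inner q v w
  potential_invariant : ∀ (g : G) (q : Q), S.potential (g • q) = S.potential q
  distribution_invariant : ∀ (g : G) (q : Q) (u : D q),
    tangentAction E g q (S.incl q u) ∈ LinearMap.range (S.incl (g • q)).toLinearMap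

/-- `W` is a `G`-invariant smooth subbundle of `TQ` with `TQ = D ⊕ W`. -/
structure IsInvariantComplement (S : System E F D)
    (W : ∀ q : Q, Submodule ℝ (TangentSpace 𝓘(ℝ, E) q)) : Prop where
  smooth : IsSmoothSubbundle W
  isCompl : ∀ q, IsCompl (LinearMap.range (S.incl q).toLinearMap) (W q)
  invariant : ∀ (g : G) (q : Q), ∀ w ∈ W q, tangentAction E g q w ∈ W (g • q)

variable {G} in
/-- The lifted action of `G` on `D*`, which is the action on `D` conjugated with the constrained
Legendre transform: `g` sends `Leg_c(v)` to `Leg_c(Tg(v)) = ⟨Tg(v), ·⟩|_D`. -/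
def liftedAction (S : System E F D) (g : G) (p : PhaseSpace F D) : PhaseSpace F D :=
  ⟨g • p.proj, (S.metric.inner (g • p.proj)
    (tangentAction E g p.proj (S.incl p.proj (S.velocity p)))).comp (S.incl (g • p.proj))⟩

variable {G} in
/-- The derivative at `p` of the lifted action of `g` on `D*`. -/
def liftedDeriv (S : System E F D) (g : G) (p : PhaseSpace F D) :
    PhaseTangent E p →ₗ[ℝ] PhaseTangent E (S.liftedAction g p) :=
  (mfderiv (𝓘(ℝ, E).prod 𝓘(ℝ, F →L[ℝ] ℝ)) (𝓘(ℝ, E).prod 𝓘(ℝ, F →L[ℝ] ℝ))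
    (S.liftedAction g) p).toLinearMap

/-- `G`-invariance of a bivector `Π` on `D*`: the lifted action of each `g` sends `Π` to `Π`. -/
def IsInvariantBivector (S : System E F D)
    (P : ∀ p : PhaseSpace F D, Dual ℝ (PhaseTangent E p) →ₗ[ℝ] PhaseTangent E p) : Prop :=
  ∀ (g : G) (p : PhaseSpace F D) (a : Dual ℝ (PhaseTangent E (S.liftedAction g p))),
    P (S.liftedAction g p) a = S.liftedDeriv g p (P p (a ∘ₗ S.liftedDeriv g p))

/-- The section `Z` of `D` is `G`-equivariant on `U ⊆ Q`, as a vector field. -/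
def IsEquivariantOn (S : System E F D) (Z : ∀ q, D q) (U : Set Q) : Prop :=
  ∀ (g : G), ∀ q ∈ U, g • q ∈ U →
    S.incl (g • q) (Z (g • q)) = tangentAction E g q (S.incl q (Z q))

variable (EG) in
/-- The section `Z` of `D` generates a gauge momentum over `U ⊆ Q`: it takes its values in
`𝒮_q = D_q ∩ (𝔤 · q)`, and `p_Z` is a first integral of the nonholonomic dynamics. -/
structure IsGaugeGeneratorOn (S : System E F D) (Z : ∀ q, D q) (U : Set Q) : Prop where
  tangent_orbit : ∀ q ∈ U, S.incl q (Z q) ∈ orbitTangent E EG G q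
  first_integral : ∀ p : PhaseSpace F D, p.proj ∈ U →
    differential E (momentum Z) p (S.nhField p) = 0

/-- The sections `Z_b` and `Y_I` form a symmetry-momentum adapted basis of sections of `D` on the
open set `U`, where the `Z_b` are given generators of gauge momenta. -/
structure IsAdaptedBasis (S : System E F D) {l k : ℕ} (Z : Fin l → ∀ q, D q)
    (Y : Fin k → ∀ q, D q) (U : Set Q) : Prop where
  isLocalFrameOn : IsLocalFrameOn 𝓘(ℝ, E) F ∞ (Sum.elim Z Y) U
  equivariant : ∀ i, S.IsEquivariantOn G (Sum.elim Z Y i) U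

/-- The 3-form `Λ` on `Q` extends smoothly, from the set `Q_f` of points with trivial isotropy,
a `G`-invariant 3-form which vanishes upon contraction with `W` and which satisfies
`Λ(Z_b, X_α, X_β) = ⟨[Z_b, X_α], X_β⟩` for each adapted basis `{X_α} = {Z_b, Y_I}` of sections of
`D` on an open subset of `Q_f`. -/
structure IsAdaptedThreeForm (S : System E F D)
    (W : ∀ q : Q, Submodule ℝ (TangentSpace 𝓘(ℝ, E) q)) {l : ℕ} (Z : Fin l → ∀ q, D q)
    (Λ : ∀ q : Q, TangentSpace 𝓘(ℝ, E) q [⋀^Fin 3]→L[ℝ] ℝ) : Prop where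
  smooth : IsSmoothThreeForm Λ
  invariant : ∀ (g : G), ∀ q ∈ freePoints G Q, ∀ x : Fin 3 → TangentSpace 𝓘(ℝ, E) q,
    Λ (g • q) (fun i => tangentAction E g q (x i)) = Λ q x
  vanish : ∀ q ∈ freePoints G Q, ∀ w ∈ W q, ∀ x y, Λ q ![w, x, y] = 0
  adapted : ∀ (U : Set Q), IsOpen U → U ⊆ freePoints G Q →
    ∀ (k : ℕ) (Y : Fin k → ∀ q, D q), S.IsAdaptedBasis G Z Y U →
    ∀ q ∈ U, ∀ (b : Fin l) (α β : Fin l ⊕ Fin k),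
      Λ q ![S.incl q (Z b q), S.incl q (Sum.elim Z Y α q), S.incl q (Sum.elim Z Y β q)] =
        S.metric.inner q
          (VectorField.mlieBracket 𝓘(ℝ, E) (fun x => S.incl x (Z b x))
            (fun x => S.incl x (Sum.elim Z Y α x)) q)
          (S.incl q (Sum.elim Z Y β q))

/-- The reduced space `D*/G`, the orbit space of the lifted action. -/
def ReducedSpace (S : System E F D) : Type _ :=
  Quot (fun p p' : PhaseSpace F D => ∃ g : G, S.liftedAction g p = p')

/-- The pull-back to `D*` of a function on `D*/G`. -/
def pullback (S : System E F D) (f : S.ReducedSpace G → ℝ) (p : PhaseSpace F D) : ℝ :=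
  f (Quot.mk _ p)

/-- The smooth functions on `D*/G` are those whose pull-back to `D*` is smooth. -/
def IsReducedSmooth (S : System E F D) (f : S.ReducedSpace G → ℝ) : Prop :=
  IsSmooth E (S.pullback G f)

/-- `B` is the bracket of smooth functions on `D*/G` induced by the bivector `Π` on `D*`: the
bracket of two smooth functions on `D*/G` is the smooth function on `D*/G` whose pull-back to `D*`
is the bracket of the pull-backs. -/
def IsInducedBracket (S : System E F D)
    (P : ∀ p : PhaseSpace F D, Dual ℝ (PhaseTangent E p) →ₗ[ℝ] PhaseTangent E p)
    (B : (S.ReducedSpace G → ℝ) → (S.ReducedSpace G → ℝ) → (S.ReducedSpace G → ℝ)) : Prop :=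
  ∀ f h, S.IsReducedSmooth G f → S.IsReducedSmooth G h →
    S.IsReducedSmooth G (B f h) ∧
      S.pullback G (B f h) = bracket P (S.pullback G f) (S.pullback G h)

/-- `c` is a Casimir function of the bracket `B` of smooth functions on `D*/G`. -/
def IsCasimir (S : System E F D)
    (B : (S.ReducedSpace G → ℝ) → (S.ReducedSpace G → ℝ) → (S.ReducedSpace G → ℝ))
    (c : S.ReducedSpace G → ℝ) : Prop :=
  S.IsReducedSmooth G c ∧ ∀ f, S.IsReducedSmooth G f → B f c = 0 ∧ B c f = 0

end System

end Symmetry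

end System

end Nonholonomic

end

set_option linter.unusedSectionVars false

noncomputable section

namespace Nonholonomic

/-! ### Smoothness of maps into `D*` and of the natural pairings. -/

section Pairings

variable {E Q F : Type*} {D : Q → Type*}
  [NormedAddCommGroup E] [NormedSpace ℝ E]
  [TopologicalSpace Q] [ChartedSpace E Q] [IsManifold 𝓘(ℝ, E) ∞ Q]
  [NormedAddCommGroup F] [NormedSpace ℝ F] [FiniteDimensional ℝ F]
  [TopologicalSpace (TotalSpace F D)]
  [∀ q, AddCommGroup (D q)] [∀ q, Module ℝ (D q)] [∀ q, TopologicalSpace (D q)]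
  [FiberBundle F D] [VectorBundle ℝ F D] [ContMDiffVectorBundle ∞ F D 𝓘(ℝ, E)]
  {EM HM M : Type*} [NormedAddCommGroup EM] [NormedSpace ℝ EM] [TopologicalSpace HM]
  {IM : ModelWithCorners ℝ EM HM} [TopologicalSpace M] [ChartedSpace HM M]

/-! Write v = Leg_c⁻¹(π). The endomorphism N = Π_nh^♯ ∘ Ξ^♭ squares to zero, because its values are
vertical and Ξ^♭ kills vertical vectors. Hence (Id + N)⁻¹ = Id - N, and by skew-symmetry the gauge
transformed bivector is Π_nh plus the term Λ(v, Tτ Π_nh^♯ a, Tτ Π_nh^♯ b) (`apply_gaugeSharp`). On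
pulled-back functions and momenta its bracket is therefore {f∘τ, h∘τ} = 0, {f∘τ, p_X} = X(f), {p_X,
p_Y} = -⟨[X, Y], v⟩ + Λ(v, X, Y). These formulas mention no frame, and they determine the bivector,
since the differentials of such functions span the cotangent spaces of `D*`
(`exists_eq_sum_differential_chartFun`).

Invariance: the lifted action carries pulled-back functions to pulled-back functions and p_X to the
momentum of the pulled-back section. The right-hand sides above are natural under isometries that
preserve `D` and Λ. Invariance of Λ is given over Q_f only and extends to Q by continuity and
density (`threeForm_invariant_of_dense`).

Casimirs: near a point of Q_f take an adapted basis {X_i}. The defining property of Λ gives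
{p_{X_i}, π_b} = ⟨[Z_b, X_i], v⟩ - Λ(Z_b, X_i, v) = 0. So the Hamiltonian vector of π_b projects to
Z_b(q) and annihilates all p_{X_i}. Choose ξ in the Lie algebra with ξ·q = Z_b(q). The generator of
the lifted action given by ξ also projects to Z_b(q), and it annihilates the p_{X_i} because the X_i
are equivariant. The two vectors are thus equal, so the Hamiltonian vector is tangent to the orbit
and kills invariant functions (`IsAdaptedThreeForm.differential_gaugeSharp_momentum_eq_zero`). The
bracket is smooth (`isSmooth_bracket_gaugeSharp`) and Q_f is dense, so it vanishes on all of `D*`.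

The remaining ingredient is the existence of adapted bases (`IsSymmetric.exists_isAdaptedBasis`). At
a point with trivial isotropy the orbit map is an immersion, and the implicit function theorem
yields a slice. Properness ensures that only group elements near 1 move nearby points to nearby
points. Together they give a local equivariant map φ to `G` (`exists_moving_frame`), which
transports sections of `D` to equivariant ones. -/

variable (E F) in
/-- The section `X` of `D` is smooth at `q`. -/
def SmoothSectionAt (X : ∀ q, D q) (q : Q) : Prop :=
  ContMDiffAt 𝓘(ℝ, E) (𝓘(ℝ, E).prod 𝓘(ℝ, F)) ∞ (fun x => (⟨x, X x⟩ : TotalSpace F D)) q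

variable (E) in
/-- The vector field `X` on `Q` is smooth at `q`. -/
def SmoothFieldAt (X : ∀ q : Q, TangentSpace 𝓘(ℝ, E) q) (q : Q) : Prop :=
  ContMDiffAt 𝓘(ℝ, E) 𝓘(ℝ, E).tangent ∞
    (fun x => (⟨x, X x⟩ : TangentBundle 𝓘(ℝ, E) Q)) q

theorem frame_eq_symmL {q₀ q : Q} (hq : q ∈ (trivializationAt F D q₀).baseSet)
    (α : Fin (finrank ℝ F)) :
    frame (F := F) (D := D) q₀ α q =
      (trivializationAt F D q₀).symmL ℝ q (finBasis ℝ F α) := by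
  rw [frame, Trivialization.localFrame_apply_of_mem_baseSet _ _ hq]
  rw [Trivialization.symmL_apply _ hq]
  simp [Trivialization.basisAt]

variable (E) in
theorem smoothSectionAt_localFrame {q₀ q : Q}
    (hq : q ∈ (trivializationAt F D q₀).baseSet)
    (α : Fin (finrank ℝ F)) : SmoothSectionAt E F (frame (F := F) (D := D) q₀ α) q :=
  contMDiffAt_localFrame_of_mem ∞ _ _ α hq

/-- Identifies the fibre coordinates of the bundle chart of `D*` with the momenta of the frame;
smoothness of maps into `D*` is thereby reduced to smoothness of real functions. -/
theorem trivializationAt_phaseSpace_apply {q₀ : Q} (p : PhaseSpace F D)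
    (hp : p.proj ∈ (trivializationAt F D q₀).baseSet) (α : Fin (finrank ℝ F)) :
    (trivializationAt (F →L[ℝ] ℝ) (fun q : Q => D q →L[ℝ] Bundle.Trivial Q ℝ q) q₀ p).2
      (finBasis ℝ F α) = p.2 (frame q₀ α p.proj) := by
  rw [hom_trivializationAt_apply, frame_eq_symmL hp]
  simp [ContinuousLinearMap.inCoordinates]

/-- A map to `D*` is smooth if its projection to `Q` and its momenta are smooth. -/
theorem contMDiffAt_phaseSpace {c : M → PhaseSpace F D} {x₀ : M}
    (hb : ContMDiffAt IM 𝓘(ℝ, E) ∞ (fun x => (c x).proj) x₀)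
    (hm : ∀ α, ContMDiffAt IM 𝓘(ℝ, ℝ) ∞
      (fun x => ((c x).2 (frame (F := F) (D := D) (c x₀).proj α (c x).proj) : ℝ)) x₀) :
    ContMDiffAt IM (𝓘(ℝ, E).prod 𝓘(ℝ, F →L[ℝ] ℝ)) ∞ c x₀ := by
  rw [contMDiffAt_totalSpace]
  refine ⟨hb, ?_⟩
  have hev : ∀ᶠ x in 𝓝 x₀, (c x).proj ∈ (trivializationAt F D (c x₀).proj).baseSet :=
    hb.continuousAt.preimage_mem_nhds ((trivializationAt F D (c x₀).proj).open_baseSet.mem_nhds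
      (FiberBundle.mem_baseSet_trivializationAt' _))
  have h : ContMDiffAt IM 𝓘(ℝ, F →L[ℝ] ℝ) ∞ (fun x => ∑ α,
      ((c x).2 (frame (F := F) (D := D) (c x₀).proj α (c x).proj) : ℝ) •
        LinearMap.toContinuousLinearMap ((finBasis ℝ F).coord α)) x₀ :=
    ContMDiffAt.sum fun α _ => (hm α).smul contMDiffAt_const
  refine h.congr_of_eventuallyEq ?_
  filter_upwards [hev] with x hx
  refine ContinuousLinearMap.coe_injective ((finBasis ℝ F).ext fun β => ?_)
  simp only [ContinuousLinearMap.coe_coe]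
  rw [trivializationAt_phaseSpace_apply _ hx]
  simp [Finsupp.single_apply]

/-- The pairing of covectors in `D*` with vectors in `D` is smooth. -/
theorem contMDiffAt_pairing {b : M → Q} {a : ∀ x, D (b x) →L[ℝ] Bundle.Trivial Q ℝ (b x)}
    {u : ∀ x, D (b x)} {x₀ : M}
    (ha : ContMDiffAt IM (𝓘(ℝ, E).prod 𝓘(ℝ, F →L[ℝ] ℝ)) ∞
      (fun x => (⟨b x, a x⟩ : PhaseSpace F D)) x₀)
    (hu : ContMDiffAt IM (𝓘(ℝ, E).prod 𝓘(ℝ, F)) ∞ (fun x => (⟨b x, u x⟩ : TotalSpace F D)) x₀) :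
    ContMDiffAt IM 𝓘(ℝ, ℝ) ∞ (fun x => (a x (u x) : ℝ)) x₀ := by
  have h := ContMDiffAt.clm_bundle_apply (F₂ := ℝ) (E₂ := Bundle.Trivial Q ℝ) ha hu
  exact (contMDiffAt_totalSpace.1 h).2

theorem contMDiffAt_momentum {X : ∀ q, D q} {p : PhaseSpace F D}
    (hX : SmoothSectionAt E F X p.proj) :
    ContMDiffAt (𝓘(ℝ, E).prod 𝓘(ℝ, F →L[ℝ] ℝ)) 𝓘(ℝ, ℝ) ∞ (momentum X) p :=
  contMDiffAt_pairing (b := fun p : PhaseSpace F D => p.proj) (a := fun p => p.2)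
    (u := fun p => X p.proj) contMDiffAt_id
    (ContMDiffAt.comp p hX (contMDiffAt_proj _))

namespace System

variable (S : System E F D)

/-- The Riemannian metric is smooth. -/
theorem contMDiffAt_inner {b : M → Q} {u w : ∀ x, TangentSpace 𝓘(ℝ, E) (b x)} {x₀ : M}
    (hu : ContMDiffAt IM 𝓘(ℝ, E).tangent ∞
      (fun x => (⟨b x, u x⟩ : TangentBundle 𝓘(ℝ, E) Q)) x₀)
    (hw : ContMDiffAt IM 𝓘(ℝ, E).tangent ∞
      (fun x => (⟨b x, w x⟩ : TangentBundle 𝓘(ℝ, E) Q)) x₀) :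
    ContMDiffAt IM 𝓘(ℝ, ℝ) ∞ (fun x => S.metric.inner (b x) (u x) (w x)) x₀ := by
  have hb : ContMDiffAt IM 𝓘(ℝ, E) ∞ b x₀ := (contMDiffAt_totalSpace.1 hu).1
  have h := ContMDiffAt.clm_bundle_apply₂ (F₁ := E) (F₂ := E) (F₃ := ℝ)
    (E₁ := fun q : Q => TangentSpace 𝓘(ℝ, E) q) (E₂ := fun q : Q => TangentSpace 𝓘(ℝ, E) q)
    (E₃ := Bundle.Trivial Q ℝ) (b := b) (v := u) (w := w)
    (ψ := fun x => S.metric.inner (b x)) (x := x₀) (n := ∞) (IM := IM) (IB := 𝓘(ℝ, E))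
    (S.metric.contMDiff.contMDiffAt.comp x₀ hb) hu hw
  exact (contMDiffAt_totalSpace.1 h).2

theorem contMDiffAt_incl {b : M → Q} {u : ∀ x, D (b x)} {x₀ : M}
    (hu : ContMDiffAt IM (𝓘(ℝ, E).prod 𝓘(ℝ, F)) ∞ (fun x => (⟨b x, u x⟩ : TotalSpace F D)) x₀) :
    ContMDiffAt IM 𝓘(ℝ, E).tangent ∞
      (fun x => (⟨b x, S.incl (b x) (u x)⟩ : TangentBundle 𝓘(ℝ, E) Q)) x₀ :=
  S.contMDiff_incl.contMDiffAt.comp x₀ hu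

/-- The restriction of `⟨w, ·⟩` to `D`, as an element of `D*`. -/
def covector {q : Q} (w : TangentSpace 𝓘(ℝ, E) q) : PhaseSpace F D :=
  ⟨q, (S.metric.inner q w).comp (S.incl q)⟩

/-- The momenta of this covector are inner products with the frame. The lifted action has this form
by definition, with w = Tg(v). -/
theorem contMDiffAt_covector {b : M → Q} {w : ∀ x, TangentSpace 𝓘(ℝ, E) (b x)} {x₀ : M}
    (hw : ContMDiffAt IM 𝓘(ℝ, E).tangent ∞
      (fun x => (⟨b x, w x⟩ : TangentBundle 𝓘(ℝ, E) Q)) x₀) :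
    ContMDiffAt IM (𝓘(ℝ, E).prod 𝓘(ℝ, F →L[ℝ] ℝ)) ∞ (fun x => S.covector (w x)) x₀ := by
  have hb : ContMDiffAt IM 𝓘(ℝ, E) ∞ b x₀ := (contMDiffAt_totalSpace.1 hw).1
  refine contMDiffAt_phaseSpace hb fun α => ?_
  refine S.contMDiffAt_inner (b := b) hw (S.contMDiffAt_incl ?_)
  exact ContMDiffAt.comp x₀ (smoothSectionAt_localFrame (D := D) E
    (FiberBundle.mem_baseSet_trivializationAt' (b x₀)) α) hb

end System

end Pairings

/-! ### Smoothness of the inverse Legendre transform. -/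

section Legendre

variable {E Q F : Type*} {D : Q → Type*}
  [NormedAddCommGroup E] [NormedSpace ℝ E]
  [TopologicalSpace Q] [ChartedSpace E Q] [IsManifold 𝓘(ℝ, E) ∞ Q]
  [NormedAddCommGroup F] [NormedSpace ℝ F] [FiniteDimensional ℝ F]
  [TopologicalSpace (TotalSpace F D)]
  [∀ q, AddCommGroup (D q)] [∀ q, Module ℝ (D q)] [∀ q, TopologicalSpace (D q)]
  [FiberBundle F D] [VectorBundle ℝ F D] [ContMDiffVectorBundle ∞ F D 𝓘(ℝ, E)]
  {EM HM M : Type*} [NormedAddCommGroup EM] [NormedSpace ℝ EM] [TopologicalSpace HM]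
  {IM : ModelWithCorners ℝ EM HM} [TopologicalSpace M] [ChartedSpace HM M]

/-- The component in the typical fibre, in a bundle chart of `D*`. -/
theorem trivializationAt_phaseSpace_eq {q₀ : Q} (p : PhaseSpace F D)
    (hp : p.proj ∈ (trivializationAt F D q₀).baseSet) :
    (trivializationAt (F →L[ℝ] ℝ) (fun q : Q => D q →L[ℝ] Bundle.Trivial Q ℝ q) q₀ p).2 =
      p.2.comp ((trivializationAt F D q₀).symmL ℝ p.proj) := by
  refine ContinuousLinearMap.coe_injective ((finBasis ℝ F).ext fun β => ?_)
  simp only [ContinuousLinearMap.coe_coe]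
  rw [trivializationAt_phaseSpace_apply _ hp, frame_eq_symmL hp]
  rfl

namespace System

variable (S : System E F D)

theorem inner_velocity (p : PhaseSpace F D) (u : D p.proj) :
    S.metric.inner p.proj (S.incl p.proj (S.velocity p)) (S.incl p.proj u) = p.2 u := by
  have h : S.legendre p.proj (S.velocity p) = p.2 := (S.legendre p.proj).apply_symm_apply p.2
  exact DFunLike.congr_fun h u

theorem velocity_eq_of_inner (p : PhaseSpace F D) (v : D p.proj)
    (h : ∀ u, S.metric.inner p.proj (S.incl p.proj v) (S.incl p.proj u) = p.2 u) :
    S.velocity p = v := by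
  rw [velocity, LinearEquiv.symm_apply_eq]
  ext u
  exact (h u).symm

theorem velocity_covector {q : Q} (v : D q) : S.velocity (S.covector (S.incl q v)) = v :=
  S.velocity_eq_of_inner (S.covector (S.incl q v)) v fun _ => rfl

/-- The Gram operator of the metric on `D` in a bundle chart of `D`. -/
def gram (q₀ q : Q) : F →L[ℝ] F →L[ℝ] ℝ :=
  ∑ α, ∑ β, S.metric.inner q (S.incl q (frame (F := F) q₀ α q)) (S.incl q (frame q₀ β q)) •
    (LinearMap.toContinuousLinearMap ((finBasis ℝ F).coord α)).smulRight
      (LinearMap.toContinuousLinearMap ((finBasis ℝ F).coord β))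

theorem gram_apply {q₀ q : Q} (hq : q ∈ (trivializationAt F D q₀).baseSet) (u w : F) :
    S.gram q₀ q u w = S.metric.inner q (S.incl q ((trivializationAt F D q₀).symmL ℝ q u))
      (S.incl q ((trivializationAt F D q₀).symmL ℝ q w)) := by
  conv_rhs => rw [← (finBasis ℝ F).sum_repr u, ← (finBasis ℝ F).sum_repr w]
  simp only [gram, _root_.sum_apply, _root_.smul_apply,
    ContinuousLinearMap.smulRight_apply, map_sum, map_smul, frame_eq_symmL hq, smul_eq_mul,
    LinearMap.coe_toContinuousLinearMap', Basis.coord_apply, Finset.mul_sum]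
  rw [Finset.sum_comm]
  refine Finset.sum_congr rfl fun α _ => Finset.sum_congr rfl fun β _ => ?_
  ring

theorem contMDiffAt_gram {q₀ : Q} : ContMDiffAt 𝓘(ℝ, E) 𝓘(ℝ, F →L[ℝ] F →L[ℝ] ℝ) ∞
    (S.gram q₀) q₀ := by
  have hs := fun α => smoothSectionAt_localFrame (F := F) (D := D) E
    (FiberBundle.mem_baseSet_trivializationAt' q₀) α
  refine ContMDiffAt.sum fun α _ => ContMDiffAt.sum fun β _ => ?_
  exact (S.contMDiffAt_inner (S.contMDiffAt_incl (hs α)) (S.contMDiffAt_incl (hs β))).smul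
    contMDiffAt_const

/-- Positive definiteness on the image of `D` gives injectivity, and the typical fibre and its dual
have equal dimension. -/
theorem isInvertible_gram {q₀ q : Q} (hq : q ∈ (trivializationAt F D q₀).baseSet) :
    (S.gram q₀ q).IsInvertible := by
  have hinj : Function.Injective (S.gram q₀ q).toLinearMap := by
    rw [← LinearMap.ker_eq_bot, LinearMap.ker_eq_bot']
    intro u hu
    by_contra hne
    have h3 : S.gram q₀ q u u = 0 := by
      have := DFunLike.congr_fun hu u
      simpa using this
    rw [S.gram_apply hq] at h3
    have h1 : S.incl q ((trivializationAt F D q₀).symmL ℝ q u) ≠ 0 := fun h => hne (by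
      have h0 := S.incl_injective q (h.trans (map_zero (S.incl q)).symm)
      have h2 := (trivializationAt F D q₀).continuousLinearMapAt_symmL (R := ℝ) hq u
      rw [h0, map_zero] at h2
      exact h2.symm)
    exact (S.metric.pos q _ h1).ne' h3
  have hd : finrank ℝ F = finrank ℝ (F →L[ℝ] ℝ) := by
    rw [← (LinearMap.toContinuousLinearMap (𝕜 := ℝ) (E := F) (F' := ℝ)).finrank_eq]
    exact (Subspace.dual_finrank_eq).symm
  exact ⟨(LinearEquiv.ofInjectiveOfFinrankEq _ hinj hd).toContinuousLinearEquiv, by ext; rfl⟩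

/-- The inverse Legendre transform is smooth. -/
theorem contMDiff_velocity : ContMDiff (𝓘(ℝ, E).prod 𝓘(ℝ, F →L[ℝ] ℝ)) (𝓘(ℝ, E).prod 𝓘(ℝ, F)) ∞
    (fun p : PhaseSpace F D => (⟨p.proj, S.velocity p⟩ : TotalSpace F D)) := by
  intro p₀
  rw [contMDiffAt_totalSpace]
  refine ⟨contMDiffAt_proj _, ?_⟩
  set q₀ := p₀.proj with hq₀
  have hmem : q₀ ∈ (trivializationAt F D q₀).baseSet := FiberBundle.mem_baseSet_trivializationAt' q₀
  obtain ⟨e, he⟩ := S.isInvertible_gram hmem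
  have hinv : ContMDiffAt (𝓘(ℝ, E).prod 𝓘(ℝ, F →L[ℝ] ℝ)) 𝓘(ℝ, (F →L[ℝ] ℝ) →L[ℝ] F) ∞
      (fun p : PhaseSpace F D => (S.gram q₀ p.proj).inverse) p₀ := by
    have h1 : ContMDiffAt 𝓘(ℝ, F →L[ℝ] F →L[ℝ] ℝ) 𝓘(ℝ, (F →L[ℝ] ℝ) →L[ℝ] F) ∞
        ContinuousLinearMap.inverse (S.gram q₀ p₀.proj) := by
      rw [contMDiffAt_iff_contDiffAt, ← hq₀, ← he]
      exact contDiffAt_map_inverse e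
    exact h1.comp p₀ (S.contMDiffAt_gram.comp p₀ (contMDiffAt_proj _))
  have hp := (contMDiffAt_totalSpace.1
    (contMDiffAt_id (I := 𝓘(ℝ, E).prod 𝓘(ℝ, F →L[ℝ] ℝ)) (n := ∞) (x := p₀))).2
  refine (hinv.clm_apply hp).congr_of_eventuallyEq ?_
  have hev : ∀ᶠ p : PhaseSpace F D in 𝓝 p₀, p.proj ∈ (trivializationAt F D q₀).baseSet :=
    (FiberBundle.continuous_proj _ _).continuousAt.preimage_mem_nhds
      ((trivializationAt F D q₀).open_baseSet.mem_nhds hmem)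
  filter_upwards [hev] with p hp
  obtain ⟨e', he'⟩ := S.isInvertible_gram hp
  -- In the chart, v is the solution of Gram · v = π, so it is the inverse Gram operator applied to
  -- π; inversion of operators is smooth.
  have key : S.gram q₀ p.proj (trivializationAt F D q₀ ⟨p.proj, S.velocity p⟩).2 =
      (trivializationAt (F →L[ℝ] ℝ) (fun q : Q => D q →L[ℝ] Bundle.Trivial Q ℝ q) q₀ p).2 := by
    ext w
    rw [trivializationAt_phaseSpace_eq p hp, S.gram_apply hp]
    have h2 : (trivializationAt F D q₀).symmL ℝ p.proj
        (trivializationAt F D q₀ ⟨p.proj, S.velocity p⟩).2 = S.velocity p := by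
      have := (trivializationAt F D q₀).symmL_continuousLinearMapAt (R := ℝ) hp (S.velocity p)
      rwa [Trivialization.continuousLinearMapAt_apply_of_mem _ _ hp] at this
    rw [h2, S.inner_velocity]
    rfl
  simp only [id]
  rw [← hq₀, ← key, ← he', ContinuousLinearMap.inverse_equiv]
  simp

/-- The velocity, as a tangent vector of `Q`, is a smooth function on `D*`. -/
theorem contMDiffAt_incl_velocity (p : PhaseSpace F D) :
    ContMDiffAt (𝓘(ℝ, E).prod 𝓘(ℝ, F →L[ℝ] ℝ)) 𝓘(ℝ, E).tangent ∞
      (fun p : PhaseSpace F D =>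
        (⟨p.proj, S.incl p.proj (S.velocity p)⟩ : TangentBundle 𝓘(ℝ, E) Q)) p :=
  S.contMDiffAt_incl (S.contMDiff_velocity p)

/-- A section of `D` is smooth if it is smooth as a vector field. -/
theorem contMDiffAt_of_incl {b : M → Q} {u : ∀ x, D (b x)} {x₀ : M}
    (hu : ContMDiffAt IM 𝓘(ℝ, E).tangent ∞
      (fun x => (⟨b x, S.incl (b x) (u x)⟩ : TangentBundle 𝓘(ℝ, E) Q)) x₀) :
    ContMDiffAt IM (𝓘(ℝ, E).prod 𝓘(ℝ, F)) ∞ (fun x => (⟨b x, u x⟩ : TotalSpace F D)) x₀ := by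
  -- The section is recovered as Leg_c⁻¹ of its covector, which depends only on the vector field.
  have h := (S.contMDiff_velocity _).comp x₀ (S.contMDiffAt_covector hu)
  refine h.congr_of_eventuallyEq (Filter.Eventually.of_forall fun x => ?_)
  simp only [Function.comp_apply]
  exact congrArg (TotalSpace.mk (b x)) (S.velocity_covector (u x)).symm

end System

end Legendre

/-! ### Differentials of momenta and pulled-back functions; components of sections. -/

section Characterization

variable {E Q F : Type*} {D : Q → Type*}
  [NormedAddCommGroup E] [NormedSpace ℝ E]
  [TopologicalSpace Q] [ChartedSpace E Q] [IsManifold 𝓘(ℝ, E) ∞ Q]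
  [NormedAddCommGroup F] [NormedSpace ℝ F] [FiniteDimensional ℝ F]
  [TopologicalSpace (TotalSpace F D)]
  [∀ q, AddCommGroup (D q)] [∀ q, Module ℝ (D q)] [∀ q, TopologicalSpace (D q)]
  [FiberBundle F D] [VectorBundle ℝ F D] [ContMDiffVectorBundle ∞ F D 𝓘(ℝ, E)]
  {EM HM M : Type*} [NormedAddCommGroup EM] [NormedSpace ℝ EM] [TopologicalSpace HM]
  {IM : ModelWithCorners ℝ EM HM} [TopologicalSpace M] [ChartedSpace HM M]

theorem mvfderiv_sum_smul {ι : Type*} (s : Finset ι) (c : ι → ℝ) {f : ι → M → ℝ} {x : M}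
    (hf : ∀ i, MDifferentiableAt IM 𝓘(ℝ, ℝ) (f i) x) :
    mvfderiv IM (fun y => ∑ i ∈ s, c i * f i y) x = ∑ i ∈ s, c i • mvfderiv IM (f i) x := by
  have h : HasMFDerivAt IM 𝓘(ℝ, ℝ) (fun y => ∑ i ∈ s, c i * f i y) x
      (∑ i ∈ s, c i • mvfderiv IM (f i) x) := by
    classical
    induction s using Finset.induction_on with
    | empty => exact hasMFDerivAt_const (0 : ℝ) x
    | insert i s hi ih =>
      have e : (fun y => ∑ j ∈ insert i s, c j * f j y) =
          (c i • f i) + fun y => ∑ j ∈ s, c j * f j y := by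
        ext y
        simp [Finset.sum_insert hi]
      rw [e]
      exact (((hf i).hasMFDerivAt.const_smul (c i)).add ih).congr_mfderiv
        (Finset.sum_insert (f := fun j => c j • mvfderiv IM (f j) x) hi).symm
  exact h.mfderiv

/-- The differential of a function on `D*` along a map to `D*`. -/
theorem differential_mfderiv {f : PhaseSpace F D → ℝ} {c : M → PhaseSpace F D} {x : M}
    {p : PhaseSpace F D} (hp : c x = p)
    (hf : MDifferentiableAt (𝓘(ℝ, E).prod 𝓘(ℝ, F →L[ℝ] ℝ)) 𝓘(ℝ, ℝ) f p)
    (hc : MDifferentiableAt IM (𝓘(ℝ, E).prod 𝓘(ℝ, F →L[ℝ] ℝ)) c x) (w : TangentSpace IM x) :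
    differential E f p (mfderiv IM (𝓘(ℝ, E).prod 𝓘(ℝ, F →L[ℝ] ℝ)) c x w) =
      mvfderiv IM (f ∘ c) x w := by
  subst hp
  exact (mfderiv_comp_apply x hf hc w).symm

theorem mdifferentiableAt_proj (p : PhaseSpace F D) :
    MDifferentiableAt (𝓘(ℝ, E).prod 𝓘(ℝ, F →L[ℝ] ℝ)) 𝓘(ℝ, E)
      (fun x : PhaseSpace F D => x.proj) p :=
  (contMDiffAt_proj (n := ∞) (IB := 𝓘(ℝ, E)) (F := F →L[ℝ] ℝ)
    (E := fun q : Q => D q →L[ℝ] Bundle.Trivial Q ℝ q)).mdifferentiableAt (by simp)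

/-- The derivative of the projection of a map to `D*`. -/
theorem projDeriv_mfderiv {c : M → PhaseSpace F D} {x : M}
    {p : PhaseSpace F D} (hp : c x = p)
    (hc : MDifferentiableAt IM (𝓘(ℝ, E).prod 𝓘(ℝ, F →L[ℝ] ℝ)) c x) (w : TangentSpace IM x) :
    projDeriv E p (mfderiv IM (𝓘(ℝ, E).prod 𝓘(ℝ, F →L[ℝ] ℝ)) c x w) =
      mfderiv IM 𝓘(ℝ, E) (fun y => (c y).proj) x w := by
  subst hp
  exact (mfderiv_comp_apply x (mdifferentiableAt_proj _) hc w).symm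

/-- The differential of a function on `D*` which is pulled back from `Q`. -/
theorem differential_comp_proj {f : Q → ℝ} {p : PhaseSpace F D}
    (hf : MDifferentiableAt 𝓘(ℝ, E) 𝓘(ℝ, ℝ) f p.proj) (w : PhaseTangent E p) :
    differential E (fun x : PhaseSpace F D => f x.proj) p w =
      mvfderiv 𝓘(ℝ, E) f p.proj (projDeriv E p w) :=
  mfderiv_comp_apply p hf (mdifferentiableAt_proj p) w

theorem differential_congr {f h : PhaseSpace F D → ℝ} {p : PhaseSpace F D} (hfh : f =ᶠ[𝓝 p] h) :
    differential E f p = differential E h p := by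
  have := hfh.mfderiv_eq (I := 𝓘(ℝ, E).prod 𝓘(ℝ, F →L[ℝ] ℝ)) (I' := 𝓘(ℝ, ℝ))
  ext w
  exact DFunLike.congr_fun this w

/-- The component of the section `X` of `D` with respect to `frame q₀ α`. -/
def sectionCoeff (q₀ : Q) (X : ∀ q, D q) (α : Fin (finrank ℝ F)) (q : Q) : ℝ :=
  (finBasis ℝ F).coord α ((trivializationAt F D q₀).continuousLinearMapAt ℝ q (X q))

theorem sum_sectionCoeff_smul_frame {q₀ q : Q} (hq : q ∈ (trivializationAt F D q₀).baseSet)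
    (X : ∀ q, D q) :
    ∑ α, sectionCoeff (F := F) q₀ X α q • frame (F := F) q₀ α q = X q := by
  simp only [sectionCoeff, frame_eq_symmL hq, ← map_smul, ← map_sum, Basis.coord_apply]
  rw [(finBasis ℝ F).sum_repr]
  exact (trivializationAt F D q₀).symmL_continuousLinearMapAt (R := ℝ) hq (X q)

theorem eventually_mem_baseSet (q₀ : Q) :
    ∀ᶠ q in 𝓝 q₀, q ∈ (trivializationAt F D q₀).baseSet :=
  (trivializationAt F D q₀).open_baseSet.mem_nhds (FiberBundle.mem_baseSet_trivializationAt' q₀)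

theorem contMDiffAt_sectionCoeff {q₀ : Q} {X : ∀ q, D q} (hX : SmoothSectionAt E F X q₀)
    (α : Fin (finrank ℝ F)) :
    ContMDiffAt 𝓘(ℝ, E) 𝓘(ℝ, ℝ) ∞ (sectionCoeff (F := F) q₀ X α) q₀ := by
  have h1 := (contMDiffAt_totalSpace.1 hX).2
  have h2 : ContMDiffAt 𝓘(ℝ, F) 𝓘(ℝ, ℝ) ∞
      (LinearMap.toContinuousLinearMap ((finBasis ℝ F).coord α))
      (trivializationAt F D q₀ ⟨q₀, X q₀⟩).2 :=
    (ContinuousLinearMap.contDiff _).contMDiff.contMDiffAt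
  refine (h2.comp q₀ h1).congr_of_eventuallyEq ?_
  filter_upwards [eventually_mem_baseSet (F := F) (D := D) q₀] with q hq
  simp only [sectionCoeff, Trivialization.continuousLinearMapAt_apply_of_mem _ _ hq]
  rfl

theorem contMDiff_vertical_line (p : PhaseSpace F D)
    (l : D p.proj →L[ℝ] Bundle.Trivial Q ℝ p.proj) :
    ContMDiffAt 𝓘(ℝ, ℝ) (𝓘(ℝ, E).prod 𝓘(ℝ, F →L[ℝ] ℝ)) ∞
      (fun t : ℝ => (⟨p.proj, p.2 + t • l⟩ : PhaseSpace F D)) 0 := by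
  refine contMDiffAt_phaseSpace contMDiffAt_const fun α => ?_
  have : ContDiff ℝ ∞ (fun t : ℝ => (p.2 (frame (F := F) p.proj α p.proj) : ℝ) +
      t * (l (frame (F := F) p.proj α p.proj) : ℝ)) := by fun_prop
  exact this.contMDiff.contMDiffAt

/-- On the line t ↦ π + t l the function p_X is affine with slope l(X). -/
theorem differential_momentum_vertical {p : PhaseSpace F D} {X : ∀ q, D q}
    (hX : SmoothSectionAt E F X p.proj) (l : D p.proj →L[ℝ] Bundle.Trivial Q ℝ p.proj) :
    differential E (momentum X) p (vertical E p l) = l (X p.proj) := by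
  refine (differential_mfderiv (E := E) (p := p) (by simp)
    ((contMDiffAt_momentum hX).mdifferentiableAt (by simp))
    ((contMDiff_vertical_line p l).mdifferentiableAt (by simp)) _).trans ?_
  have h : HasDerivAt (fun t : ℝ => (p.2 (X p.proj) : ℝ) + t * (l (X p.proj) : ℝ))
      (1 * (l (X p.proj) : ℝ)) 0 :=
    ((hasDerivAt_id (0 : ℝ)).mul_const _).const_add _
  have h2 := h.hasFDerivAt.hasMFDerivAt.mfderiv
  have h3 := DFunLike.congr_fun h2 (1 : ℝ)
  refine Eq.trans ?_ (h3.trans ?_)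
  · rfl
  · exact (one_smul ℝ _).trans (one_mul (M := ℝ) _)

theorem differential_momentum_partialMomentum {p : PhaseSpace F D} {X : ∀ q, D q}
    (hX : SmoothSectionAt E F X p.proj) (α : Fin (finrank ℝ F)) :
    differential E (momentum X) p (partialMomentum E p α) =
      sectionCoeff (F := F) p.proj X α p.proj :=
  differential_momentum_vertical hX _

theorem constantSection_self (p : PhaseSpace F D) : constantSection p p.proj = p := by
  have h : (constantSection p p.proj).2 = p.2 := by
    ext u
    exact congrArg p.2 ((trivializationAt F D p.proj).symmL_continuousLinearMapAt (R := ℝ)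
      (FiberBundle.mem_baseSet_trivializationAt' p.proj) u)
  cases p
  exact congrArg (TotalSpace.mk _) h

theorem contMDiffAt_constantSection (p : PhaseSpace F D) :
    ContMDiffAt 𝓘(ℝ, E) (𝓘(ℝ, E).prod 𝓘(ℝ, F →L[ℝ] ℝ)) ∞ (constantSection p) p.proj := by
  refine contMDiffAt_phaseSpace contMDiffAt_id fun α => ?_
  refine (contMDiffAt_const (c := (p.2 ((trivializationAt F D p.proj).symmL ℝ p.proj
    (finBasis ℝ F α)) : ℝ))).congr_of_eventuallyEq ?_
  filter_upwards [eventually_mem_baseSet (F := F) (D := D) p.proj] with q hq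
  change p.2 ((trivializationAt F D p.proj).symmL ℝ p.proj
    ((trivializationAt F D p.proj).continuousLinearMapAt ℝ q (frame p.proj α q))) = _
  rw [frame_eq_symmL hq, Trivialization.continuousLinearMapAt_symmL _ hq]

/-- With the π_β frozen, only the components X^β vary, so differentiating p_X along this section
differentiates just these components. -/
theorem momentum_constantSection (p : PhaseSpace F D) (X : ∀ q, D q) (q : Q) :
    momentum X (constantSection p q) =
      ∑ β, (p.2 (frame (F := F) p.proj β p.proj) : ℝ) * sectionCoeff (F := F) p.proj X β q := by
  change p.2 ((trivializationAt F D p.proj).symmL ℝ p.proj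
    ((trivializationAt F D p.proj).continuousLinearMapAt ℝ q (X q))) = _
  conv_lhs => rw [← (finBasis ℝ F).sum_repr
    ((trivializationAt F D p.proj).continuousLinearMapAt ℝ q (X q))]
  rw [map_sum, map_sum]
  simp only [frame_eq_symmL (FiberBundle.mem_baseSet_trivializationAt' p.proj)]
  refine Finset.sum_congr rfl fun β _ => ?_
  rw [map_smul, map_smul]
  exact mul_comm _ _

/-- The summed Leibniz rule. Smoothness of the partial sums belongs to the induction because
additivity of the bracket requires it. -/
theorem mlieBracket_sum_smul_left [CompleteSpace E] {ι : Type*} (s : Finset ι) {f : ι → Q → ℝ}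
    {V : ι → ∀ q : Q, TangentSpace 𝓘(ℝ, E) q} (W : ∀ q : Q, TangentSpace 𝓘(ℝ, E) q) {q : Q}
    (hf : ∀ i, ContMDiffAt 𝓘(ℝ, E) 𝓘(ℝ, ℝ) ∞ (f i) q)
    (hV : ∀ i, SmoothFieldAt E (V i) q) :
    SmoothFieldAt E (fun x => ∑ i ∈ s, f i x • V i x) q ∧
    VectorField.mlieBracket 𝓘(ℝ, E) (fun x => ∑ i ∈ s, f i x • V i x) W q =
      ∑ i ∈ s, (f i q • VectorField.mlieBracket 𝓘(ℝ, E) (V i) W q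
        - mvfderiv 𝓘(ℝ, E) (f i) q (W q) • V i q) := by
  have : IsManifold 𝓘(ℝ, E) 2 Q := inferInstance
  have : ContMDiffVectorBundle ∞ E (TangentSpace 𝓘(ℝ, E) : Q → Type _) 𝓘(ℝ, E) :=
    inferInstance
  classical
  induction s using Finset.induction_on with
  | empty =>
    refine ⟨?_, ?_⟩
    · exact (contMDiff_zeroSection ℝ (TangentSpace 𝓘(ℝ, E) : Q → Type _)).contMDiffAt
    · exact congrFun (VectorField.mlieBracket_zero_left (I := 𝓘(ℝ, E)) (W := W)) q
  | insert i s hi ih =>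
    have hs : SmoothFieldAt E (f i • V i) q := (hf i).smul_section (hV i)
    have e : (fun x => ∑ j ∈ insert i s, f j x • V j x) =
        f i • V i + fun x => ∑ j ∈ s, f j x • V j x := by
      ext x
      simp [Finset.sum_insert hi]
    rw [e]
    refine ⟨hs.add_section ih.1, ?_⟩
    rw [VectorField.mlieBracket_add_left (hs.mdifferentiableAt (by simp))
      (ih.1.mdifferentiableAt (by simp)), ih.2, Finset.sum_insert hi,
      VectorField.mlieBracket_smul_left ((hf i).mdifferentiableAt (by simp))
      ((hV i).mdifferentiableAt (by simp))]
    congr 1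
    rw [neg_smul, neg_add_eq_sub]

end Characterization

/-! ### Frame-free formulas for the nonholonomic bivector. -/

section NonholonomicBivector

variable {E Q F : Type*} {D : Q → Type*}
  [NormedAddCommGroup E] [NormedSpace ℝ E]
  [TopologicalSpace Q] [ChartedSpace E Q] [IsManifold 𝓘(ℝ, E) ∞ Q]
  [NormedAddCommGroup F] [NormedSpace ℝ F] [FiniteDimensional ℝ F]
  [TopologicalSpace (TotalSpace F D)]
  [∀ q, AddCommGroup (D q)] [∀ q, Module ℝ (D q)] [∀ q, TopologicalSpace (D q)]
  [FiberBundle F D] [VectorBundle ℝ F D] [ContMDiffVectorBundle ∞ F D 𝓘(ℝ, E)]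

namespace System

variable (S : System E F D)

theorem nhSharp_apply (p : PhaseSpace F D) (b : Dual ℝ (PhaseTangent E p)) :
    S.nhSharp p b = ∑ α, (b (partialMomentum E p α) • S.partialBase p α -
        b (S.partialBase p α) • partialMomentum E p α) -
      ∑ α, ∑ β, S.structureTerm p α β • b (partialMomentum E p β) • partialMomentum E p α := by
  simp [nhSharp]

theorem smoothFieldAt_incl {X : ∀ q, D q} {q : Q} (hX : SmoothSectionAt E F X q) :
    SmoothFieldAt E (fun x => S.incl x (X x)) q :=
  S.contMDiffAt_incl hX

theorem smoothFieldAt_frameField (q₀ : Q) (α : Fin (finrank ℝ F)) :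
    SmoothFieldAt E (S.frameField q₀ α) q₀ :=
  S.smoothFieldAt_incl (smoothSectionAt_localFrame E
    (FiberBundle.mem_baseSet_trivializationAt' q₀) α)

theorem structureTerm_swap (p : PhaseSpace F D) (α β : Fin (finrank ℝ F)) :
    S.structureTerm p β α = -S.structureTerm p α β := by
  rw [structureTerm, VectorField.mlieBracket_swap_apply, map_neg]
  rfl

/-- The first sum consists of wedge products; the second is skew because the structure term is skew
in its two indices. -/
theorem nhSharp_skew (p : PhaseSpace F D) (a b : Dual ℝ (PhaseTangent E p)) :
    a (S.nhSharp p b) = -b (S.nhSharp p a) := by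
  simp only [nhSharp_apply, map_sub, map_sum, map_smul, smul_eq_mul, neg_sub]
  have h : ∑ α, ∑ β, S.structureTerm p α β *
        (a (partialMomentum E p β) * b (partialMomentum E p α)) =
      -∑ α, ∑ β, S.structureTerm p α β *
        (b (partialMomentum E p β) * a (partialMomentum E p α)) := by
    rw [Finset.sum_comm, ← Finset.sum_neg_distrib]
    refine Finset.sum_congr rfl fun α _ => ?_
    rw [← Finset.sum_neg_distrib]
    refine Finset.sum_congr rfl fun β _ => ?_
    rw [S.structureTerm_swap p α β]
    ring
  have h' : ∑ α, (b (partialMomentum E p α) * a (S.partialBase p α) -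
        b (S.partialBase p α) * a (partialMomentum E p α)) =
      -∑ α, (a (partialMomentum E p α) * b (S.partialBase p α) -
        a (S.partialBase p α) * b (partialMomentum E p α)) := by
    rw [← Finset.sum_neg_distrib]
    exact Finset.sum_congr rfl fun α _ => by ring
  rw [h, h']
  ring

/-- Holds because `constantSection p` is a section of τ. -/
theorem projDeriv_partialBase (p : PhaseSpace F D) (α : Fin (finrank ℝ F)) :
    projDeriv E p (S.partialBase p α) = S.frameField p.proj α p.proj := by
  refine (projDeriv_mfderiv (E := E) (constantSection_self p)
    ((contMDiffAt_constantSection p).mdifferentiableAt (by simp)) _).trans ?_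
  change mfderiv 𝓘(ℝ, E) 𝓘(ℝ, E) id p.proj _ = _
  rw [mfderiv_id]
  rfl

theorem differential_momentum_partialBase {p : PhaseSpace F D} {X : ∀ q, D q}
    (hX : SmoothSectionAt E F X p.proj) (α : Fin (finrank ℝ F)) :
    differential E (momentum X) p (S.partialBase p α) =
      ∑ β, (p.2 (frame (F := F) p.proj β p.proj) : ℝ) *
        mvfderiv 𝓘(ℝ, E) (sectionCoeff (F := F) p.proj X β) p.proj
          (S.frameField p.proj α p.proj) := by
  refine (differential_mfderiv (E := E) (constantSection_self p)
    ((contMDiffAt_momentum hX).mdifferentiableAt (by simp))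
    ((contMDiffAt_constantSection p).mdifferentiableAt (by simp)) _).trans ?_
  have e : momentum X ∘ constantSection p = fun q => ∑ β,
      (p.2 (frame (F := F) p.proj β p.proj) : ℝ) * sectionCoeff (F := F) p.proj X β q :=
    funext fun q => momentum_constantSection p X q
  rw [e, mvfderiv_sum_smul _ _ fun β => (contMDiffAt_sectionCoeff hX β).mdifferentiableAt (by simp)]
  simp

/-- The projection of `Π_nh^♯(b)` to `Q` takes its values in `D`. -/
theorem projDeriv_nhSharp (p : PhaseSpace F D) (b : Dual ℝ (PhaseTangent E p)) :
    projDeriv E p (S.nhSharp p b) =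
      ∑ α, b (partialMomentum E p α) • S.frameField p.proj α p.proj := by
  simp [nhSharp_apply, projDeriv_partialMomentum, projDeriv_partialBase]

theorem sum_sectionCoeff_smul_frameField (X : ∀ q, D q) {q₀ q : Q}
    (hq : q ∈ (trivializationAt F D q₀).baseSet) :
    ∑ α, sectionCoeff (F := F) q₀ X α q • S.frameField q₀ α q = S.incl q (X q) := by
  simp only [frameField, ← map_smul, ← map_sum]
  rw [sum_sectionCoeff_smul_frame hq]

theorem projDeriv_nhSharp_momentum {p : PhaseSpace F D} {X : ∀ q, D q}
    (hX : SmoothSectionAt E F X p.proj) :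
    projDeriv E p (S.nhSharp p (differential E (momentum X) p)) = S.incl p.proj (X p.proj) := by
  rw [projDeriv_nhSharp]
  simp only [differential_momentum_partialMomentum hX]
  exact S.sum_sectionCoeff_smul_frameField X (FiberBundle.mem_baseSet_trivializationAt' p.proj)

/-- The horizontal part of Π_nh^♯(b) is weighted by the values of b on the ∂/∂π_α, which vanish for
a covector pulled back from `Q`. -/
theorem projDeriv_nhSharp_comp_proj {p : PhaseSpace F D} {f : Q → ℝ}
    (hf : MDifferentiableAt 𝓘(ℝ, E) 𝓘(ℝ, ℝ) f p.proj) :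
    projDeriv E p (S.nhSharp p (differential E (fun x : PhaseSpace F D => f x.proj) p)) = 0 := by
  rw [projDeriv_nhSharp]
  simp only [differential_comp_proj hf, projDeriv_partialMomentum, map_zero, zero_smul,
    Finset.sum_const_zero]

variable [CompleteSpace E]

theorem mlieBracket_incl_left {X : ∀ q, D q} (W : ∀ q : Q, TangentSpace 𝓘(ℝ, E) q) {q₀ : Q}
    (hX : SmoothSectionAt E F X q₀) :
    VectorField.mlieBracket 𝓘(ℝ, E) (fun x => S.incl x (X x)) W q₀ =
      ∑ α, (sectionCoeff (F := F) q₀ X α q₀ •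
          VectorField.mlieBracket 𝓘(ℝ, E) (S.frameField q₀ α) W q₀ -
        mvfderiv 𝓘(ℝ, E) (sectionCoeff (F := F) q₀ X α) q₀ (W q₀) • S.frameField q₀ α q₀) := by
  rw [← (mlieBracket_sum_smul_left Finset.univ W (contMDiffAt_sectionCoeff hX)
    (S.smoothFieldAt_frameField q₀)).2]
  refine Filter.EventuallyEq.mlieBracket_vectorField_eq ?_ Filter.EventuallyEq.rfl
  filter_upwards [eventually_mem_baseSet (F := F) (D := D) q₀] with q hq
  exact (S.sum_sectionCoeff_smul_frameField X hq).symm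

/-- Expansion of both sections in the frame, with the Leibniz rule in each slot and ⟨X_α, v⟩ = π_α;
the result is to be matched with the coordinate form of the bracket {p_X, p_Y}. -/
theorem inner_mlieBracket_incl {X Y : ∀ q, D q} {p : PhaseSpace F D}
    (hX : SmoothSectionAt E F X p.proj) (hY : SmoothSectionAt E F Y p.proj) :
    S.metric.inner p.proj (VectorField.mlieBracket 𝓘(ℝ, E) (fun x => S.incl x (X x))
        (fun x => S.incl x (Y x)) p.proj) (S.incl p.proj (S.velocity p)) =
      ∑ α, ∑ β, (sectionCoeff (F := F) p.proj X α p.proj *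
          (sectionCoeff (F := F) p.proj Y β p.proj * S.structureTerm p α β +
            mvfderiv 𝓘(ℝ, E) (sectionCoeff (F := F) p.proj Y β) p.proj
              (S.frameField p.proj α p.proj) * (p.2 (frame (F := F) p.proj β p.proj) : ℝ)) -
        sectionCoeff (F := F) p.proj Y β p.proj *
          mvfderiv 𝓘(ℝ, E) (sectionCoeff (F := F) p.proj X α) p.proj
            (S.frameField p.proj β p.proj) * (p.2 (frame (F := F) p.proj α p.proj) : ℝ)) := by
  have hpair : ∀ α, S.metric.inner p.proj (S.frameField p.proj α p.proj)
      (S.incl p.proj (S.velocity p)) = (p.2 (frame (F := F) p.proj α p.proj) : ℝ) := fun α => by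
    rw [S.metric.symm]
    exact S.inner_velocity p _
  have hY0 := S.sum_sectionCoeff_smul_frameField Y
    (FiberBundle.mem_baseSet_trivializationAt' (F := F) (E := D) p.proj)
  have hright : ∀ α, S.metric.inner p.proj (VectorField.mlieBracket 𝓘(ℝ, E)
        (S.frameField p.proj α) (fun x => S.incl x (Y x)) p.proj)
        (S.incl p.proj (S.velocity p)) =
      ∑ β, (sectionCoeff (F := F) p.proj Y β p.proj * S.structureTerm p α β +
        mvfderiv 𝓘(ℝ, E) (sectionCoeff (F := F) p.proj Y β) p.proj
          (S.frameField p.proj α p.proj) * (p.2 (frame (F := F) p.proj β p.proj) : ℝ)) := by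
    intro α
    rw [VectorField.mlieBracket_swap_apply, S.mlieBracket_incl_left _ hY, map_neg, map_sum]
    simp only [map_sub, map_smul, _root_.neg_apply, _root_.sum_apply,
      _root_.sub_apply, _root_.smul_apply, smul_eq_mul, hpair, ← Finset.sum_neg_distrib]
    refine Finset.sum_congr rfl fun β _ => ?_
    have h := S.structureTerm_swap p α β
    rw [structureTerm] at h
    rw [h]
    ring
  rw [S.mlieBracket_incl_left _ hX, map_sum]
  simp only [map_sub, map_smul, _root_.sum_apply, _root_.sub_apply, _root_.smul_apply,
    smul_eq_mul, hpair, hright]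
  refine Finset.sum_congr rfl fun α _ => ?_
  rw [← hY0]
  simp only [map_sum, map_smul, smul_eq_mul, Finset.mul_sum, Finset.sum_mul,
    ← Finset.sum_sub_distrib]

/-- The nonholonomic bracket `{p_X, p_Y} = -⟨[X, Y], v⟩` of the momenta of two sections. -/
theorem differential_momentum_nhSharp_momentum {X Y : ∀ q, D q} {p : PhaseSpace F D}
    (hX : SmoothSectionAt E F X p.proj) (hY : SmoothSectionAt E F Y p.proj) :
    differential E (momentum X) p (S.nhSharp p (differential E (momentum Y) p)) =
      -S.metric.inner p.proj (VectorField.mlieBracket 𝓘(ℝ, E) (fun x => S.incl x (X x))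
        (fun x => S.incl x (Y x)) p.proj) (S.incl p.proj (S.velocity p)) := by
  rw [S.inner_mlieBracket_incl hX hY]
  simp only [nhSharp_apply, map_sub, map_sum, map_smul, smul_eq_mul,
    differential_momentum_partialMomentum hX, differential_momentum_partialMomentum hY,
    S.differential_momentum_partialBase hX, S.differential_momentum_partialBase hY]
  -- Exchanging the names of the indices puts the derivatives of the X^α in the form in which they
  -- occur in dp_X(X_α).
  have h : ∑ α, ∑ β, sectionCoeff (F := F) p.proj Y β p.proj *
          mvfderiv 𝓘(ℝ, E) (sectionCoeff (F := F) p.proj X α) p.proj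
            (S.frameField p.proj β p.proj) * (p.2 (frame (F := F) p.proj α p.proj) : ℝ) =
      ∑ α, sectionCoeff (F := F) p.proj Y α p.proj *
        ∑ β, (p.2 (frame (F := F) p.proj β p.proj) : ℝ) *
          mvfderiv 𝓘(ℝ, E) (sectionCoeff (F := F) p.proj X β) p.proj
            (S.frameField p.proj α p.proj) := by
    rw [Finset.sum_comm]
    refine Finset.sum_congr rfl fun α _ => ?_
    rw [Finset.mul_sum]
    exact Finset.sum_congr rfl fun β _ => by ring
  simp only [Finset.sum_sub_distrib, h, neg_sub, mul_add, Finset.sum_add_distrib]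
  rw [sub_sub]
  congr 1
  rw [add_comm]
  congr 1
  · exact Finset.sum_congr rfl fun α _ => Finset.sum_congr rfl fun β _ => by ring
  · refine Finset.sum_congr rfl fun α _ => ?_
    rw [Finset.sum_mul]
    exact Finset.sum_congr rfl fun β _ => by ring

end System

end NonholonomicBivector

/-! ### Derivatives of smooth families of maps. -/

section TangentMaps

variable {EM HM M : Type*} [NormedAddCommGroup EM] [NormedSpace ℝ EM] [TopologicalSpace HM]
  {IM : ModelWithCorners ℝ EM HM} [TopologicalSpace M] [ChartedSpace HM M]
  {EN HN N : Type*} [NormedAddCommGroup EN] [NormedSpace ℝ EN] [TopologicalSpace HN]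
  {IN : ModelWithCorners ℝ EN HN} [TopologicalSpace N] [ChartedSpace HN N] [IsManifold IN ∞ N]
  {EP HP P : Type*} [NormedAddCommGroup EP] [NormedSpace ℝ EP] [TopologicalSpace HP]
  {IP : ModelWithCorners ℝ EP HP} [TopologicalSpace P] [ChartedSpace HP P] [IsManifold IP ∞ P]

/-- The derivative of a smooth family of maps, applied to a smooth family of vectors, is smooth. -/
theorem contMDiffAt_mfderiv_apply {f : M → N → P} {b : M → N} {v : ∀ x, TangentSpace IN (b x)}
    {x₀ : M} [IsManifold IM ∞ M]
    (hf : ContMDiffAt (IM.prod IN) IP ∞ (Function.uncurry f) (x₀, b x₀))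
    (hv : ContMDiffAt IM IN.tangent ∞ (fun x => (⟨b x, v x⟩ : TangentBundle IN N)) x₀) :
    ContMDiffAt IM IP.tangent ∞
      (fun x => (⟨f x (b x), mfderiv IN IP (f x) (b x) (v x)⟩ : TangentBundle IP P)) x₀ := by
  have : IsManifold IN 1 N := inferInstance
  have : IsManifold IP 1 P := inferInstance
  have hb : ContMDiffAt IM IN ∞ b x₀ := (contMDiffAt_totalSpace.1 hv).1
  exact ContMDiffAt.clm_apply_of_inCoordinates (F₁ := EN) (F₂ := EP) (b₁ := b)
    (E₁ := TangentSpace IN) (E₂ := TangentSpace IP) (b₂ := fun x => f x (b x))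
    (ϕ := fun x => mfderiv IN IP (f x) (b x)) (v := v)
    (hf.mfderiv f b hb (by simp)) hv (hf.comp x₀ (contMDiffAt_id.prodMk hb))

theorem contMDiffAt_mvfderiv_apply {f : N → ℝ} {X : ∀ x : N, TangentSpace IN x} {x₀ : N}
    (hf : ContMDiffAt IN 𝓘(ℝ, ℝ) ∞ f x₀)
    (hX : ContMDiffAt IN IN.tangent ∞ (fun x => (⟨x, X x⟩ : TangentBundle IN N)) x₀) :
    ContMDiffAt IN 𝓘(ℝ, ℝ) ∞ (fun x => mvfderiv IN f x (X x)) x₀ := by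
  have h := contMDiffAt_mfderiv_apply (IP := 𝓘(ℝ, ℝ)) (f := fun _ : N => f) (b := id) (v := X)
    (hf.comp (x₀, x₀) contMDiffAt_snd) hX
  have h2 := (contMDiffAt_totalSpace.1 h).2
  simp only [trivializationAt_model_space_apply] at h2
  exact h2

end TangentMaps

/-! ### Sign rules for three-forms. -/

section ThreeForm

variable {V : Type*} [AddCommGroup V] [Module ℝ V] [TopologicalSpace V]

theorem threeForm_swap_right (Λ : V [⋀^Fin 3]→L[ℝ] ℝ) (x y z : V) :
    Λ ![x, y, z] = -Λ ![x, z, y] := by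
  refine Eq.trans ?_ (Λ.map_swap ![x, z, y] (i := 1) (j := 2) (by decide))
  change Λ _ = Λ _
  congr 1
  ext i
  fin_cases i <;> rfl

theorem threeForm_swap_left (Λ : V [⋀^Fin 3]→L[ℝ] ℝ) (x y z : V) :
    Λ ![x, y, z] = -Λ ![y, x, z] := by
  refine Eq.trans ?_ (Λ.map_swap ![y, x, z] (i := 0) (j := 1) (by decide))
  change Λ _ = Λ _
  congr 1
  ext i
  fin_cases i <;> rfl

end ThreeForm

/-! ### The gauge transformed bivector and its three basic brackets. -/

section Gauge

variable {E Q F : Type*} {D : Q → Type*}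
  [NormedAddCommGroup E] [NormedSpace ℝ E]
  [TopologicalSpace Q] [ChartedSpace E Q] [IsManifold 𝓘(ℝ, E) ∞ Q]
  [NormedAddCommGroup F] [NormedSpace ℝ F] [FiniteDimensional ℝ F]
  [TopologicalSpace (TotalSpace F D)]
  [∀ q, AddCommGroup (D q)] [∀ q, Module ℝ (D q)] [∀ q, TopologicalSpace (D q)]
  [FiberBundle F D] [VectorBundle ℝ F D] [ContMDiffVectorBundle ∞ F D 𝓘(ℝ, E)]
  (S : System E F D) (Λ : ∀ q : Q, TangentSpace 𝓘(ℝ, E) q [⋀^Fin 3]→L[ℝ] ℝ)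

namespace System

/-- With N = Π_nh^♯ ∘ Ξ^♭, the image of N is vertical (`h0`) and Ξ^♭ kills it (`h1`), so N² = 0 and
the inverse of Id + N is Id - N. -/
theorem gaugeSharp_apply (p : PhaseSpace F D) (b : Dual ℝ (PhaseTangent E p)) :
    S.gaugeSharp Λ p b = S.nhSharp p b - S.nhSharp p (S.xiFlat Λ p (S.nhSharp p b)) := by
  have h0 : ∀ a : PhaseTangent E p, projDeriv E p (S.nhSharp p (S.xiFlat Λ p a)) = 0 := by
    intro a
    rw [projDeriv_nhSharp]
    refine Finset.sum_eq_zero fun α _ => ?_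
    rw [xiFlat_apply, projDeriv_partialMomentum, (Λ p.proj).map_coord_zero 1 (by simp), zero_smul]
  have h1 : ∀ a : PhaseTangent E p, S.xiFlat Λ p (S.nhSharp p (S.xiFlat Λ p a)) = 0 := by
    intro a
    ext b
    rw [xiFlat_apply, h0]
    exact (Λ p.proj).map_coord_zero 2 (by simp)
  set w := S.nhSharp p b - S.nhSharp p (S.xiFlat Λ p (S.nhSharp p b)) with hw
  have h2 : S.gaugeEndomorphism Λ p w = S.nhSharp p b := by
    simp [gaugeEndomorphism, hw, h1]
  have h3 : ((S.isUnit_gaugeEndomorphism Λ p).unit⁻¹ : (Module.End ℝ (PhaseTangent E p))ˣ).val *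
      S.gaugeEndomorphism Λ p = 1 := (S.isUnit_gaugeEndomorphism Λ p).val_inv_mul
  change ((S.isUnit_gaugeEndomorphism Λ p).unit⁻¹ : (Module.End ℝ (PhaseTangent E p))ˣ).val
    (S.nhSharp p b) = w
  rw [← h2, ← Module.End.mul_apply, h3, Module.End.one_apply]

/-- The gauge transformed bivector in terms of the nonholonomic one. -/
theorem apply_gaugeSharp (p : PhaseSpace F D) (a b : Dual ℝ (PhaseTangent E p)) :
    a (S.gaugeSharp Λ p b) = a (S.nhSharp p b) +
      Λ p.proj ![S.incl p.proj (S.velocity p), projDeriv E p (S.nhSharp p a),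
        projDeriv E p (S.nhSharp p b)] := by
  -- Skew-symmetry moves the outer Π_nh^♯ onto a; what remains is a value of Ξ, which sees its
  -- arguments only through Tτ.
  rw [gaugeSharp_apply, map_sub, S.nhSharp_skew p a (S.xiFlat Λ p (S.nhSharp p b)), sub_neg_eq_add,
    xiFlat_apply]

theorem gaugeSharp_skew (p : PhaseSpace F D) (a b : Dual ℝ (PhaseTangent E p)) :
    a (S.gaugeSharp Λ p b) = -b (S.gaugeSharp Λ p a) := by
  rw [apply_gaugeSharp, apply_gaugeSharp, S.nhSharp_skew p a b, neg_add]
  congr 1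
  exact threeForm_swap_right _ _ _ _

variable {S} {p : PhaseSpace F D}

/-- Together with the next two lemmas this gives all brackets of pulled-back functions and momenta.
The correction by Λ drops out as soon as one of the two functions is pulled back, since its
Hamiltonian vector is then vertical. -/
theorem gaugeSharp_comp_proj_comp_proj {f h : Q → ℝ}
    (hf : MDifferentiableAt 𝓘(ℝ, E) 𝓘(ℝ, ℝ) f p.proj)
    (hh : MDifferentiableAt 𝓘(ℝ, E) 𝓘(ℝ, ℝ) h p.proj) :
    differential E (fun x : PhaseSpace F D => f x.proj) p
      (S.gaugeSharp Λ p (differential E (fun x : PhaseSpace F D => h x.proj) p)) = 0 := by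
  rw [apply_gaugeSharp, differential_comp_proj hf, S.projDeriv_nhSharp_comp_proj hh, map_zero,
    zero_add]
  exact (Λ p.proj).map_coord_zero 2 (by simp)

theorem gaugeSharp_comp_proj_momentum {f : Q → ℝ} {X : ∀ q, D q}
    (hf : MDifferentiableAt 𝓘(ℝ, E) 𝓘(ℝ, ℝ) f p.proj) (hX : SmoothSectionAt E F X p.proj) :
    differential E (fun x : PhaseSpace F D => f x.proj) p
      (S.gaugeSharp Λ p (differential E (momentum X) p)) =
      mvfderiv 𝓘(ℝ, E) f p.proj (S.incl p.proj (X p.proj)) := by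
  rw [apply_gaugeSharp, differential_comp_proj hf, S.projDeriv_nhSharp_momentum hX,
    S.projDeriv_nhSharp_comp_proj hf, add_eq_left]
  exact (Λ p.proj).map_coord_zero 1 (by simp)

theorem gaugeSharp_momentum_momentum [CompleteSpace E] {X Y : ∀ q, D q}
    (hX : SmoothSectionAt E F X p.proj) (hY : SmoothSectionAt E F Y p.proj) :
    differential E (momentum X) p (S.gaugeSharp Λ p (differential E (momentum Y) p)) =
      -S.metric.inner p.proj (VectorField.mlieBracket 𝓘(ℝ, E) (fun x => S.incl x (X x))
        (fun x => S.incl x (Y x)) p.proj) (S.incl p.proj (S.velocity p)) +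
      Λ p.proj ![S.incl p.proj (S.velocity p), S.incl p.proj (X p.proj),
        S.incl p.proj (Y p.proj)] := by
  rw [apply_gaugeSharp, S.differential_momentum_nhSharp_momentum hX hY,
    S.projDeriv_nhSharp_momentum hX, S.projDeriv_nhSharp_momentum hY]

end System

end Gauge

/-! ### Coordinate functions on `D*` and expansion of covectors. -/

section ChartFunctions

variable {E Q F : Type*} {D : Q → Type*}
  [NormedAddCommGroup E] [NormedSpace ℝ E] [FiniteDimensional ℝ E]
  [TopologicalSpace Q] [ChartedSpace E Q] [IsManifold 𝓘(ℝ, E) ∞ Q]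
  [NormedAddCommGroup F] [NormedSpace ℝ F] [FiniteDimensional ℝ F]
  [TopologicalSpace (TotalSpace F D)]
  [∀ q, AddCommGroup (D q)] [∀ q, Module ℝ (D q)] [∀ q, TopologicalSpace (D q)]
  [FiberBundle F D] [VectorBundle ℝ F D] [ContMDiffVectorBundle ∞ F D 𝓘(ℝ, E)]

variable (E F) in
/-- The coordinate functions on the model space of `D*`. -/
def chartCoord : Fin (finrank ℝ E) ⊕ Fin (finrank ℝ F) → E × (F →L[ℝ] ℝ) →L[ℝ] ℝ :=
  Sum.elim
    (fun i => (LinearMap.toContinuousLinearMap ((finBasis ℝ E).coord i)).comp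
      (ContinuousLinearMap.fst ℝ E (F →L[ℝ] ℝ)))
    (fun α => (ContinuousLinearMap.apply ℝ ℝ (finBasis ℝ F α)).comp
      (ContinuousLinearMap.snd ℝ E (F →L[ℝ] ℝ)))

variable (E F) in
/-- The coordinate vectors of the model space of `D*`. -/
def chartVec : Fin (finrank ℝ E) ⊕ Fin (finrank ℝ F) → E × (F →L[ℝ] ℝ) :=
  Sum.elim (fun i => (finBasis ℝ E i, 0))
    (fun α => (0, LinearMap.toContinuousLinearMap ((finBasis ℝ F).coord α)))

theorem sum_chartCoord_smul_chartVec (x : E × (F →L[ℝ] ℝ)) :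
    ∑ j, chartCoord E F j x • chartVec E F j = x := by
  obtain ⟨y, l⟩ := x
  rw [Fintype.sum_sum_type]
  have h1 : ∑ i, chartCoord E F (.inl i) (y, l) • chartVec E F (.inl i) = (y, 0) := by
    simp only [chartCoord, chartVec, Sum.elim_inl, Prod.smul_mk, smul_zero]
    refine Prod.ext ?_ ?_
    · simp [Prod.fst_sum, (finBasis ℝ E).sum_repr]
    · simp [Prod.snd_sum]
  have h2 : ∑ α, chartCoord E F (.inr α) (y, l) • chartVec E F (.inr α) = (0, l) := by
    simp only [chartCoord, chartVec, Sum.elim_inr, Prod.smul_mk, smul_zero]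
    refine Prod.ext (by simp [Prod.fst_sum]) ?_
    rw [Prod.snd_sum]
    refine ContinuousLinearMap.coe_injective ((finBasis ℝ F).ext fun β => ?_)
    simp [Finsupp.single_apply]
  rw [h1, h2]
  simp

theorem map_eq_sum_chartCoord_mul (L : E × (F →L[ℝ] ℝ) →ₗ[ℝ] ℝ) (x : E × (F →L[ℝ] ℝ)) :
    L x = ∑ j, L (chartVec E F j) * chartCoord E F j x := by
  conv_lhs => rw [← sum_chartCoord_smul_chartVec x]
  simp only [map_sum, map_smul, smul_eq_mul]
  exact Finset.sum_congr rfl fun j _ => mul_comm _ _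

variable (E) in
/-- The coordinate functions on `D*` near the fibre over `q₀`: the coordinates of the base point and
the momenta of the frame at `q₀`. -/
def chartFun (q₀ : Q) : Fin (finrank ℝ E) ⊕ Fin (finrank ℝ F) → PhaseSpace F D → ℝ :=
  Sum.elim (fun i p => (finBasis ℝ E).coord i (extChartAt 𝓘(ℝ, E) q₀ p.proj))
    (fun α => momentum (frame q₀ α))

theorem mem_chartAt_source_iff {p₀ p : PhaseSpace F D} :
    p ∈ (chartAt (ModelProd E (F →L[ℝ] ℝ)) p₀).source ↔
      p.proj ∈ (trivializationAt F D p₀.proj).baseSet ∧ p.proj ∈ (chartAt E p₀.proj).source := by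
  rw [FiberBundle.chartedSpace_chartAt]
  simp [hom_trivializationAt_apply]

theorem chartCoord_extChartAt {p₀ p : PhaseSpace F D}
    (hp : p.proj ∈ (trivializationAt F D p₀.proj).baseSet)
    (j : Fin (finrank ℝ E) ⊕ Fin (finrank ℝ F)) :
    chartCoord E F j (extChartAt (𝓘(ℝ, E).prod 𝓘(ℝ, F →L[ℝ] ℝ)) p₀ p) = chartFun E p₀.proj j p := by
  rw [FiberBundle.extChartAt]
  cases j with
  | inl i => simp [chartCoord, chartFun, hom_trivializationAt_apply]
  | inr α => exact trivializationAt_phaseSpace_apply p hp α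

theorem mdifferentiableAt_extChartAt_phaseSpace {p₀ p : PhaseSpace F D}
    (hp : p ∈ (chartAt (ModelProd E (F →L[ℝ] ℝ)) p₀).source) :
    MDifferentiableAt (𝓘(ℝ, E).prod 𝓘(ℝ, F →L[ℝ] ℝ)) 𝓘(ℝ, E × (F →L[ℝ] ℝ))
      (extChartAt (𝓘(ℝ, E).prod 𝓘(ℝ, F →L[ℝ] ℝ)) p₀) p :=
  mdifferentiableAt_extChartAt hp

theorem chartFun_eventuallyEq {p₀ p : PhaseSpace F D}
    (hp : p ∈ (chartAt (ModelProd E (F →L[ℝ] ℝ)) p₀).source)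
    (j : Fin (finrank ℝ E) ⊕ Fin (finrank ℝ F)) :
    chartFun E p₀.proj j =ᶠ[𝓝 p]
      chartCoord E F j ∘ extChartAt (𝓘(ℝ, E).prod 𝓘(ℝ, F →L[ℝ] ℝ)) p₀ := by
  filter_upwards [(chartAt (ModelProd E (F →L[ℝ] ℝ)) p₀).open_source.mem_nhds hp] with p' hp'
  exact (chartCoord_extChartAt (mem_chartAt_source_iff.1 hp').1 j).symm

theorem differential_chartFun {p₀ p : PhaseSpace F D}
    (hp : p ∈ (chartAt (ModelProd E (F →L[ℝ] ℝ)) p₀).source)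
    (j : Fin (finrank ℝ E) ⊕ Fin (finrank ℝ F)) (w : PhaseTangent E p) :
    differential E (chartFun E p₀.proj j) p w =
      chartCoord E F j (mfderiv (𝓘(ℝ, E).prod 𝓘(ℝ, F →L[ℝ] ℝ)) 𝓘(ℝ, E × (F →L[ℝ] ℝ))
        (extChartAt (𝓘(ℝ, E).prod 𝓘(ℝ, F →L[ℝ] ℝ)) p₀) p w) := by
  rw [differential_congr (chartFun_eventuallyEq hp j)]
  have h1 : MDifferentiableAt 𝓘(ℝ, E × (F →L[ℝ] ℝ)) 𝓘(ℝ, ℝ) (chartCoord E F j)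
      (extChartAt (𝓘(ℝ, E).prod 𝓘(ℝ, F →L[ℝ] ℝ)) p₀ p) :=
    (chartCoord E F j).differentiableAt.mdifferentiableAt
  refine (mfderiv_comp_apply p h1 (mdifferentiableAt_extChartAt_phaseSpace hp) w).trans ?_
  rw [mfderiv_eq_fderiv, ContinuousLinearMap.fderiv]
  rfl

/-- The differentials of the coordinate functions span the cotangent spaces of `D*`. -/
theorem exists_eq_sum_differential_chartFun (p : PhaseSpace F D) (b : Dual ℝ (PhaseTangent E p)) :
    ∃ c : Fin (finrank ℝ E) ⊕ Fin (finrank ℝ F) → ℝ,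
      b = ∑ j, c j • differential E (chartFun E p.proj j) p := by
  have : IsManifold (𝓘(ℝ, E).prod 𝓘(ℝ, F →L[ℝ] ℝ)) 1 (PhaseSpace F D) :=
    IsManifold.of_le (n := ∞) (by simp)
  -- The derivative of the chart is invertible, so b can be transported to the model space and
  -- expanded there in the dual basis.
  obtain ⟨A, hA⟩ := isInvertible_mfderiv_extChartAt (I := 𝓘(ℝ, E).prod 𝓘(ℝ, F →L[ℝ] ℝ))
    (mem_extChartAt_source (I := 𝓘(ℝ, E).prod 𝓘(ℝ, F →L[ℝ] ℝ)) p)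
  let L : E × (F →L[ℝ] ℝ) →ₗ[ℝ] ℝ := b ∘ₗ A.symm.toLinearMap
  refine ⟨fun j => L (chartVec E F j), ?_⟩
  ext w
  simp only [LinearMap.sum_apply, LinearMap.smul_apply, smul_eq_mul,
    differential_chartFun (mem_chart_source (ModelProd E (F →L[ℝ] ℝ)) p)]
  refine Eq.trans ?_ (map_eq_sum_chartCoord_mul L _)
  rw [← hA]
  exact congrArg b (A.symm_apply_apply w).symm

/-- The components of the differential of a smooth function on `D*` are smooth. -/
theorem IsSmooth.differential_eq_sum {f : PhaseSpace F D → ℝ} (hf : IsSmooth E f)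
    (p₀ : PhaseSpace F D) : ∃ a : Fin (finrank ℝ E) ⊕ Fin (finrank ℝ F) → PhaseSpace F D → ℝ,
      (∀ j, ContMDiffAt (𝓘(ℝ, E).prod 𝓘(ℝ, F →L[ℝ] ℝ)) 𝓘(ℝ, ℝ) ∞ (a j) p₀) ∧
      ∀ p ∈ (chartAt (ModelProd E (F →L[ℝ] ℝ)) p₀).source,
        differential E f p = ∑ j, a j p • differential E (chartFun E p₀.proj j) p := by
  set φ := extChartAt (𝓘(ℝ, E).prod 𝓘(ℝ, F →L[ℝ] ℝ)) p₀ with hφ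
  have hs : ContDiffOn ℝ ∞ (f ∘ φ.symm) φ.target :=
    (hf.comp_contMDiffOn (contMDiffOn_extChartAt_symm p₀)).contDiffOn
  have ht : IsOpen φ.target := isOpen_extChartAt_target p₀
  -- The coefficients are the partial derivatives of f in the chart at `p₀`. This chart stays fixed
  -- while p varies, which is what makes them smooth functions of p near `p₀`.
  refine ⟨fun j p => fderiv ℝ (f ∘ φ.symm) (φ p) (chartVec E F j), fun j => ?_, fun p hp => ?_⟩
  · have h1 : ContDiffAt ℝ ∞ (fun x => fderiv ℝ (f ∘ φ.symm) x (chartVec E F j)) (φ p₀) :=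
      ((hs.contDiffAt (ht.mem_nhds (mem_extChartAt_target p₀))).fderiv_right
        (by simp)).clm_apply contDiffAt_const
    exact h1.contMDiffAt.comp p₀ contMDiffAt_extChartAt
  · have hp' : p ∈ φ.source := by rwa [hφ, extChartAt_source]
    have hd : MDifferentiableAt 𝓘(ℝ, E × (F →L[ℝ] ℝ)) 𝓘(ℝ, ℝ) (f ∘ φ.symm) (φ p) :=
      ((hs.contDiffAt (ht.mem_nhds (φ.map_source hp'))).differentiableAt
        (by simp)).mdifferentiableAt
    have he : f =ᶠ[𝓝 p] (f ∘ φ.symm) ∘ φ := by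
      filter_upwards [(isOpen_extChartAt_source p₀).mem_nhds hp'] with x hx
      simp [φ.left_inv hx]
    ext w
    rw [differential_congr he]
    refine (mfderiv_comp_apply p hd (mdifferentiableAt_extChartAt_phaseSpace hp) w).trans ?_
    simp only [LinearMap.sum_apply, LinearMap.smul_apply, smul_eq_mul, differential_chartFun hp]
    rw [mfderiv_eq_fderiv]
    exact map_eq_sum_chartCoord_mul (fderiv ℝ (f ∘ φ.symm) (φ p)).toLinearMap _

end ChartFunctions

/-! ### Smoothness of the bracket. -/

section SmoothBracket

variable {E Q F : Type*} {D : Q → Type*}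
  [NormedAddCommGroup E] [NormedSpace ℝ E] [FiniteDimensional ℝ E]
  [TopologicalSpace Q] [ChartedSpace E Q] [IsManifold 𝓘(ℝ, E) ∞ Q]
  [NormedAddCommGroup F] [NormedSpace ℝ F] [FiniteDimensional ℝ F]
  [TopologicalSpace (TotalSpace F D)]
  [∀ q, AddCommGroup (D q)] [∀ q, Module ℝ (D q)] [∀ q, TopologicalSpace (D q)]
  [FiberBundle F D] [VectorBundle ℝ F D] [ContMDiffVectorBundle ∞ F D 𝓘(ℝ, E)]
  {EM HM M : Type*} [NormedAddCommGroup EM] [NormedSpace ℝ EM] [TopologicalSpace HM]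
  {IM : ModelWithCorners ℝ EM HM} [TopologicalSpace M] [ChartedSpace HM M]

omit [FiniteDimensional ℝ E] in
theorem IsSmoothThreeForm.contMDiffOn {Λ : ∀ q : Q, TangentSpace 𝓘(ℝ, E) q [⋀^Fin 3]→L[ℝ] ℝ}
    (hΛ : IsSmoothThreeForm Λ) {U : Set Q} (hU : IsOpen U)
    {X Y Z : ∀ q : Q, TangentSpace 𝓘(ℝ, E) q}
    (hX : ContMDiffOn 𝓘(ℝ, E) 𝓘(ℝ, E).tangent ∞
      (fun q => (⟨q, X q⟩ : TangentBundle 𝓘(ℝ, E) Q)) U)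
    (hY : ContMDiffOn 𝓘(ℝ, E) 𝓘(ℝ, E).tangent ∞
      (fun q => (⟨q, Y q⟩ : TangentBundle 𝓘(ℝ, E) Q)) U)
    (hZ : ContMDiffOn 𝓘(ℝ, E) 𝓘(ℝ, E).tangent ∞
      (fun q => (⟨q, Z q⟩ : TangentBundle 𝓘(ℝ, E) Q)) U) :
    ContMDiffOn 𝓘(ℝ, E) 𝓘(ℝ, ℝ) ∞ (fun q => Λ q ![X q, Y q, Z q]) U := by
  have h := hΛ U hU ![X, Y, Z] (fun i => by fin_cases i <;> assumption)
  convert h using 3 with q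
  ext i
  fin_cases i <;> rfl

/-- A three-form is linear in its first argument. -/
theorem threeForm_sum_left {V ι : Type*} [AddCommGroup V] [Module ℝ V] [TopologicalSpace V]
    (Λ : V [⋀^Fin 3]→L[ℝ] ℝ) (s : Finset ι) (c : ι → ℝ) (x : ι → V) (y z : V) :
    Λ ![∑ i ∈ s, c i • x i, y, z] = ∑ i ∈ s, c i * Λ ![x i, y, z] := by
  have h : ∀ u, Λ ![u, y, z] = contract Λ y z u := fun u => by
    rw [threeForm_swap_left, threeForm_swap_right, neg_neg]
    rfl
  simp only [h, map_sum, map_smul, smul_eq_mul]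

/-- The components of a smooth map to `D` in a bundle chart are smooth. -/
theorem contMDiffAt_frameCoeff {b : M → Q} {u : ∀ x, D (b x)} {x₀ : M}
    (hu : ContMDiffAt IM (𝓘(ℝ, E).prod 𝓘(ℝ, F)) ∞ (fun x => (⟨b x, u x⟩ : TotalSpace F D)) x₀)
    (α : Fin (finrank ℝ F)) :
    ContMDiffAt IM 𝓘(ℝ, ℝ) ∞ (fun x => (finBasis ℝ F).coord α
      ((trivializationAt F D (b x₀)).continuousLinearMapAt ℝ (b x) (u x))) x₀ := by
  have h := contMDiffAt_totalSpace.1 hu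
  have h2 : ContMDiffAt 𝓘(ℝ, F) 𝓘(ℝ, ℝ) ∞
      (LinearMap.toContinuousLinearMap ((finBasis ℝ F).coord α))
      (trivializationAt F D (b x₀) ⟨b x₀, u x₀⟩).2 :=
    (ContinuousLinearMap.contDiff _).contMDiff.contMDiffAt
  refine (h2.comp x₀ h.2).congr_of_eventuallyEq ?_
  filter_upwards [h.1.continuousAt.eventually
    (eventually_mem_baseSet (F := F) (D := D) (b x₀))] with x hx
  rw [Trivialization.continuousLinearMapAt_apply_of_mem _ _ hx]
  rfl

theorem sum_frameCoeff_smul_frame {q₀ q : Q} (hq : q ∈ (trivializationAt F D q₀).baseSet)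
    (u : D q) :
    ∑ α, (finBasis ℝ F).coord α ((trivializationAt F D q₀).continuousLinearMapAt ℝ q u) •
      frame (F := F) q₀ α q = u := by
  simp only [frame_eq_symmL hq, ← map_smul, ← map_sum, Basis.coord_apply]
  rw [(finBasis ℝ F).sum_repr]
  exact (trivializationAt F D q₀).symmL_continuousLinearMapAt (R := ℝ) hq u

namespace System

variable (S : System E F D)

theorem contMDiffOn_frameField (q₀ : Q) (α : Fin (finrank ℝ F)) :
    ContMDiffOn 𝓘(ℝ, E) 𝓘(ℝ, E).tangent ∞
      (fun q => (⟨q, S.frameField q₀ α q⟩ : TangentBundle 𝓘(ℝ, E) Q))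
      (trivializationAt F D q₀).baseSet := fun _ hq =>
  (S.smoothFieldAt_incl (smoothSectionAt_localFrame E hq α)).contMDiffWithinAt

/-- Smoothness of Λ concerns vector fields on `Q`, while v depends on the point of `D*`. Expanding v
in the frame at `p₀` separates smooth coefficients on `D*` from the functions Λ(X_γ, X_α, X_β),
which are pulled back from `Q`. -/
theorem contMDiffAt_threeForm_velocity {Λ : ∀ q : Q, TangentSpace 𝓘(ℝ, E) q [⋀^Fin 3]→L[ℝ] ℝ}
    (hΛ : IsSmoothThreeForm Λ) (p₀ : PhaseSpace F D) (α β : Fin (finrank ℝ F)) :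
    ContMDiffAt (𝓘(ℝ, E).prod 𝓘(ℝ, F →L[ℝ] ℝ)) 𝓘(ℝ, ℝ) ∞
      (fun p : PhaseSpace F D => Λ p.proj ![S.incl p.proj (S.velocity p),
        S.frameField p₀.proj α p.proj, S.frameField p₀.proj β p.proj]) p₀ := by
  have h1 := contMDiffAt_frameCoeff (S.contMDiff_velocity p₀)
  have h2 : ∀ γ, ContMDiffAt 𝓘(ℝ, E) 𝓘(ℝ, ℝ) ∞ (fun q => Λ q ![S.frameField p₀.proj γ q,
        S.frameField p₀.proj α q, S.frameField p₀.proj β q]) p₀.proj := fun γ =>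
    (hΛ.contMDiffOn (trivializationAt F D p₀.proj).open_baseSet
      (S.contMDiffOn_frameField p₀.proj γ) (S.contMDiffOn_frameField p₀.proj α)
      (S.contMDiffOn_frameField p₀.proj β)).contMDiffAt
      (eventually_mem_baseSet (F := F) (D := D) p₀.proj)
  refine (ContMDiffAt.sum (t := Finset.univ) fun γ _ =>
    (h1 γ).smul ((h2 γ).comp p₀ (contMDiffAt_proj _))).congr_of_eventuallyEq ?_
  filter_upwards [(contMDiffAt_proj (n := ∞) (IB := 𝓘(ℝ, E)) (F := F →L[ℝ] ℝ)
    (E := fun q : Q => D q →L[ℝ] Bundle.Trivial Q ℝ q) (p := p₀)).continuousAt.eventually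
    (eventually_mem_baseSet (F := F) (D := D) p₀.proj)] with p hp
  conv_lhs => rw [← sum_frameCoeff_smul_frame hp (S.velocity p)]
  simp only [map_sum, map_smul]
  exact threeForm_sum_left _ _ _ _ _ _

theorem contMDiffAt_gaugeSharp_chartFun {Λ : ∀ q : Q, TangentSpace 𝓘(ℝ, E) q [⋀^Fin 3]→L[ℝ] ℝ}
    (hΛ : IsSmoothThreeForm Λ) (p₀ : PhaseSpace F D)
    (j k : Fin (finrank ℝ E) ⊕ Fin (finrank ℝ F)) :
    ContMDiffAt (𝓘(ℝ, E).prod 𝓘(ℝ, F →L[ℝ] ℝ)) 𝓘(ℝ, ℝ) ∞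
      (bracket (S.gaugeSharp Λ) (chartFun E p₀.proj j) (chartFun E p₀.proj k)) p₀ := by
  have hev := (chartAt (ModelProd E (F →L[ℝ] ℝ)) p₀).open_source.mem_nhds
    (mem_chart_source (ModelProd E (F →L[ℝ] ℝ)) p₀)
  have hframe : ∀ p ∈ (chartAt (ModelProd E (F →L[ℝ] ℝ)) p₀).source, ∀ α,
      SmoothSectionAt E F (frame (F := F) (D := D) p₀.proj α) p.proj := fun p hp α =>
    smoothSectionAt_localFrame E (mem_chartAt_source_iff.1 hp).1 α
  have hcoord : ∀ p ∈ (chartAt (ModelProd E (F →L[ℝ] ℝ)) p₀).source, ∀ i,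
      ContMDiffAt 𝓘(ℝ, E) 𝓘(ℝ, ℝ) ∞
        (fun q : Q => (finBasis ℝ E).coord i (extChartAt 𝓘(ℝ, E) p₀.proj q)) p.proj := by
    intro p hp i
    have h2 : ContMDiffAt 𝓘(ℝ, E) 𝓘(ℝ, ℝ) ∞
        (LinearMap.toContinuousLinearMap ((finBasis ℝ E).coord i))
        (extChartAt 𝓘(ℝ, E) p₀.proj p.proj) :=
      (ContinuousLinearMap.contDiff _).contMDiff.contMDiffAt
    exact h2.comp p.proj (contMDiffAt_extChartAt' (mem_chartAt_source_iff.1 hp).2)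
  have hmixed : ∀ i α, ContMDiffAt (𝓘(ℝ, E).prod 𝓘(ℝ, F →L[ℝ] ℝ)) 𝓘(ℝ, ℝ) ∞
      (bracket (S.gaugeSharp Λ) (chartFun E p₀.proj (.inl i)) (chartFun E p₀.proj (.inr α))) p₀ := by
    intro i α
    have h := contMDiffAt_mvfderiv_apply
      (hcoord p₀ (mem_chart_source (ModelProd E (F →L[ℝ] ℝ)) p₀) i)
      (S.smoothFieldAt_frameField p₀.proj α)
    refine (h.comp p₀ (contMDiffAt_proj _)).congr_of_eventuallyEq ?_
    filter_upwards [hev] with p hp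
    exact gaugeSharp_comp_proj_momentum Λ ((hcoord p hp i).mdifferentiableAt (by simp))
      (hframe p hp α)
  cases j with
  | inl i =>
    cases k with
    | inl i' =>
      refine (contMDiffAt_const (c := (0 : ℝ))).congr_of_eventuallyEq ?_
      filter_upwards [hev] with p hp
      exact gaugeSharp_comp_proj_comp_proj Λ ((hcoord p hp i).mdifferentiableAt (by simp))
        ((hcoord p hp i').mdifferentiableAt (by simp))
    | inr α => exact hmixed i α
  | inr α =>
    cases k with
    | inl i =>
      refine (hmixed i α).neg.congr_of_eventuallyEq (Filter.Eventually.of_forall fun p => ?_)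
      exact S.gaugeSharp_skew Λ p _ _
    | inr β =>
      have : IsManifold 𝓘(ℝ, E) (minSmoothness ℝ 2) Q := by
        rw [minSmoothness_of_isRCLikeNormedField]
        infer_instance
      -- The Lie bracket costs one derivative; the orders ∞ + 1 and ∞ agree by definition.
      have : IsManifold 𝓘(ℝ, E) (((⊤ : ℕ∞) : ℕ∞ω) + 1) Q := ‹IsManifold 𝓘(ℝ, E) ∞ Q›
      have hb : SmoothFieldAt E (VectorField.mlieBracket 𝓘(ℝ, E) (S.frameField p₀.proj α)
          (S.frameField p₀.proj β)) p₀.proj :=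
        ContMDiffAt.mlieBracket_vectorField (m := ⊤) (n := ⊤)
          (S.smoothFieldAt_frameField p₀.proj α) (S.smoothFieldAt_frameField p₀.proj β) (by simp)
      have h1 := S.contMDiffAt_inner (b := fun p : PhaseSpace F D => p.proj)
        (hb.comp p₀ (contMDiffAt_proj _)) (S.contMDiffAt_incl_velocity p₀)
      refine (h1.neg.add (S.contMDiffAt_threeForm_velocity hΛ p₀ α β)).congr_of_eventuallyEq ?_
      filter_upwards [hev] with p hp
      exact gaugeSharp_momentum_momentum Λ (hframe p hp α) (hframe p hp β)

/-- The bracket of smooth functions on `D*` is smooth. -/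
theorem isSmooth_bracket_gaugeSharp {Λ : ∀ q : Q, TangentSpace 𝓘(ℝ, E) q [⋀^Fin 3]→L[ℝ] ℝ}
    (hΛ : IsSmoothThreeForm Λ) {f h : PhaseSpace F D → ℝ} (hf : IsSmooth E f)
    (hh : IsSmooth E h) : IsSmooth E (bracket (S.gaugeSharp Λ) f h) := by
  intro p₀
  obtain ⟨a, ha, ha'⟩ := hf.differential_eq_sum p₀
  obtain ⟨c, hc, hc'⟩ := hh.differential_eq_sum p₀
  -- Both differentials are expanded in the coordinate differentials at `p₀`; bilinearity leaves the
  -- brackets of the coordinates.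
  refine (ContMDiffAt.sum (t := Finset.univ) fun j _ => ContMDiffAt.sum (t := Finset.univ)
    fun k _ => ((ha j).smul (hc k)).smul
      (S.contMDiffAt_gaugeSharp_chartFun hΛ p₀ j k)).congr_of_eventuallyEq ?_
  filter_upwards [(chartAt (ModelProd E (F →L[ℝ] ℝ)) p₀).open_source.mem_nhds
    (mem_chart_source (ModelProd E (F →L[ℝ] ℝ)) p₀)] with p hp
  rw [bracket, ha' p hp, hc' p hp]
  simp only [LinearMap.sum_apply, LinearMap.smul_apply, map_sum, map_smul, smul_eq_mul,
    Finset.mul_sum]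
  rw [Finset.sum_comm]
  refine Finset.sum_congr rfl fun j _ => Finset.sum_congr rfl fun k _ => ?_
  rw [mul_left_comm, ← mul_assoc]
  rfl

end System

end SmoothBracket

/-! ### The lifted action on sections, momenta and Lie brackets. -/

section ActionLift

variable {E Q F : Type*} {D : Q → Type*}
  [NormedAddCommGroup E] [NormedSpace ℝ E]
  [TopologicalSpace Q] [ChartedSpace E Q] [IsManifold 𝓘(ℝ, E) ∞ Q]
  [NormedAddCommGroup F] [NormedSpace ℝ F] [FiniteDimensional ℝ F]
  [TopologicalSpace (TotalSpace F D)]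
  [∀ q, AddCommGroup (D q)] [∀ q, Module ℝ (D q)] [∀ q, TopologicalSpace (D q)]
  [FiberBundle F D] [VectorBundle ℝ F D] [ContMDiffVectorBundle ∞ F D 𝓘(ℝ, E)]
  {G : Type*} [Group G] [MulAction G Q]

omit [IsManifold 𝓘(ℝ, E) ∞ Q] in
theorem isInvertible_tangentAction
    (hsm : ∀ g : G, ContMDiff 𝓘(ℝ, E) 𝓘(ℝ, E) ∞ (fun q : Q => g • q)) (g : G) (q : Q) :
    (tangentAction E g q).IsInvertible :=
  let Φ : Q ≃ₘ^∞⟮𝓘(ℝ, E), 𝓘(ℝ, E)⟯ Q := ⟨MulAction.toPerm g, hsm g, hsm g⁻¹⟩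
  ⟨Φ.mfderivToContinuousLinearEquiv (by simp) q, rfl⟩

variable (F) in
theorem finrank_fibre (q : Q) :
    FiniteDimensional ℝ (D q) ∧ finrank ℝ (D q) = finrank ℝ F :=
  let e := ((trivializationAt F D q).continuousLinearEquivAt ℝ q
    (FiberBundle.mem_baseSet_trivializationAt' q)).toLinearEquiv
  ⟨e.symm.finiteDimensional, e.finrank_eq⟩

namespace System

variable {S : System E F D}

/-- The action of `g` on `D`, from the fibre over `q` to the one over `g • q`. -/
def IsSymmetric.fibreMap (hS : S.IsSymmetric G) (g : G) (q : Q) : D q →ₗ[ℝ] D (g • q) :=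
  (LinearEquiv.ofInjective (S.incl (g • q)).toLinearMap
    (S.incl_injective (g • q))).symm.toLinearMap ∘ₗ
    ((tangentAction E g q).toLinearMap ∘ₗ (S.incl q).toLinearMap).codRestrict _
      (hS.distribution_invariant g q)

theorem IsSymmetric.incl_fibreMap (hS : S.IsSymmetric G) (g : G) (q : Q) (u : D q) :
    S.incl (g • q) (hS.fibreMap g q u) = tangentAction E g q (S.incl q u) :=
  LinearEquiv.ofInjective_symm_apply (f := (S.incl (g • q)).toLinearMap)
    (h := S.incl_injective (g • q)) (⟨tangentAction E g q (S.incl q u), hS.distribution_invariant g q u⟩ :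
      LinearMap.range (S.incl (g • q)).toLinearMap)

variable (hsm : ∀ g : G, ContMDiff 𝓘(ℝ, E) 𝓘(ℝ, E) ∞ (fun q : Q => g • q))

include hsm in
theorem IsSymmetric.fibreMap_injective (hS : S.IsSymmetric G) (g : G) (q : Q) :
    Function.Injective (hS.fibreMap g q) := fun u w h =>
  S.incl_injective q ((isInvertible_tangentAction hsm g q).injective (by
    rw [← hS.incl_fibreMap, ← hS.incl_fibreMap, h]))

/-- The action of `g` on `D`, as an equivalence of the fibres over `q` and `g • q`. -/
def IsSymmetric.fibreEquiv (hS : S.IsSymmetric G) (g : G) (q : Q) : D q ≃ₗ[ℝ] D (g • q) :=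
  have := (finrank_fibre F (D := D) q).1
  have := (finrank_fibre F (D := D) (g • q)).1
  LinearEquiv.ofInjectiveOfFinrankEq (hS.fibreMap g q) (hS.fibreMap_injective hsm g q)
    ((finrank_fibre F q).2.trans (finrank_fibre F (g • q)).2.symm)

theorem IsSymmetric.incl_fibreEquiv (hS : S.IsSymmetric G) (g : G) (q : Q) (u : D q) :
    S.incl (g • q) (hS.fibreEquiv hsm g q u) = tangentAction E g q (S.incl q u) :=
  hS.incl_fibreMap g q u

/-- The pull-back of a section of `D` under the action of `g`. -/
def IsSymmetric.pullSection (hS : S.IsSymmetric G) (g : G) (X : ∀ q, D q) (q : Q) : D q :=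
  (hS.fibreEquiv hsm g q).symm (X (g • q))

theorem IsSymmetric.tangentAction_pullSection (hS : S.IsSymmetric G) (g : G) (X : ∀ q, D q)
    (q : Q) : tangentAction E g q (S.incl q (hS.pullSection hsm g X q)) =
      S.incl (g • q) (X (g • q)) := by
  rw [← hS.incl_fibreEquiv hsm]
  exact congrArg _ (LinearEquiv.apply_symm_apply _ _)

/-- Makes the smoothness of pull-backs and the naturality of the Lie bracket available for sections
of `D`. -/
theorem IsSymmetric.incl_pullSection (hS : S.IsSymmetric G) (g : G) (X : ∀ q, D q) :
    (fun q => S.incl q (hS.pullSection hsm g X q)) =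
      VectorField.mpullback 𝓘(ℝ, E) 𝓘(ℝ, E) (fun q : Q => g • q)
        (fun q => S.incl q (X q)) := by
  ext q
  refine ((isInvertible_tangentAction hsm g q).inverse_apply_eq.2 ?_).symm
  exact (hS.tangentAction_pullSection hsm g X q).symm

theorem IsSymmetric.pullSection_of_equivariant (hS : S.IsSymmetric G) {g : G} {X : ∀ q, D q}
    {U : Set Q} (hX : S.IsEquivariantOn G X U) {q : Q} (hq : q ∈ U) (hgq : g • q ∈ U) :
    hS.pullSection hsm g X q = X q := by
  refine (LinearEquiv.symm_apply_eq _).2 (S.incl_injective _ ?_)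
  rw [hS.incl_fibreEquiv hsm]
  exact hX g q hq hgq

/-- The metric is invariant: ⟨Tg(v), X(g • q)⟩ = ⟨v, Tg⁻¹ X(g • q)⟩. -/
theorem IsSymmetric.momentum_liftedAction (hS : S.IsSymmetric G) (g : G) (X : ∀ q, D q)
    (p : PhaseSpace F D) :
    momentum X (S.liftedAction g p) = momentum (hS.pullSection hsm g X) p := by
  refine Eq.trans ?_ (S.inner_velocity p _)
  rw [← hS.metric_invariant g, hS.tangentAction_pullSection]
  rfl

theorem IsSymmetric.incl_velocity_liftedAction (hS : S.IsSymmetric G) (g : G)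
    (p : PhaseSpace F D) :
    S.incl (g • p.proj) (S.velocity (S.liftedAction g p)) =
      tangentAction E g p.proj (S.incl p.proj (S.velocity p)) := by
  rw [← hS.incl_fibreMap]
  refine congrArg (S.incl (g • p.proj)) (S.velocity_eq_of_inner (S.liftedAction g p) _ fun u => ?_)
  exact congrArg (fun w => S.metric.inner (g • p.proj) w (S.incl _ u)) (hS.incl_fibreMap g p.proj _)

theorem IsSymmetric.smoothSectionAt_pullSection [CompleteSpace E] (hS : S.IsSymmetric G) {g : G}
    {X : ∀ q, D q} {q : Q} (hX : SmoothSectionAt E F X (g • q)) :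
    SmoothSectionAt E F (hS.pullSection hsm g X) q := by
  have : IsManifold 𝓘(ℝ, E) (((⊤ : ℕ∞) : ℕ∞ω) + 1) Q := ‹IsManifold 𝓘(ℝ, E) ∞ Q›
  refine S.contMDiffAt_of_incl ?_
  have h := ContMDiffAt.mpullback_vectorField_preimage (m := ∞) (n := ∞)
    (f := fun q : Q => g • q) (x₀ := q)
    (S.smoothFieldAt_incl hX) (hsm g q) (isInvertible_tangentAction hsm g q) (by simp)
  rw [← hS.incl_pullSection hsm] at h
  exact h

/-- Lie brackets commute with pull-back by a diffeomorphism, and g acts by isometries. -/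
theorem IsSymmetric.inner_mlieBracket_pullSection [CompleteSpace E] (hS : S.IsSymmetric G) {g : G}
    {X Y : ∀ q, D q} {q : Q} (hX : SmoothSectionAt E F X (g • q))
    (hY : SmoothSectionAt E F Y (g • q)) (w : TangentSpace 𝓘(ℝ, E) q) :
    S.metric.inner (g • q) (VectorField.mlieBracket 𝓘(ℝ, E) (fun x => S.incl x (X x))
        (fun x => S.incl x (Y x)) (g • q)) (tangentAction E g q w) =
      S.metric.inner q (VectorField.mlieBracket 𝓘(ℝ, E)
        (fun x => S.incl x (hS.pullSection hsm g X x))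
        (fun x => S.incl x (hS.pullSection hsm g Y x)) q) w := by
  have : IsManifold 𝓘(ℝ, E) (minSmoothness ℝ 2) Q := by
    rw [minSmoothness_of_isRCLikeNormedField]
    infer_instance
  have h := VectorField.mpullback_mlieBracket (n := ∞) (f := fun q : Q => g • q) (x₀ := q)
    ((S.smoothFieldAt_incl hX).mdifferentiableAt (by simp))
    ((S.smoothFieldAt_incl hY).mdifferentiableAt (by simp)) (hsm g q)
    (by rw [minSmoothness_of_isRCLikeNormedField]; exact WithTop.coe_le_coe.2 le_top)
  rw [← hS.incl_pullSection hsm, ← hS.incl_pullSection hsm] at h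
  rw [← h]
  refine Eq.trans ?_ (hS.metric_invariant g q _ w)
  refine congrArg (fun u => S.metric.inner (g • q) u (tangentAction E g q w)) ?_
  exact ((isInvertible_tangentAction hsm g q).self_apply_inverse _).symm

end System

end ActionLift

/-! ### Invariance of the gauge transformed bivector. -/

section Invariance

variable {E Q F : Type*} {D : Q → Type*}
  [NormedAddCommGroup E] [NormedSpace ℝ E] [FiniteDimensional ℝ E]
  [TopologicalSpace Q] [ChartedSpace E Q] [IsManifold 𝓘(ℝ, E) ∞ Q]
  [NormedAddCommGroup F] [NormedSpace ℝ F] [FiniteDimensional ℝ F]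
  [TopologicalSpace (TotalSpace F D)]
  [∀ q, AddCommGroup (D q)] [∀ q, Module ℝ (D q)] [∀ q, TopologicalSpace (D q)]
  [FiberBundle F D] [VectorBundle ℝ F D] [ContMDiffVectorBundle ∞ F D 𝓘(ℝ, E)]
  {G : Type*} [Group G] [MulAction G Q]
  {EM HM M : Type*} [NormedAddCommGroup EM] [NormedSpace ℝ EM] [TopologicalSpace HM]
  {IM : ModelWithCorners ℝ EM HM} [TopologicalSpace M] [ChartedSpace HM M] [IsManifold IM ∞ M]

omit [FiniteDimensional ℝ E] in
/-- The lifted action is smooth. -/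
theorem System.contMDiffAt_liftedAction (S : System E F D) {γ : M → G} {c : M → PhaseSpace F D}
    {x₀ : M}
    (hγ : ContMDiffAt (IM.prod 𝓘(ℝ, E)) 𝓘(ℝ, E) ∞ (fun y : M × Q => γ y.1 • y.2)
      (x₀, (c x₀).proj))
    (hc : ContMDiffAt IM (𝓘(ℝ, E).prod 𝓘(ℝ, F →L[ℝ] ℝ)) ∞ c x₀) :
    ContMDiffAt IM (𝓘(ℝ, E).prod 𝓘(ℝ, F →L[ℝ] ℝ)) ∞
      (fun x => S.liftedAction (γ x) (c x)) x₀ :=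
  -- Smoothness is asked of (x, q) ↦ γ(x) • q instead of γ. This serves both uses: a fixed group
  -- element acting on a varying point, and a varying group element acting on a fixed point.
  S.contMDiffAt_covector (b := fun x => γ x • (c x).proj)
    (contMDiffAt_mfderiv_apply (f := fun x (q : Q) => γ x • q) (b := fun x => (c x).proj)
      (v := fun x => S.incl (c x).proj (S.velocity (c x))) hγ
      ((S.contMDiffAt_incl_velocity (c x₀)).comp x₀ hc))

omit [FiniteDimensional ℝ F] in
/-- A smooth three-form which is invariant on a dense set is invariant. -/
theorem threeForm_invariant_of_dense {Λ : ∀ q : Q, TangentSpace 𝓘(ℝ, E) q [⋀^Fin 3]→L[ℝ] ℝ}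
    (hΛ : IsSmoothThreeForm Λ) {g : G}
    (hsm : ∀ g : G, ContMDiff 𝓘(ℝ, E) 𝓘(ℝ, E) ∞ (fun q : Q => g • q)) {A : Set Q} (hA : Dense A)
    (h : ∀ q ∈ A, ∀ x : Fin 3 → TangentSpace 𝓘(ℝ, E) q,
      Λ (g • q) (fun i => tangentAction E g q (x i)) = Λ q x)
    (q₀ : Q) (x : Fin 3 → TangentSpace 𝓘(ℝ, E) q₀) :
    Λ (g • q₀) (fun i => tangentAction E g q₀ (x i)) = Λ q₀ x := by
  have : IsManifold 𝓘(ℝ, E) (((⊤ : ℕ∞) : ℕ∞ω) + 1) Q := ‹IsManifold 𝓘(ℝ, E) ∞ Q›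
  have : ContMDiffVectorBundle ∞ E (TangentSpace 𝓘(ℝ, E) : Q → Type _) 𝓘(ℝ, E) := inferInstance
  -- The vectors are extended to local fields Y near g • q₀, and X is the pull-back of Y under g.
  -- Both sides of the identity, evaluated on X and Y, are then continuous at q₀ and agree on the
  -- dense set `A`.
  choose s hs hs' using fun i => FiberBundle.exists_contMDiffOn_extend (k := ∞) 𝓘(ℝ, E) E
    (V := (TangentSpace 𝓘(ℝ, E) : Q → Type _)) (tangentAction E g q₀ (x i))
  set Y : Fin 3 → ∀ q : Q, TangentSpace 𝓘(ℝ, E) q := fun i =>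
    FiberBundle.extend E (tangentAction E g q₀ (x i)) with hY
  set U : Set Q := interior (⋂ i, s i) with hU
  have hUq : g • q₀ ∈ U := mem_interior_iff_mem_nhds.2 (Filter.iInter_mem.2 hs)
  have hUs : ∀ i, U ⊆ s i := fun i => interior_subset.trans (Set.iInter_subset s i)
  have hpre : IsOpen ((fun q : Q => g • q) ⁻¹' U) := isOpen_interior.preimage (hsm g).continuous
  set X : Fin 3 → ∀ q : Q, TangentSpace 𝓘(ℝ, E) q := fun i =>
    VectorField.mpullback 𝓘(ℝ, E) 𝓘(ℝ, E) (fun q : Q => g • q) (Y i) with hX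
  have hTX : ∀ i q, tangentAction E g q (X i q) = Y i (g • q) := fun i q =>
    (isInvertible_tangentAction hsm g q).self_apply_inverse _
  have hc1 : ContinuousAt (fun q => Λ (g • q) (fun i => Y i (g • q))) q₀ :=
    ((hΛ U isOpen_interior Y fun i => (hs' i).mono (hUs i)).contMDiffAt
      (isOpen_interior.mem_nhds hUq)).continuousAt.comp (f := fun q : Q => g • q)
      (hsm g).continuous.continuousAt
  have hc2 : ContinuousAt (fun q => Λ q (fun i => X i q)) q₀ := by
    refine ((hΛ _ hpre X fun i q hq => ?_).contMDiffAt (hpre.mem_nhds hUq)).continuousAt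
    refine (ContMDiffAt.mpullback_vectorField_preimage (m := ∞) (n := ∞)
      (f := fun q : Q => g • q) (x₀ := q) ?_ (hsm g q) (isInvertible_tangentAction hsm g q)
      (by simp)).contMDiffWithinAt
    exact ((hs' i).mono (hUs i)).contMDiffAt (isOpen_interior.mem_nhds hq)
  have hX0 : ∀ i, X i q₀ = x i := fun i => (isInvertible_tangentAction hsm g q₀).injective
    ((hTX i q₀).trans (FiberBundle.extend_apply_self E _))
  have key := tendsto_nhds_unique_of_frequently_eq hc1.tendsto hc2.tendsto
    ((mem_closure_iff_frequently.1 (hA q₀)).mono fun q hq => by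
      rw [← h q hq]
      exact congrArg (Λ (g • q)) (funext fun i => (hTX i q).symm))
  simp only [hX0] at key
  rw [← key]
  exact congrArg (Λ (g • q₀)) (funext fun i => (FiberBundle.extend_apply_self E _).symm)

namespace System

variable {S : System E F D} {Λ : ∀ q : Q, TangentSpace 𝓘(ℝ, E) q [⋀^Fin 3]→L[ℝ] ℝ} {g : G}

/-- After composition with the lifted action the coordinates near g • q are still pulled-back
functions and momenta, though no longer coordinates of a chosen frame. The frame-free bracket
formulas thus apply at both points. -/
theorem IsSymmetric.bracket_liftedAction_chartFun (hS : S.IsSymmetric G)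
    (hsm : ∀ g : G, ContMDiff 𝓘(ℝ, E) 𝓘(ℝ, E) ∞ (fun q : Q => g • q))
    (hΛ : ∀ (q : Q) (x : Fin 3 → TangentSpace 𝓘(ℝ, E) q),
      Λ (g • q) (fun i => tangentAction E g q (x i)) = Λ q x) (p : PhaseSpace F D)
    (j k : Fin (finrank ℝ E) ⊕ Fin (finrank ℝ F)) :
    bracket (S.gaugeSharp Λ) (chartFun E (g • p.proj) j) (chartFun E (g • p.proj) k)
        (S.liftedAction g p) =
      bracket (S.gaugeSharp Λ) (chartFun E (g • p.proj) j ∘ S.liftedAction g)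
        (chartFun E (g • p.proj) k ∘ S.liftedAction g) p := by
  set φ : Fin (finrank ℝ E) → Q → ℝ := fun i q =>
    (finBasis ℝ E).coord i (extChartAt 𝓘(ℝ, E) (g • p.proj) q) with hφ
  have hφd : ∀ i, MDifferentiableAt 𝓘(ℝ, E) 𝓘(ℝ, ℝ) (φ i) (g • p.proj) := fun i => by
    have h2 : ContMDiffAt 𝓘(ℝ, E) 𝓘(ℝ, ℝ) ∞
        (LinearMap.toContinuousLinearMap ((finBasis ℝ E).coord i))
        (extChartAt 𝓘(ℝ, E) (g • p.proj) (g • p.proj)) :=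
      (ContinuousLinearMap.contDiff _).contMDiff.contMDiffAt
    have h3 : ContMDiffAt 𝓘(ℝ, E) 𝓘(ℝ, ℝ) ∞ (φ i) (g • p.proj) :=
      h2.comp (g • p.proj) contMDiffAt_extChartAt
    exact h3.mdifferentiableAt (by simp)
  have hgd : MDifferentiableAt 𝓘(ℝ, E) 𝓘(ℝ, E) (fun q : Q => g • q) p.proj :=
    (hsm g p.proj).mdifferentiableAt (by simp)
  have hφg : ∀ i, MDifferentiableAt 𝓘(ℝ, E) 𝓘(ℝ, ℝ) (fun q : Q => φ i (g • q)) p.proj :=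
    fun i => MDifferentiableAt.comp (I' := 𝓘(ℝ, E)) (f := fun q : Q => g • q) (g := φ i) p.proj
      (hφd i) hgd
  have hX : ∀ α, SmoothSectionAt E F (frame (F := F) (D := D) (g • p.proj) α) (g • p.proj) :=
    fun α => smoothSectionAt_localFrame E (FiberBundle.mem_baseSet_trivializationAt' _) α
  have hXg : ∀ α, SmoothSectionAt E F (hS.pullSection hsm g (frame (F := F) (g • p.proj) α)) p.proj :=
    fun α => hS.smoothSectionAt_pullSection hsm (hX α)
  have hmom : ∀ α, momentum (frame (F := F) (D := D) (g • p.proj) α) ∘ S.liftedAction g =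
      momentum (hS.pullSection hsm g (frame (F := F) (g • p.proj) α)) := fun α =>
    funext fun p => hS.momentum_liftedAction hsm g _ p
  have hmixed : ∀ i α,
      differential E (fun x : PhaseSpace F D => φ i x.proj) (S.liftedAction g p)
        (S.gaugeSharp Λ (S.liftedAction g p)
          (differential E (momentum (frame (F := F) (g • p.proj) α)) (S.liftedAction g p))) =
      differential E (fun x : PhaseSpace F D => φ i (g • x.proj)) p (S.gaugeSharp Λ p
          (differential E (momentum (hS.pullSection hsm g (frame (F := F) (g • p.proj) α))) p)) := by
    intro i α
    refine (gaugeSharp_comp_proj_momentum Λ (p := S.liftedAction g p) (hφd i) (hX α)).trans ?_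
    refine Eq.trans ?_ (gaugeSharp_comp_proj_momentum Λ (hφg i) (hXg α)).symm
    refine Eq.trans ?_ (mfderiv_comp_apply p.proj (hφd i) hgd _).symm
    refine congrArg (mfderiv 𝓘(ℝ, E) 𝓘(ℝ, ℝ) (φ i) (g • p.proj)) ?_
    exact (hS.tangentAction_pullSection hsm g _ p.proj).symm
  cases j with
  | inl i =>
    cases k with
    | inl i' =>
      exact (gaugeSharp_comp_proj_comp_proj (S := S) Λ (p := S.liftedAction g p) (hφd i)
        (hφd i')).trans (gaugeSharp_comp_proj_comp_proj (S := S) Λ (p := p) (hφg i) (hφg i')).symm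
    | inr α =>
      refine (hmixed i α).trans ?_
      change _ = bracket (S.gaugeSharp Λ) _ (momentum _ ∘ S.liftedAction g) p
      rw [hmom]
      rfl
  | inr α =>
    cases k with
    | inl i =>
      refine (S.gaugeSharp_skew Λ _ _ _).trans ?_
      refine (congrArg Neg.neg (hmixed i α)).trans ?_
      change _ = bracket (S.gaugeSharp Λ) (momentum _ ∘ S.liftedAction g) _ p
      rw [hmom]
      exact (S.gaugeSharp_skew Λ p _ _).symm
    | inr β =>
      change _ = bracket (S.gaugeSharp Λ) (momentum _ ∘ S.liftedAction g)
        (momentum _ ∘ S.liftedAction g) p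
      rw [hmom, hmom]
      refine (gaugeSharp_momentum_momentum Λ (p := S.liftedAction g p) (hX α) (hX β)).trans ?_
      refine Eq.trans ?_ (gaugeSharp_momentum_momentum Λ (hXg α) (hXg β)).symm
      refine congrArg₂ (fun s t : ℝ => -s + t) ?_ ?_
      · rw [← hS.inner_mlieBracket_pullSection hsm (hX α) (hX β)]
        exact congrArg _ (hS.incl_velocity_liftedAction g p)
      · refine Eq.trans ?_ (hΛ p.proj _)
        refine congrArg (Λ (g • p.proj)) (funext fun i => ?_)
        fin_cases i
        · exact hS.incl_velocity_liftedAction g p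
        · exact (hS.tangentAction_pullSection hsm g _ p.proj).symm
        · exact (hS.tangentAction_pullSection hsm g _ p.proj).symm

/-- The gauge transformed bivector is invariant if the three-form is. -/
theorem IsSymmetric.gaugeSharp_liftedAction (hS : S.IsSymmetric G)
    (hsm : ∀ g : G, ContMDiff 𝓘(ℝ, E) 𝓘(ℝ, E) ∞ (fun q : Q => g • q))
    (hΛ : ∀ (q : Q) (x : Fin 3 → TangentSpace 𝓘(ℝ, E) q),
      Λ (g • q) (fun i => tangentAction E g q (x i)) = Λ q x) (p : PhaseSpace F D)
    (a : Dual ℝ (PhaseTangent E (S.liftedAction g p))) :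
    S.gaugeSharp Λ (S.liftedAction g p) a =
      S.liftedDeriv g p (S.gaugeSharp Λ p (a ∘ₗ S.liftedDeriv g p)) := by
  have hΦ : MDifferentiableAt (𝓘(ℝ, E).prod 𝓘(ℝ, F →L[ℝ] ℝ)) (𝓘(ℝ, E).prod 𝓘(ℝ, F →L[ℝ] ℝ))
      (S.liftedAction g) p :=
    (S.contMDiffAt_liftedAction (γ := fun _ : PhaseSpace F D => g) (c := id)
      ((hsm g).contMDiffAt.comp _ contMDiffAt_snd) contMDiffAt_id).mdifferentiableAt (by simp)
  have hchart : ∀ j, MDifferentiableAt (𝓘(ℝ, E).prod 𝓘(ℝ, F →L[ℝ] ℝ)) 𝓘(ℝ, ℝ)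
      (chartFun E (F := F) (D := D) (g • p.proj) j) (S.liftedAction g p) := fun j => by
    have h := chartFun_eventuallyEq
      (mem_chart_source (ModelProd E (F →L[ℝ] ℝ)) (S.liftedAction g p)) j
    refine (MDifferentiableAt.congr_of_eventuallyEq ?_ h)
    exact (chartCoord E F j).differentiableAt.mdifferentiableAt.comp _
      (mdifferentiableAt_extChartAt_phaseSpace (mem_chart_source _ _))
  have hd : ∀ j w, differential E (chartFun E (g • p.proj) j) (S.liftedAction g p)
      (S.liftedDeriv g p w) =
        differential E (chartFun E (g • p.proj) j ∘ S.liftedAction g) p w := fun j w =>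
    differential_mfderiv rfl (hchart j) hΦ w
  -- Vectors are compared by pairing with covectors; by bilinearity only the coordinate
  -- differentials need to be tested.
  rw [← sub_eq_zero, ← Module.forall_dual_apply_eq_zero_iff ℝ]
  intro b
  rw [map_sub, sub_eq_zero]
  obtain ⟨c, rfl⟩ := exists_eq_sum_differential_chartFun (S.liftedAction g p) a
  obtain ⟨d, rfl⟩ := exists_eq_sum_differential_chartFun (S.liftedAction g p) b
  have hcomp : (∑ j, c j • differential E (chartFun E (S.liftedAction g p).proj j)
      (S.liftedAction g p)) ∘ₗ S.liftedDeriv g p =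
      ∑ j, c j • differential E (chartFun E (g • p.proj) j ∘ S.liftedAction g) p := by
    ext w
    simp only [LinearMap.comp_apply, LinearMap.sum_apply, LinearMap.smul_apply]
    exact Finset.sum_congr rfl fun j _ => congrArg (c j • ·) (hd j w)
  rw [hcomp]
  simp only [map_sum, map_smul, LinearMap.sum_apply, LinearMap.smul_apply]
  refine Finset.sum_congr rfl fun j _ => congrArg (c j • ·)
    (Finset.sum_congr rfl fun k _ => congrArg (d k • ·) ?_)
  exact (hS.bracket_liftedAction_chartFun hsm hΛ p k j).trans (hd k _).symm

end System

end Invariance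

/-! ### Smoothness of implicit functions on a neighbourhood. -/

section Implicit

variable {E₁ E₂ F : Type*} [NormedAddCommGroup E₁] [NormedSpace ℝ E₁] [CompleteSpace E₁]
  [NormedAddCommGroup E₂] [NormedSpace ℝ E₂] [CompleteSpace E₂]
  [NormedAddCommGroup F] [NormedSpace ℝ F] [CompleteSpace F]

/-- The implicit function is smooth near the base point if the equation is smooth near it. -/
theorem eventually_contDiffAt_implicitFunction {u : E₁ × E₂} {f : E₁ × E₂ → F}
    (hf : ∀ᶠ z in 𝓝 u, ContDiffAt ℝ ∞ f z)
    (hinv : (fderiv ℝ f u ∘L .inr ℝ E₁ E₂).IsInvertible) :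
    ∀ᶠ y in 𝓝 u.1, ContDiffAt ℝ ∞ (hf.self_of_nhds.implicitFunction (by simp) hinv) y := by
  set η := hf.self_of_nhds.implicitFunction (by simp) hinv with hη
  have h1 : ∀ᶠ z in 𝓝 u, (fderiv ℝ f z ∘L .inr ℝ E₁ E₂).IsInvertible := by
    obtain ⟨e, he⟩ := hinv
    have hc : ContinuousAt (fun z => fderiv ℝ f z ∘L .inr ℝ E₁ E₂) u :=
      ((hf.self_of_nhds.fderiv_right (m := 0) (by simp)).clm_comp contDiffAt_const).continuousAt
    have h2 : Set.range ((↑) : (E₂ ≃L[ℝ] F) → E₂ →L[ℝ] F) ∈ 𝓝 (fderiv ℝ f u ∘L .inr ℝ E₁ E₂) := by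
      rw [← he]
      exact e.nhds
    filter_upwards [hc.preimage_mem_nhds h2] with z hz
    exact hz
  have hη1 : ContDiffAt ℝ 1 η u.1 :=
    (hf.self_of_nhds.contDiffAt_implicitFunction (by simp) hinv).of_le (by simp)
  have hη2 : ∀ᶠ y in 𝓝 u.1, ContinuousAt η y :=
    (hη1.eventually (by simp)).mono fun y hy => hy.continuousAt
  have hηt : Filter.Tendsto (fun y => (y, η y)) (𝓝 u.1) (𝓝 u) := by
    have h3 := (continuousAt_id (x := u.1)).prodMk hη1.continuousAt
    have h4 : η u.1 = u.2 := hf.self_of_nhds.implicitFunction_apply_self (by simp) hinv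
    simpa [ContinuousAt, h4] using h3
  have hηe : ∀ᶠ y in 𝓝 u.1, f (y, η y) = f u :=
    hf.self_of_nhds.eventually_apply_implicitFunction (by simp) hinv
  filter_upwards [hηt.eventually hf, hηt.eventually h1, hη2, eventually_eventually_nhds.2 hηe]
    with y hy1 hy2 hy3 hy4
  -- `ContDiffAt` of order ∞ at the base point alone provides no common neighbourhood for all finite
  -- orders. The theorem is therefore applied anew at (y, η y), and local uniqueness identifies the
  -- new solution with η near y.
  have h5 : ContDiffAt ℝ ∞ (hy1.implicitFunction (by simp) hy2) y :=
    hy1.contDiffAt_implicitFunction (by simp) hy2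
  refine h5.congr_of_eventuallyEq ?_
  have h6 : Filter.Tendsto (fun x => (x, η x)) (𝓝 y) (𝓝 (y, η y)) :=
    continuousAt_id.prodMk hy3
  filter_upwards [h6.eventually (hy1.eventually_apply_eq_iff_implicitFunction (by simp) hy2), hy4]
    with x hx1 hx2
  exact (hx1.1 (hx2.trans hy4.self_of_nhds.symm)).symm

end Implicit

/-! ### Local slices and moving frames at points with trivial isotropy. -/

section MovingFrame

variable {E Q : Type*} [NormedAddCommGroup E] [NormedSpace ℝ E] [FiniteDimensional ℝ E]
  [TopologicalSpace Q] [ChartedSpace E Q] [IsManifold 𝓘(ℝ, E) ∞ Q]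
  {EG G : Type*} [NormedAddCommGroup EG] [NormedSpace ℝ EG] [FiniteDimensional ℝ EG]
  [Group G] [TopologicalSpace G] [ChartedSpace EG G] [LieGroup 𝓘(ℝ, EG) ∞ G]
  [MulAction G Q] [ContMDiffSMul 𝓘(ℝ, EG) 𝓘(ℝ, E) ∞ G Q]

omit [FiniteDimensional ℝ E] [FiniteDimensional ℝ EG] [IsManifold 𝓘(ℝ, E) ∞ Q]
  [LieGroup 𝓘(ℝ, EG) ∞ G] in
variable (E EG) in
theorem contMDiff_smul_left (q : Q) :
    ContMDiff 𝓘(ℝ, EG) 𝓘(ℝ, E) ∞ (fun g : G => g • q) :=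
  ContMDiff.smul (I' := 𝓘(ℝ, E)) contMDiff_id contMDiff_const

omit [FiniteDimensional ℝ E] in
/-- The orbit map of a point with trivial isotropy is an immersion at `1`. -/
theorem injective_mfderiv_orbit [T2Space Q] {q : Q} (hq : q ∈ freePoints G Q) :
    Function.Injective (mfderiv 𝓘(ℝ, EG) 𝓘(ℝ, E) (fun g : G => g • q) 1) := by
  have : LieGroup 𝓘(ℝ, EG) (minSmoothness ℝ 3) G := by
    rw [minSmoothness_of_isRCLikeNormedField]
    exact LieGroup.of_le (n := ∞) (WithTop.coe_le_coe.2 le_top)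
  have : IsManifold 𝓘(ℝ, EG) 1 G := inferInstance
  rw [← ContinuousLinearMap.coe_coe, ← LinearMap.ker_eq_bot, LinearMap.ker_eq_bot']
  intro ξ hξ
  set o : G → Q := fun g => g • q with ho
  have hod : ∀ g, MDifferentiableAt 𝓘(ℝ, EG) 𝓘(ℝ, E) o g := fun g =>
    (contMDiff_smul_left E EG q g).mdifferentiableAt (by simp)
  -- Since o(g h) = g • o(h), a kernel vector at 1 generates a left-invariant field that lies in the
  -- kernel everywhere.
  have hX : ∀ g : G, mfderiv 𝓘(ℝ, EG) 𝓘(ℝ, E) o g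
      (mulInvariantVectorField (I := 𝓘(ℝ, EG)) ξ g) = 0 := by
    intro g
    have h1 := mfderiv_comp_apply_of_eq (I := 𝓘(ℝ, EG)) (I' := 𝓘(ℝ, EG)) (I'' := 𝓘(ℝ, E))
      (f := fun h : G => g * h) (x := 1) (hod g)
      ((contMDiff_mul_left (I := 𝓘(ℝ, EG)) (n := ∞) (a := g) 1).mdifferentiableAt (by simp))
      (mul_one g) ξ
    have h2 : o ∘ (fun h : G => g * h) = (fun x : Q => g • x) ∘ o := by
      ext h
      exact mul_smul g h q
    rw [h2] at h1
    refine h1.symm.trans ?_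
    refine (mfderiv_comp_apply (1 : G) ((ContMDiffSMul.contMDiff_const_smul (I := 𝓘(ℝ, EG))
      (I' := 𝓘(ℝ, E)) (n := ∞) g (o 1)).mdifferentiableAt (by simp)) (hod 1) ξ).trans ?_
    refine (congrArg _ hξ).trans (map_zero _)
  obtain ⟨γ, hγ0, hγ⟩ := exists_isMIntegralCurveAt_of_contMDiffAt_boundaryless (I := 𝓘(ℝ, EG))
    (v := mulInvariantVectorField (I := 𝓘(ℝ, EG)) ξ) (x₀ := (1 : G)) 0
    ((contMDiffAt_mulInvariantVectorField (I := 𝓘(ℝ, EG)) ξ).of_le (by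
      rw [minSmoothness_of_isRCLikeNormedField]
      norm_num))
  have h1 : IsMIntegralCurveAt (I := 𝓘(ℝ, E)) (o ∘ γ) (fun _ => 0) 0 := by
    filter_upwards [hγ] with t ht
    have h := HasMFDerivAt.comp t (hod (γ t)).hasMFDerivAt ht
    refine h.congr_mfderiv (ContinuousLinearMap.ext fun (s : ℝ) => ?_)
    exact ((map_smul _ s _).trans ((congrArg (s • ·) (hX (γ t))).trans (smul_zero s))).trans
      (smul_zero s).symm
  have h2 : IsMIntegralCurveAt (I := 𝓘(ℝ, E)) (fun _ : ℝ => q) (fun _ => 0) 0 := by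
    refine Filter.Eventually.of_forall fun t => ?_
    refine (hasMFDerivAt_const q t).congr_mfderiv (ContinuousLinearMap.ext fun (s : ℝ) => ?_)
    exact (smul_zero s).symm
  -- The image under o of an integral curve of that field has velocity zero. So γ stays in the
  -- stabilizer, is constant, and ξ = 0.
  have h3 : o ∘ γ =ᶠ[𝓝 0] fun _ => q :=
    isMIntegralCurveAt_eventuallyEq_of_contMDiffAt_boundaryless (I := 𝓘(ℝ, E))
      ((contMDiff_zeroSection ℝ (TangentSpace 𝓘(ℝ, E) : Q → Type _)).contMDiffAt) h1 h2
      (by simp [ho, hγ0])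
  have h4 : γ =ᶠ[𝓝 0] fun _ => 1 := by
    filter_upwards [h3] with t ht
    have : γ t ∈ MulAction.stabilizer G q := ht
    rw [show MulAction.stabilizer G q = ⊥ from hq] at this
    exact this
  have h5 := hγ.self_of_nhds.mfderiv
  rw [h4.mfderiv_eq, mfderiv_const] at h5
  have h6 : mulInvariantVectorField (I := 𝓘(ℝ, EG)) ξ (γ 0) = 0 :=
    (one_smul ℝ _).symm.trans (DFunLike.congr_fun h5 (1 : ℝ)).symm
  rw [hγ0] at h6
  refine Eq.trans ?_ h6
  have h7 : (fun h : G => (1 : G) * h) = id := funext one_mul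
  change ξ = mfderiv 𝓘(ℝ, EG) 𝓘(ℝ, EG) (fun h : G => (1 : G) * h) 1 ξ
  rw [h7, mfderiv_id]
  rfl

omit [NormedAddCommGroup E] [NormedSpace ℝ E] [FiniteDimensional ℝ E]
  [ChartedSpace E Q] [IsManifold 𝓘(ℝ, E) ∞ Q]
  [NormedAddCommGroup EG] [NormedSpace ℝ EG] [FiniteDimensional ℝ EG] [ChartedSpace EG G]
  [LieGroup 𝓘(ℝ, EG) ∞ G] [ContMDiffSMul 𝓘(ℝ, EG) 𝓘(ℝ, E) ∞ G Q] in
/-- For a proper action, only group elements near `1` can move a point near a point `q₀` with trivial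
isotropy to another point near `q₀`. -/
theorem exists_nhds_forall_smul_mem [ProperSMul G Q] {q₀ : Q} (hq₀ : q₀ ∈ freePoints G Q)
    {N : Set G} (hN : N ∈ 𝓝 (1 : G)) :
    ∃ U ∈ 𝓝 q₀, ∀ (g : G), ∀ q ∈ U, g • q ∈ U → g ∈ N := by
  have hcl := (ProperSMul.isProperMap_smul_pair (G := G) (X := Q)).isClosedMap
  have hfib : (fun gx : G × Q => (gx.1 • gx.2, gx.2)) ⁻¹' {(q₀, q₀)} ⊆ {(1, q₀)} := by
    rintro ⟨g, q⟩ h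
    obtain ⟨h1, h2⟩ := Prod.ext_iff.1 (Set.mem_singleton_iff.1 h)
    simp only at h1 h2
    subst h2
    have : g ∈ MulAction.stabilizer G q := h1
    rw [show MulAction.stabilizer G q = ⊥ from hq₀] at this
    simp [Subgroup.mem_bot.1 this]
  -- For the closed map (g, q) ↦ (g • q, q), every neighbourhood of the fibre {(1, q₀)} contains the
  -- preimage of a neighbourhood of (q₀, q₀).
  have h1 := (isClosedMap_iff_comap_nhds_le.1 hcl (y := (q₀, q₀))).trans (nhdsSet_mono hfib)
  rw [nhdsSet_singleton] at h1
  have h2 : Prod.fst ⁻¹' N ∈ 𝓝 ((1 : G), q₀) := continuous_fst.continuousAt.preimage_mem_nhds hN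
  obtain ⟨V, hV, hVN⟩ := Filter.mem_comap.1 (h1 h2)
  rw [nhds_prod_eq] at hV
  obtain ⟨A, hA, B, hB, hAB⟩ := Filter.mem_prod_iff.1 hV
  exact ⟨A ∩ B, Filter.inter_mem hA hB, fun g q hq hgq =>
    hVN (a := (g, q)) (hAB ⟨hgq.1, hq.2⟩)⟩

/-- The equation which defines a local slice through `q₀` can be solved for the group element that
moves the slice to a given point. -/
theorem exists_local_section [T2Space Q] {q₀ : Q} (hq₀ : q₀ ∈ freePoints G Q) :
    ∃ (σ : Q → EG) (φ : Q → G), (∀ᶠ q in 𝓝 q₀, ContMDiffAt 𝓘(ℝ, E) 𝓘(ℝ, EG) ∞ φ q) ∧ φ q₀ = 1 ∧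
      ∀ᶠ x : G × Q in 𝓝 (1, q₀), σ (x.1⁻¹ • x.2) = 0 ↔ φ x.2 = x.1 := by
  have : IsManifold 𝓘(ℝ, EG) 1 G := inferInstance
  set A := mfderiv 𝓘(ℝ, EG) 𝓘(ℝ, E) (fun g : G => g • q₀) 1 with hA
  -- A left inverse of the derivative of the orbit map: the slice is the zero set of L applied to
  -- the chart displacement, hence transversal to the orbit.
  obtain ⟨L, hL⟩ := LinearMap.exists_leftInverse_of_injective
    (show EG →ₗ[ℝ] E from A.toLinearMap) (LinearMap.ker_eq_bot.2 (injective_mfderiv_orbit hq₀))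
  set L' : E →L[ℝ] EG := LinearMap.toContinuousLinearMap L with hL'
  set ψ := extChartAt 𝓘(ℝ, E) q₀ with hψ
  set χ := extChartAt 𝓘(ℝ, EG) (1 : G) with hχ
  set σ : Q → EG := fun q => L' (ψ q - ψ q₀) with hσ
  have hσs : ∀ q ∈ ψ.source, ContMDiffAt 𝓘(ℝ, E) 𝓘(ℝ, EG) ∞ σ q := fun q hq =>
    ContMDiffAt.comp (I' := 𝓘(ℝ, E)) (g := fun y : E => L' (y - ψ q₀)) q
      (show ContDiff ℝ ∞ (fun y : E => L' (y - ψ q₀)) by fun_prop).contMDiff.contMDiffAt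
      (contMDiffAt_extChartAt' (by rwa [hψ, extChartAt_source] at hq))
  have hσd : ∀ v : TangentSpace 𝓘(ℝ, E) q₀, mfderiv 𝓘(ℝ, E) 𝓘(ℝ, EG) σ q₀ v = L' v := by
    intro v
    have h1 : HasFDerivAt (fun y : E => L' (y - ψ q₀)) L' (ψ q₀) :=
      L'.hasFDerivAt.comp (ψ q₀) ((hasFDerivAt_id _).sub_const _)
    refine (mfderiv_comp_apply (I' := 𝓘(ℝ, E)) (g := fun y : E => L' (y - ψ q₀)) q₀
      h1.hasMFDerivAt.mdifferentiableAt
      ((contMDiffAt_extChartAt (n := ∞)).mdifferentiableAt (by simp)) v).trans ?_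
    rw [mfderiv_extChartAt_self, h1.hasMFDerivAt.mfderiv]
    rfl
  have hχs : ContMDiffAt 𝓘(ℝ, EG) 𝓘(ℝ, EG) ∞ χ.symm (χ 1) :=
    (contMDiffOn_extChartAt_symm (1 : G)).contMDiffAt (extChartAt_target_mem_nhds (1 : G))
  have hχ1 : χ.symm (χ 1) = 1 := extChartAt_to_inv (I := 𝓘(ℝ, EG)) (1 : G)
  have hψ1 : ψ.symm (ψ q₀) = q₀ := extChartAt_to_inv (I := 𝓘(ℝ, E)) q₀
  set H : E × EG → EG := fun z => σ (χ.symm z.2 • ψ.symm z.1) with hH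
  have hHe : ∀ᶠ z in 𝓝 (ψ q₀, χ 1), ContDiffAt ℝ ∞ H z := by
    have hact : ∀ z : E × EG, z.1 ∈ ψ.target → z.2 ∈ χ.target → ContMDiffAt 𝓘(ℝ, E × EG) 𝓘(ℝ, E) ∞
        (fun z : E × EG => χ.symm z.2 • ψ.symm z.1) z := fun z h1 h2 =>
      ContMDiffAt.smul (I := 𝓘(ℝ, EG)) (I' := 𝓘(ℝ, E))
        (ContMDiffAt.comp (I' := 𝓘(ℝ, EG)) (f := Prod.snd) z
          ((contMDiffOn_extChartAt_symm (1 : G)).contMDiffAt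
            ((isOpen_extChartAt_target (1 : G)).mem_nhds h2)) contDiffAt_snd.contMDiffAt)
        (ContMDiffAt.comp (I' := 𝓘(ℝ, E)) (f := Prod.fst) z
          ((contMDiffOn_extChartAt_symm q₀).contMDiffAt
            ((isOpen_extChartAt_target q₀).mem_nhds h1)) contDiffAt_fst.contMDiffAt)
    have h1 : ∀ᶠ z : E × EG in 𝓝 (ψ q₀, χ 1), z.1 ∈ ψ.target :=
      (continuous_fst.continuousAt (x := (ψ q₀, χ 1))).eventually
        (extChartAt_target_mem_nhds (I := 𝓘(ℝ, E)) q₀)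
    have h2 : ∀ᶠ z : E × EG in 𝓝 (ψ q₀, χ 1), z.2 ∈ χ.target :=
      (continuous_snd.continuousAt (x := (ψ q₀, χ 1))).eventually
        (extChartAt_target_mem_nhds (I := 𝓘(ℝ, EG)) (1 : G))
    have h3 := (hact (ψ q₀, χ 1) h1.self_of_nhds h2.self_of_nhds).continuousAt
    have h4 : ∀ᶠ z : E × EG in 𝓝 (ψ q₀, χ 1), χ.symm z.2 • ψ.symm z.1 ∈ ψ.source := by
      refine h3.eventually ?_
      simp only [hχ1, hψ1, one_smul]
      exact extChartAt_source_mem_nhds q₀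
    filter_upwards [h1, h2, h4] with z hz1 hz2 hz3
    exact (ContMDiffAt.comp z (hσs _ hz3) (hact z hz1 hz2)).contDiffAt
  have hHs : ContDiffAt ℝ ∞ H (ψ q₀, χ 1) := hHe.self_of_nhds
  have hH0 : H (ψ q₀, χ 1) = 0 := by simp [hH, hσ, hχ1, hψ1]
  -- In the group direction the derivative of the slice equation is L composed with the derivative
  -- of the orbit map, that is, the identity.
  have hHd : fderiv ℝ H (ψ q₀, χ 1) ∘L .inr ℝ E EG = .id ℝ EG := by
    ext v
    have h1 : HasFDerivAt (fun x : EG => (ψ q₀, x)) (.inr ℝ E EG) (χ 1) :=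
      hasFDerivAt_prodMk_right _ _
    have h2 := ((hHs.differentiableAt (by simp)).hasFDerivAt.comp (χ 1) h1).fderiv
    rw [← h2]
    have h3 : H ∘ (fun x : EG => (ψ q₀, x)) = σ ∘ (fun g : G => g • q₀) ∘ χ.symm := by
      ext x
      simp [hH, hψ1]
    rw [h3, ← mfderiv_eq_fderiv]
    have hod := (contMDiff_smul_left E EG q₀ (1 : G)).mdifferentiableAt (by simp)
    have hχd := hχs.mdifferentiableAt (by simp)
    refine (mfderiv_comp_apply_of_eq (χ 1)
      ((hσs q₀ (mem_extChartAt_source q₀)).mdifferentiableAt (by simp))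
      (MDifferentiableAt.comp_of_eq (χ 1) hod hχd hχ1) (by simp [hχ1]) v).trans ?_
    refine (hσd _).trans ?_
    refine (congrArg L' (mfderiv_comp_apply_of_eq (χ 1) hod hχd hχ1 v)).trans ?_
    have h4 := mfderivWithin_range_extChartAt_symm (I := 𝓘(ℝ, EG)) (x := (1 : G))
    rw [ModelWithCorners.range_eq_univ, mfderivWithin_univ] at h4
    refine (congrArg (fun w => L' (A w)) (DFunLike.congr_fun h4 v)).trans ?_
    exact DFunLike.congr_fun hL v
  have hinv : (fderiv ℝ H (ψ q₀, χ 1) ∘L .inr ℝ E EG).IsInvertible := by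
    rw [hHd]
    exact ContinuousLinearMap.isInvertible_equiv (f := ContinuousLinearEquiv.refl ℝ EG)
  set η := hHs.implicitFunction (by simp) hinv with hη
  have hη0 : η (ψ q₀) = χ 1 := hHs.implicitFunction_apply_self (by simp) hinv
  -- The implicit function finds the g that moves q into the slice. The inverse is taken because
  -- φ(q) is to move a point of the slice to q.
  refine ⟨σ, fun q => (χ.symm (η (ψ q)))⁻¹, ?_, ?_, ?_⟩
  · have h1 : ∀ᶠ y in 𝓝 (ψ q₀), ContDiffAt ℝ ∞ η y :=
      eventually_contDiffAt_implicitFunction hHe hinv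
    have h2 : ∀ᶠ y in 𝓝 (ψ q₀), η y ∈ χ.target := by
      refine h1.self_of_nhds.continuousAt.eventually ?_
      rw [hη0]
      exact extChartAt_target_mem_nhds (1 : G)
    have h3 : Filter.Tendsto ψ (𝓝 q₀) (𝓝 (ψ q₀)) := continuousAt_extChartAt q₀
    filter_upwards [h3.eventually h1, h3.eventually h2, extChartAt_source_mem_nhds (I := 𝓘(ℝ, E)) q₀]
      with q hq1 hq2 hq3
    refine ContMDiffAt.inv (I := 𝓘(ℝ, EG)) ?_
    refine ContMDiffAt.comp (I' := 𝓘(ℝ, EG)) (f := fun q => η (ψ q)) q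
      ((contMDiffOn_extChartAt_symm (1 : G)).contMDiffAt
        ((isOpen_extChartAt_target (1 : G)).mem_nhds hq2)) ?_
    exact hq1.contMDiffAt.comp q (contMDiffAt_extChartAt' (by rwa [extChartAt_source] at hq3))
  · simp only [hη0, hχ1, inv_one]
  · have : ContinuousInv G := (topologicalGroup_of_lieGroup 𝓘(ℝ, EG) ∞).toContinuousInv
    have hi : Filter.Tendsto (fun x : G × Q => x.1⁻¹) (𝓝 (1, q₀)) (𝓝 1) := by
      have h : ContinuousAt (fun x : G × Q => x.1⁻¹) (1, q₀) := continuous_fst.inv.continuousAt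
      simpa [ContinuousAt] using h
    have hψc : Filter.Tendsto ψ (𝓝 q₀) (𝓝 (ψ q₀)) := continuousAt_extChartAt q₀
    have hχc : Filter.Tendsto χ (𝓝 1) (𝓝 (χ 1)) := continuousAt_extChartAt (1 : G)
    have h2c : Filter.Tendsto (Prod.snd : G × Q → Q) (𝓝 (1, q₀)) (𝓝 q₀) :=
      continuous_snd.continuousAt
    have hc : Filter.Tendsto (fun x : G × Q => (ψ x.2, χ x.1⁻¹)) (𝓝 (1, q₀))
        (𝓝 (ψ q₀, χ 1)) :=
      (hψc.comp h2c).prodMk_nhds (hχc.comp hi)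
    have hs1 : ∀ᶠ x : G × Q in 𝓝 (1, q₀), x.1⁻¹ ∈ χ.source :=
      hi.eventually (extChartAt_source_mem_nhds (1 : G))
    have hs2 : ∀ᶠ x : G × Q in 𝓝 (1, q₀), x.2 ∈ ψ.source :=
      h2c.eventually (extChartAt_source_mem_nhds q₀)
    have hs3 : ∀ᶠ x : G × Q in 𝓝 (1, q₀), η (ψ x.2) ∈ χ.target := by
      have h1 : Filter.Tendsto (fun x : G × Q => η (ψ x.2)) (𝓝 (1, q₀)) (𝓝 (χ 1)) := by
        rw [← hη0]
        exact (hHs.contDiffAt_implicitFunction (by simp) hinv).continuousAt.tendsto.comp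
          (hψc.comp h2c)
      exact h1.eventually (extChartAt_target_mem_nhds (1 : G))
    filter_upwards [hc.eventually (hHs.eventually_apply_eq_iff_implicitFunction (by simp) hinv),
      hs1, hs2, hs3] with x hx h1 h2 h3
    rw [hH0] at hx
    simp only [hH, χ.left_inv h1, ψ.left_inv h2] at hx
    rw [hx]
    constructor
    · intro h
      rw [← hη] at h
      simp [h, χ.left_inv h1]
    · intro h
      rw [← hη, ← χ.right_inv h3, ← h, inv_inv]

/-- Near a point with trivial isotropy there is a smooth equivariant map to the group. -/
theorem exists_moving_frame [T2Space Q] [ProperSMul G Q] {q₀ : Q} (hq₀ : q₀ ∈ freePoints G Q) :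
    ∃ φ : Q → G, (∀ᶠ q in 𝓝 q₀, ContMDiffAt 𝓘(ℝ, E) 𝓘(ℝ, EG) ∞ φ q) ∧ φ q₀ = 1 ∧
      ∃ U ∈ 𝓝 q₀, ∀ (g : G), ∀ q ∈ U, g • q ∈ U → φ (g • q) = g * φ q := by
  have : ContinuousMul G := (topologicalGroup_of_lieGroup 𝓘(ℝ, EG) ∞).toContinuousMul
  obtain ⟨σ, φ, hφ, hφ1, hev⟩ := exists_local_section (E := E) (EG := EG) hq₀
  refine ⟨φ, hφ, hφ1, ?_⟩
  rw [nhds_prod_eq, Filter.eventually_prod_iff] at hev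
  obtain ⟨pa, ha, pb, hb, hab⟩ := hev
  -- Properness keeps g near 1, so g * φ(q) stays in the neighbourhood where solutions of the slice
  -- equation are unique.
  have h1 : ∀ᶠ x : G × G in 𝓝 (1, 1), pa (x.1 * x.2) := by
    refine (continuous_mul.continuousAt (x := ((1 : G), (1 : G)))).eventually ?_
    simpa using ha
  rw [nhds_prod_eq, Filter.eventually_prod_iff] at h1
  obtain ⟨pc, hc, pd, hd, hcd⟩ := h1
  obtain ⟨U, hU, hUN⟩ := exists_nhds_forall_smul_mem hq₀ hc
  have hφc : Filter.Tendsto φ (𝓝 q₀) (𝓝 1) := by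
    rw [← hφ1]
    exact hφ.self_of_nhds.continuousAt
  have hV : ∀ᶠ q in 𝓝 q₀, q ∈ U ∧ pb q ∧ pd (φ q) ∧ pa (φ q) :=
    (Filter.eventually_mem_set.2 hU).and (hb.and ((hφc.eventually hd).and (hφc.eventually ha)))
  refine ⟨{q | q ∈ U ∧ pb q ∧ pd (φ q) ∧ pa (φ q)}, hV, fun g q hq hgq => ?_⟩
  have h2 := (hab hq.2.2.2 hq.2.1).2 rfl
  have h3 := hab (hcd (hUN g q hq.1 hgq.1) hq.2.2.1) hgq.2.1
  -- Equivariance is uniqueness: (g φ(q))⁻¹ • (g • q) = φ(q)⁻¹ • q lies in the slice, so g φ(q)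
  -- solves the equation at g • q.
  simp only [mul_inv_rev, mul_smul, inv_smul_smul] at h3
  exact h3.1 h2

end MovingFrame

/-! ### Existence of adapted bases over the free points. -/

section AdaptedBasis

theorem exists_linearIndependent_sumElim {V : Type*} [AddCommGroup V] [Module ℝ V]
    [FiniteDimensional ℝ V] {l : ℕ} {v : Fin l → V} (hv : LinearIndependent ℝ v) :
    ∃ (k : ℕ) (y : Fin k → V), LinearIndependent ℝ (Sum.elim v y) ∧ l + k = finrank ℝ V := by
  obtain ⟨C, hC⟩ := Submodule.exists_isCompl (Submodule.span ℝ (Set.range v))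
  refine ⟨finrank ℝ C, fun i => finBasis ℝ C i, ?_, ?_⟩
  · refine hv.sum_type ((finBasis ℝ C).linearIndependent.map' C.subtype C.ker_subtype)
      (hC.disjoint.mono_right ?_)
    rw [Submodule.span_le]
    rintro _ ⟨i, rfl⟩
    exact (finBasis ℝ C i).2
  · have h1 := Submodule.finrank_add_eq_of_isCompl hC
    rwa [finrank_span_eq_card hv, Fintype.card_fin] at h1

variable {E Q F : Type*} {D : Q → Type*}
  [NormedAddCommGroup E] [NormedSpace ℝ E] [FiniteDimensional ℝ E]
  [TopologicalSpace Q] [ChartedSpace E Q] [IsManifold 𝓘(ℝ, E) ∞ Q]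
  [NormedAddCommGroup F] [NormedSpace ℝ F] [FiniteDimensional ℝ F]
  [TopologicalSpace (TotalSpace F D)]
  [∀ q, AddCommGroup (D q)] [∀ q, Module ℝ (D q)] [∀ q, TopologicalSpace (D q)]
  [FiberBundle F D] [VectorBundle ℝ F D] [ContMDiffVectorBundle ∞ F D 𝓘(ℝ, E)]
  {EG G : Type*} [NormedAddCommGroup EG] [NormedSpace ℝ EG] [FiniteDimensional ℝ EG]
  [Group G] [TopologicalSpace G] [ChartedSpace EG G] [LieGroup 𝓘(ℝ, EG) ∞ G]
  [MulAction G Q] [ContMDiffSMul 𝓘(ℝ, EG) 𝓘(ℝ, E) ∞ G Q]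

variable (E) in
/-- The tangent lift of the action of `g`, as a map on the tangent bundle. -/
def tangentLift (g : G) : TangentBundle 𝓘(ℝ, E) Q → TangentBundle 𝓘(ℝ, E) Q :=
  tangentMap 𝓘(ℝ, E) 𝓘(ℝ, E) (fun q : Q => g • q)

/-- Stated on the total space because the fibres over (g * h) • q and g • h • q are different types.
-/
theorem tangentLift_mul (hsm : ∀ g : G, ContMDiff 𝓘(ℝ, E) 𝓘(ℝ, E) ∞ (fun q : Q => g • q))
    (g h : G) (v : TangentBundle 𝓘(ℝ, E) Q) :
    tangentLift E (g * h) v = tangentLift E g (tangentLift E h v) := by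
  have h1 := tangentMap_comp (I := 𝓘(ℝ, E)) ((hsm g).mdifferentiable (by simp))
    ((hsm h).mdifferentiable (by simp))
  refine Eq.trans ?_ (congrFun h1 v)
  refine congrArg (fun f => tangentMap 𝓘(ℝ, E) 𝓘(ℝ, E) f v) (funext fun q => ?_)
  exact mul_smul g h q

theorem tangentLift_one (v : TangentBundle 𝓘(ℝ, E) Q) : tangentLift E (1 : G) v = v := by
  have h1 : (fun q : Q => (1 : G) • q) = id := funext fun q => one_smul G q
  rw [tangentLift, h1, tangentMap_id]
  rfl

/-- Sections of a vector bundle which are linearly independent at a point are so near it. -/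
theorem eventually_linearIndependent {ι : Type*} [Finite ι] {X : ι → ∀ q, D q} {q₀ : Q}
    (hX : ∀ i, SmoothSectionAt E F (X i) q₀) (hi : LinearIndependent ℝ fun i => X i q₀) :
    ∀ᶠ q in 𝓝 q₀, LinearIndependent ℝ fun i => X i q := by
  have hc : ContinuousAt (fun q => fun i => (trivializationAt F D q₀ ⟨q, X i q⟩).2) q₀ :=
    continuousAt_pi.2 fun i => (contMDiffAt_totalSpace.1 (hX i)).2.continuousAt
  have hker : ∀ q, (hq : q ∈ (trivializationAt F D q₀).baseSet) →
      (LinearIndependent ℝ (fun i => (trivializationAt F D q₀ ⟨q, X i q⟩).2) ↔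
        LinearIndependent ℝ fun i => X i q) := fun q hq =>
    LinearMap.linearIndependent_iff
      ((trivializationAt F D q₀).continuousLinearEquivAt ℝ q hq).toLinearMap
      (LinearEquiv.ker ((trivializationAt F D q₀).continuousLinearEquivAt ℝ q hq).toLinearEquiv)
  have h0 := (hker q₀ (FiberBundle.mem_baseSet_trivializationAt' q₀)).2 hi
  filter_upwards [hc.preimage_mem_nhds (isOpen_setOfPred_linearIndependent.mem_nhds h0),
    eventually_mem_baseSet (F := F) (D := D) q₀] with q h1 h2
  exact (hker q h2).1 h1

namespace System

variable {S : System E F D}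

theorem IsSymmetric.incl_pullSection_inv (hS : S.IsSymmetric G)
    (hsm : ∀ g : G, ContMDiff 𝓘(ℝ, E) 𝓘(ℝ, E) ∞ (fun q : Q => g • q)) (g : G) (X : ∀ q, D q)
    (q : Q) : (⟨q, S.incl q (hS.pullSection hsm g⁻¹ X q)⟩ : TangentBundle 𝓘(ℝ, E) Q) =
      tangentLift E g ⟨g⁻¹ • q, S.incl (g⁻¹ • q) (X (g⁻¹ • q))⟩ := by
  have h1 : tangentLift E g⁻¹ ⟨q, S.incl q (hS.pullSection hsm g⁻¹ X q)⟩ =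
      ⟨g⁻¹ • q, S.incl (g⁻¹ • q) (X (g⁻¹ • q))⟩ :=
    congrArg (TotalSpace.mk (g⁻¹ • q)) (hS.tangentAction_pullSection hsm g⁻¹ X q)
  rw [← h1, ← tangentLift_mul hsm, mul_inv_cancel, tangentLift_one]

/-- A section of `D` that is moved by a smooth family of group elements is smooth. -/
theorem IsSymmetric.smoothSectionAt_pullSection_inv (hS : S.IsSymmetric G)
    (hsm : ∀ g : G, ContMDiff 𝓘(ℝ, E) 𝓘(ℝ, E) ∞ (fun q : Q => g • q)) {φ : Q → G} {X : ∀ q, D q}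
    {q₀ : Q} (hφ : ContMDiffAt 𝓘(ℝ, E) 𝓘(ℝ, EG) ∞ φ q₀)
    (hX : SmoothSectionAt E F X ((φ q₀)⁻¹ • q₀)) :
    SmoothSectionAt E F (fun q => hS.pullSection hsm (φ q)⁻¹ X q) q₀ := by
  refine S.contMDiffAt_of_incl ?_
  simp only [hS.incl_pullSection_inv hsm]
  have hb : ContMDiffAt 𝓘(ℝ, E) 𝓘(ℝ, E) ∞ (fun q => (φ q)⁻¹ • q) q₀ :=
    (hφ.inv (I := 𝓘(ℝ, EG))).smul (I := 𝓘(ℝ, EG)) contMDiffAt_id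
  refine contMDiffAt_mfderiv_apply (f := fun x (q : Q) => φ x • q) (b := fun q => (φ q)⁻¹ • q)
    (v := fun q => S.incl ((φ q)⁻¹ • q) (X ((φ q)⁻¹ • q))) ?_ ?_
  · exact ContMDiffAt.smul (I := 𝓘(ℝ, EG)) (hφ.comp (q₀, _) contMDiffAt_fst) contMDiffAt_snd
  · exact ContMDiffAt.comp (f := fun q => (φ q)⁻¹ • q) q₀ (S.smoothFieldAt_incl hX) hb

variable (EG) in
include EG in
/-- Near a point with trivial isotropy, linearly independent equivariant sections of `D` are part
of an equivariant local basis. -/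
theorem IsSymmetric.exists_isAdaptedBasis [T2Space Q] [ProperSMul G Q] (hS : S.IsSymmetric G)
    {l : ℕ} {Z : Fin l → ∀ q, D q} (hZ : ∀ b q, SmoothSectionAt E F (Z b) q)
    (hZequiv : ∀ b, S.IsEquivariantOn G (Z b) Set.univ) {q₀ : Q} (hq₀ : q₀ ∈ freePoints G Q)
    (hi : LinearIndependent ℝ fun b => Z b q₀) :
    ∃ U : Set Q, IsOpen U ∧ q₀ ∈ U ∧ U ⊆ freePoints G Q ∧
      ∃ (k : ℕ) (Y : Fin k → ∀ q, D q), S.IsAdaptedBasis G Z Y U := by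
  have hsm : ∀ g : G, ContMDiff 𝓘(ℝ, E) 𝓘(ℝ, E) ∞ (fun q : Q => g • q) :=
    fun g => ContMDiffSMul.contMDiff_const_smul (I := 𝓘(ℝ, EG)) g
  obtain ⟨φ, hφ, hφ1, U, hU, hφU⟩ := exists_moving_frame (E := E) (EG := EG) hq₀
  have := fun q => (finrank_fibre F (D := D) q).1
  obtain ⟨k, y, hy, hk⟩ := exists_linearIndependent_sumElim hi
  choose s hs hs' using fun i => FiberBundle.exists_contMDiffOn_extend (k := ∞) 𝓘(ℝ, E) F (y i)
  -- Y_i(q) is φ(q) applied to the extended section at φ(q)⁻¹ • q. On an orbit near q₀ the point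
  -- φ(q)⁻¹ • q does not change, so φ(g • q) = g φ(q) makes Y_i equivariant.
  set Y : Fin k → ∀ q, D q :=
    fun i q => hS.pullSection hsm (φ q)⁻¹ (FiberBundle.extend F (y i)) q with hY
  have hb : Filter.Tendsto (fun q => (φ q)⁻¹ • q) (𝓝 q₀) (𝓝 q₀) := by
    have h1 : ContMDiffAt 𝓘(ℝ, E) 𝓘(ℝ, E) ∞ (fun q => (φ q)⁻¹ • q) q₀ :=
      (hφ.self_of_nhds.inv (I := 𝓘(ℝ, EG))).smul (I := 𝓘(ℝ, EG)) contMDiffAt_id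
    simpa [ContinuousAt, hφ1] using h1.continuousAt
  have hYs : ∀ᶠ q in 𝓝 q₀, ∀ i, SmoothSectionAt E F (Y i) q := by
    have h1 : ∀ᶠ q in 𝓝 q₀, ∀ i, s i ∈ 𝓝 ((φ q)⁻¹ • q) :=
      hb.eventually (Filter.eventually_all.2 fun i => eventually_mem_nhds_iff.2 (hs i))
    filter_upwards [hφ, h1] with q hq1 hq2 i
    exact hS.smoothSectionAt_pullSection_inv hsm hq1 ((hs' i).contMDiffAt (hq2 i))
  have hXs : ∀ᶠ q in 𝓝 q₀, ∀ i, SmoothSectionAt E F (Sum.elim Z Y i) q := by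
    filter_upwards [hYs] with q hq i
    cases i with
    | inl b => exact hZ b q
    | inr i => exact hq i
  have hY0 : ∀ i, Y i q₀ = y i := by
    intro i
    have h1 := hS.incl_pullSection_inv hsm (φ q₀) (FiberBundle.extend F (y i)) q₀
    -- Generalizing φ(q₀) to a variable g allows the substitution g = 1 although the fibre depends
    -- on g.
    have h2 : ∀ g : G, g = 1 → tangentLift E g
        ⟨g⁻¹ • q₀, S.incl (g⁻¹ • q₀) (FiberBundle.extend F (y i) (g⁻¹ • q₀))⟩ =
        ⟨q₀, S.incl q₀ (y i)⟩ := by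
      rintro g rfl
      rw [tangentLift_one, inv_one, one_smul, FiberBundle.extend_apply_self]
    rw [h2 _ hφ1] at h1
    exact S.incl_injective q₀ (TotalSpace.mk_inj.1 h1)
  have hind : ∀ᶠ q in 𝓝 q₀, LinearIndependent ℝ fun i => Sum.elim Z Y i q := by
    refine eventually_linearIndependent hXs.self_of_nhds ?_
    convert hy using 1
    ext i
    cases i with
    | inl b => rfl
    | inr i => exact hY0 i
  obtain ⟨V, hV, hVo, hqV⟩ := eventually_nhds_iff.1
    (hXs.and (hind.and (Filter.eventually_mem_set.2 hU)))
  have hYe : ∀ i, S.IsEquivariantOn G (Y i) V := by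
    intro i g q hq hgq
    have h1 := hS.incl_pullSection_inv hsm (φ q) (FiberBundle.extend F (y i)) q
    have h2 := hS.incl_pullSection_inv hsm (φ (g • q)) (FiberBundle.extend F (y i)) (g • q)
    have h3 : (⟨g • q, S.incl (g • q) (Y i (g • q))⟩ : TangentBundle 𝓘(ℝ, E) Q) =
        tangentLift E g ⟨q, S.incl q (Y i q)⟩ := by
      refine h2.trans ?_
      rw [h1, ← tangentLift_mul hsm, hφU g q (hV q hq).2.2 (hV _ hgq).2.2, mul_inv_rev, mul_smul,
        inv_smul_smul]
    exact TotalSpace.mk_inj.1 h3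
  refine ⟨V, hVo, hqV, fun q hq => ?_, k, Y, ⟨⟨fun hx => (hV _ hx).2.1, fun {x} hx => ?_,
    fun i x hx => ((hV x hx).1 i).contMDiffWithinAt⟩, fun i => ?_⟩⟩
  -- The moving frame also shows freeness nearby: g • q = q gives φ(q) = g φ(q).
  · refine (Subgroup.eq_bot_iff_forall _).2 fun g hg => ?_
    have hg' : g • q = q := hg
    have h1 := hφU g q (hV q hq).2.2 (by rw [hg']; exact (hV q hq).2.2)
    rw [hg'] at h1
    exact (mul_eq_right.1 h1.symm)
  · refine (((hV x hx).2.1.span_eq_top_of_card_eq_finrank' ?_).symm).le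
    rw [Fintype.card_sum, Fintype.card_fin, Fintype.card_fin, hk, (finrank_fibre F q₀).2,
      (finrank_fibre F x).2]
  · cases i with
    | inl b => exact fun g q _ _ => hZequiv b g q trivial trivial
    | inr i => exact hYe i

end System

end AdaptedBasis

/-! ### Hamiltonian vectors of gauge momenta are tangent to orbits. -/

section Casimir

variable {E Q F : Type*} {D : Q → Type*}
  [NormedAddCommGroup E] [NormedSpace ℝ E] [FiniteDimensional ℝ E]
  [TopologicalSpace Q] [ChartedSpace E Q] [IsManifold 𝓘(ℝ, E) ∞ Q]
  [NormedAddCommGroup F] [NormedSpace ℝ F] [FiniteDimensional ℝ F]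
  [TopologicalSpace (TotalSpace F D)]
  [∀ q, AddCommGroup (D q)] [∀ q, Module ℝ (D q)] [∀ q, TopologicalSpace (D q)]
  [FiberBundle F D] [VectorBundle ℝ F D] [ContMDiffVectorBundle ∞ F D 𝓘(ℝ, E)]
  {EG G : Type*} [NormedAddCommGroup EG] [NormedSpace ℝ EG] [FiniteDimensional ℝ EG]
  [Group G] [TopologicalSpace G] [ChartedSpace EG G] [LieGroup 𝓘(ℝ, EG) ∞ G]
  [MulAction G Q] [ContMDiffSMul 𝓘(ℝ, EG) 𝓘(ℝ, E) ∞ G Q]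

theorem projDeriv_vertical (p : PhaseSpace F D)
    (l : D p.proj →L[ℝ] Bundle.Trivial Q ℝ p.proj) :
    projDeriv E p (vertical E p l) = 0 := by
  refine (projDeriv_mfderiv (E := E) (p := p) (by simp)
    ((contMDiff_vertical_line p l).mdifferentiableAt (by simp)) _).trans ?_
  rw [mfderiv_const]
  rfl

/-- The differentials of the coordinate functions separate tangent vectors of `D*`. -/
theorem eq_of_differential_chartFun_eq {p : PhaseSpace F D} {w w' : PhaseTangent E p}
    (h : ∀ j, differential E (chartFun E p.proj j) p w =
      differential E (chartFun E p.proj j) p w') : w = w' := by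
  rw [← sub_eq_zero, ← Module.forall_dual_apply_eq_zero_iff ℝ]
  intro b
  obtain ⟨c, rfl⟩ := exists_eq_sum_differential_chartFun p b
  simp only [LinearMap.sum_apply, LinearMap.smul_apply, map_sub, h, sub_self]

theorem mdifferentiableAt_coord_extChartAt (q : Q) (i : Fin (finrank ℝ E)) :
    MDifferentiableAt 𝓘(ℝ, E) 𝓘(ℝ, ℝ)
      (fun x => (finBasis ℝ E).coord i (extChartAt 𝓘(ℝ, E) q x)) q := by
  have h : ContMDiffAt 𝓘(ℝ, E) 𝓘(ℝ, ℝ) ∞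
      (LinearMap.toContinuousLinearMap ((finBasis ℝ E).coord i)) (extChartAt 𝓘(ℝ, E) q q) :=
    (ContinuousLinearMap.contDiff _).contMDiff.contMDiffAt
  exact (ContMDiffAt.comp q h contMDiffAt_extChartAt).mdifferentiableAt (by simp)

/-- A tangent vector of `D*` vanishes if it annihilates the functions that are pulled back from `Q`
and the momenta of sections which span the fibre of `D`. -/
theorem eq_zero_of_differential_eq_zero {ι : Type*} {X : ι → ∀ q, D q} {p : PhaseSpace F D}
    (hX : ∀ i, SmoothSectionAt E F (X i) p.proj)
    (hspan : ⊤ ≤ Submodule.span ℝ (Set.range fun i => X i p.proj)) {w : PhaseTangent E p}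
    (hbase : ∀ φ : Q → ℝ, MDifferentiableAt 𝓘(ℝ, E) 𝓘(ℝ, ℝ) φ p.proj →
      differential E (fun x : PhaseSpace F D => φ x.proj) p w = 0)
    (hmom : ∀ i, differential E (momentum (X i)) p w = 0) : w = 0 := by
  have hmem := FiberBundle.mem_baseSet_trivializationAt' (F := F) (E := D) p.proj
  set l : D p.proj →L[ℝ] Bundle.Trivial Q ℝ p.proj :=
    ∑ α, differential E (momentum (frame (F := F) (D := D) p.proj α)) p w •
      coframe (F := F) p.proj α with hl
  have hlf : ∀ α, l (frame (F := F) p.proj α p.proj) =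
      differential E (momentum (frame (F := F) (D := D) p.proj α)) p w := by
    intro α
    have h1 : ∀ β, coframe (F := F) (D := D) p.proj β (frame (F := F) (D := D) p.proj α p.proj) =
        if α = β then (1 : ℝ) else 0 := by
      intro β
      rw [frame_eq_symmL hmem]
      change (finBasis ℝ F).coord β ((trivializationAt F D p.proj).continuousLinearMapAt ℝ p.proj
        ((trivializationAt F D p.proj).symmL ℝ p.proj (finBasis ℝ F α))) = _
      rw [Trivialization.continuousLinearMapAt_symmL _ hmem]
      simp [Finsupp.single_apply]
    have h2 : l (frame (F := F) p.proj α p.proj) =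
        ∑ β, differential E (momentum (frame (F := F) (D := D) p.proj β)) p w *
          (coframe (F := F) (D := D) p.proj β (frame (F := F) p.proj α p.proj) : ℝ) :=
      _root_.sum_apply _ _ _
    rw [h2]
    simp only [h1]
    simp
  -- Annihilating the functions from `Q` makes w vertical, given by the covector l with components
  -- dπ_α(w). The vanishing on the momenta then says that l is zero on a spanning set.
  have hw : w = vertical E p l := by
    refine eq_of_differential_chartFun_eq fun j => ?_
    cases j with
    | inl i =>
      have hd := mdifferentiableAt_coord_extChartAt p.proj i
      refine (hbase _ hd).trans ?_
      refine Eq.trans ?_ (differential_comp_proj hd _).symm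
      rw [projDeriv_vertical, map_zero]
    | inr α =>
      refine Eq.trans ?_ (differential_momentum_vertical (smoothSectionAt_localFrame E hmem α) l).symm
      exact (hlf α).symm
  have hl0 : ∀ u, l u = 0 := by
    have h1 : l.toLinearMap = 0 := LinearMap.ext_on_range
      (f := l.toLinearMap) (g := 0) (top_le_iff.1 hspan) fun i => by
        refine (differential_momentum_vertical (hX i) l).symm.trans ?_
        rw [← hw, hmom i]
        rfl
    exact fun u => DFunLike.congr_fun h1 u
  refine eq_of_differential_chartFun_eq fun j => ?_
  rw [map_zero]
  cases j with
  | inl i => exact hbase _ (mdifferentiableAt_coord_extChartAt p.proj i)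
  | inr α => exact (hlf α).symm.trans (hl0 _)

-- Removes the identification of tangent spaces at q and 1 • q that is built into `orbitTangent`.
-- The equality is read in the model space, as its sides lie in different tangent spaces.
omit [FiniteDimensional ℝ E] [IsManifold 𝓘(ℝ, E) ∞ Q] in
theorem tangentAction_one (q : Q) (w : TangentSpace 𝓘(ℝ, E) q) :
    (tangentAction E (1 : G) q w : E) = w := by
  have h1 : (fun q : Q => (1 : G) • q) = id := funext fun q => one_smul G q
  have h2 : ∀ f : Q → Q, f = id → (mfderiv 𝓘(ℝ, E) 𝓘(ℝ, E) f q w : E) = w := by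
    rintro f rfl
    rw [mfderiv_id]
    rfl
  exact h2 _ h1

namespace System

variable {S : System E F D}

theorem liftedAction_one (p : PhaseSpace F D) : S.liftedAction (1 : G) p = p := by
  have h1 := congrArg (fun v : TangentBundle 𝓘(ℝ, E) Q => S.covector v.2)
    (tangentLift_one (G := G) ⟨p.proj, S.incl p.proj (S.velocity p)⟩)
  refine h1.trans ?_
  have h2 : (S.metric.inner p.proj (S.incl p.proj (S.velocity p))).comp (S.incl p.proj) = p.2 := by
    ext u
    exact S.inner_velocity p u
  exact congrArg (TotalSpace.mk p.proj) h2

variable {W : ∀ q : Q, Submodule ℝ (TangentSpace 𝓘(ℝ, E) q)} {l k : ℕ} {Z : Fin l → ∀ q, D q}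
  {Y : Fin k → ∀ q, D q} {Λ : ∀ q : Q, TangentSpace 𝓘(ℝ, E) q [⋀^Fin 3]→L[ℝ] ℝ} {U : Set Q}
  {p : PhaseSpace F D}

theorem IsAdaptedBasis.smoothSectionAt (hY : S.IsAdaptedBasis G Z Y U) (hU : IsOpen U) {q : Q}
    (hq : q ∈ U) (i : Fin l ⊕ Fin k) : SmoothSectionAt E F (Sum.elim Z Y i) q :=
  (hY.isLocalFrameOn.contMDiffOn i).contMDiffAt (hU.mem_nhds hq)

/-- The momenta of an adapted basis commute with the gauge momenta. -/
theorem IsAdaptedThreeForm.gaugeSharp_momentum_momentum (hΛ : S.IsAdaptedThreeForm G W Z Λ)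
    (hY : S.IsAdaptedBasis G Z Y U) (hU : IsOpen U) (hUf : U ⊆ freePoints G Q) (hp : p.proj ∈ U)
    (i : Fin l ⊕ Fin k) (b : Fin l) :
    differential E (momentum (Sum.elim Z Y i)) p
      (S.gaugeSharp Λ p (differential E (momentum (Z b)) p)) = 0 := by
  refine (System.gaugeSharp_momentum_momentum Λ (hY.smoothSectionAt hU hp i)
    (hY.smoothSectionAt hU hp (.inl b))).trans ?_
  -- The property of Λ is known when the last argument is a basis vector; linearity extends it to v.
  have h1 : ((contract (Λ p.proj) (S.incl p.proj (Z b p.proj))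
      (S.incl p.proj (Sum.elim Z Y i p.proj))) ∘ₗ (S.incl p.proj).toLinearMap) =
      (S.metric.inner p.proj (VectorField.mlieBracket 𝓘(ℝ, E) (fun x => S.incl x (Z b x))
        (fun x => S.incl x (Sum.elim Z Y i x)) p.proj)).toLinearMap ∘ₗ
        (S.incl p.proj).toLinearMap :=
    LinearMap.ext_on_range (top_le_iff.1 (hY.isLocalFrameOn.generating hp)) fun j =>
      hΛ.adapted U hU hUf k Y hY p.proj hp b i j
  have h2 := DFunLike.congr_fun h1 (S.velocity p)
  rw [threeForm_swap_left, threeForm_swap_right, neg_neg, threeForm_swap_left,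
    VectorField.mlieBracket_swap_apply, map_neg]
  have h3 : ∀ a c : ℝ, a = c → - -c + -a = 0 := fun a c h => by rw [h]; ring
  exact h3 _ _ h2

variable (EG) in
include EG in
/-- Over the free points, the Hamiltonian vector field of a gauge momentum is tangent to the
orbits of the lifted action, hence it annihilates the invariant functions. -/
theorem IsAdaptedThreeForm.differential_gaugeSharp_momentum_eq_zero
    (hΛ : S.IsAdaptedThreeForm G W Z Λ) (hS : S.IsSymmetric G)
    (hY : S.IsAdaptedBasis G Z Y U) (hU : IsOpen U) (hUf : U ⊆ freePoints G Q) (hp : p.proj ∈ U)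
    {b : Fin l} (hZ : S.incl p.proj (Z b p.proj) ∈ orbitTangent E EG G p.proj)
    {f : PhaseSpace F D → ℝ} (hf : IsSmooth E f) (hfG : ∀ (g : G) p, f (S.liftedAction g p) = f p) :
    differential E f p (S.gaugeSharp Λ p (differential E (momentum (Z b)) p)) = 0 := by
  have hsm : ∀ g : G, ContMDiff 𝓘(ℝ, E) 𝓘(ℝ, E) ∞ (fun q : Q => g • q) :=
    fun g => ContMDiffSMul.contMDiff_const_smul (I := 𝓘(ℝ, EG)) g
  obtain ⟨ξ, hξ⟩ := hZ
  have hξ' : (mfderiv 𝓘(ℝ, EG) 𝓘(ℝ, E) (fun g : G => g • p.proj) 1 ξ : E) =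
    S.incl p.proj (Z b p.proj) := hξ.trans (tangentAction_one _ _)
  set c : G → PhaseSpace F D := fun g => S.liftedAction g p with hc
  have hc1 : c 1 = p := liftedAction_one p
  have hcd : MDifferentiableAt 𝓘(ℝ, EG) (𝓘(ℝ, E).prod 𝓘(ℝ, F →L[ℝ] ℝ)) c 1 := by
    refine ContMDiffAt.mdifferentiableAt (n := ∞) ?_ (by simp)
    exact S.contMDiffAt_liftedAction (γ := fun g : G => g) (c := fun _ => p)
      (contMDiff_smul (I := 𝓘(ℝ, EG)) (I' := 𝓘(ℝ, E)) _) contMDiffAt_const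
  -- The generator of the lifted action at p, for an element ξ with ξ·q = Z_b(q).
  set w : PhaseTangent E p := mfderiv 𝓘(ℝ, EG) (𝓘(ℝ, E).prod 𝓘(ℝ, F →L[ℝ] ℝ)) c 1 ξ with hw
  have hconst : ∀ h : PhaseSpace F D → ℝ, MDifferentiableAt (𝓘(ℝ, E).prod 𝓘(ℝ, F →L[ℝ] ℝ)) 𝓘(ℝ, ℝ)
      h p → h ∘ c =ᶠ[𝓝 1] (fun _ => h p) → differential E h p w = 0 := by
    intro h hd he
    refine (differential_mfderiv hc1 hd hcd ξ).trans ?_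
    have h1 := he.mfderiv_eq (I := 𝓘(ℝ, EG)) (I' := 𝓘(ℝ, ℝ))
    rw [mfderiv_const] at h1
    exact DFunLike.congr_fun h1 ξ
  have hXs := hY.smoothSectionAt (E := E) (F := F) hU hp
  have key : S.gaugeSharp Λ p (differential E (momentum (Z b)) p) = w := by
    rw [← sub_eq_zero]
    refine eq_zero_of_differential_eq_zero hXs (hY.isLocalFrameOn.generating hp) ?_ ?_
    · intro φ hφ
      rw [map_sub, sub_eq_zero]
      refine (gaugeSharp_comp_proj_momentum Λ hφ (hXs (.inl b))).trans ?_
      refine Eq.trans ?_ (differential_comp_proj hφ w).symm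
      refine congrArg (mvfderiv 𝓘(ℝ, E) φ p.proj) ?_
      exact hξ'.symm.trans (projDeriv_mfderiv hc1 hcd ξ).symm
    · intro i
      rw [map_sub, sub_eq_zero, hΛ.gaugeSharp_momentum_momentum hY hU hUf hp]
      refine (hconst _ ((contMDiffAt_momentum (hXs i)).mdifferentiableAt (by simp)) ?_).symm
      -- The X_i are equivariant only within `U`, so the p_{X_i} are constant along the orbit only
      -- for g near 1; that is enough for the derivative.
      have hev : ∀ᶠ g : G in 𝓝 1, g • p.proj ∈ U := by
        refine (contMDiff_smul_left E EG p.proj (1 : G)).continuousAt.eventually ?_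
        simp only [one_smul]
        exact hU.mem_nhds hp
      filter_upwards [hev] with g hg
      refine (hS.momentum_liftedAction hsm g _ p).trans ?_
      exact congrArg p.2 (hS.pullSection_of_equivariant hsm (hY.equivariant i) hp hg)
  rw [key]
  exact hconst f (hf.mdifferentiableAt (by simp)) (Filter.Eventually.of_forall fun g => hfG g p)

end System

end Casimir

/-! ### Descent to the orbit space. -/

section Reduction

variable {E Q F : Type*} {D : Q → Type*}
  [NormedAddCommGroup E] [NormedSpace ℝ E] [FiniteDimensional ℝ E]
  [TopologicalSpace Q] [ChartedSpace E Q] [IsManifold 𝓘(ℝ, E) ∞ Q]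
  [NormedAddCommGroup F] [NormedSpace ℝ F] [FiniteDimensional ℝ F]
  [TopologicalSpace (TotalSpace F D)]
  [∀ q, AddCommGroup (D q)] [∀ q, Module ℝ (D q)] [∀ q, TopologicalSpace (D q)]
  [FiberBundle F D] [VectorBundle ℝ F D] [ContMDiffVectorBundle ∞ F D 𝓘(ℝ, E)]
  {EG G : Type*} [NormedAddCommGroup EG] [NormedSpace ℝ EG] [FiniteDimensional ℝ EG]
  [Group G] [TopologicalSpace G] [ChartedSpace EG G] [LieGroup 𝓘(ℝ, EG) ∞ G]
  [MulAction G Q] [ContMDiffSMul 𝓘(ℝ, EG) 𝓘(ℝ, E) ∞ G Q]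

namespace System

variable {S : System E F D} {Λ : ∀ q : Q, TangentSpace 𝓘(ℝ, E) q [⋀^Fin 3]→L[ℝ] ℝ}

/-- The bracket of invariant functions which is given by an invariant bivector is invariant. -/
theorem IsInvariantBivector.bracket_liftedAction
    {P : ∀ p : PhaseSpace F D, Dual ℝ (PhaseTangent E p) →ₗ[ℝ] PhaseTangent E p}
    (hP : S.IsInvariantBivector G P)
    (hsm : ∀ g : G, ContMDiff 𝓘(ℝ, E) 𝓘(ℝ, E) ∞ (fun q : Q => g • q))
    {f h : PhaseSpace F D → ℝ} (hf : IsSmooth E f) (hh : IsSmooth E h)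
    (hfG : ∀ (g : G) p, f (S.liftedAction g p) = f p)
    (hhG : ∀ (g : G) p, h (S.liftedAction g p) = h p) (g : G) (p : PhaseSpace F D) :
    bracket P f h (S.liftedAction g p) = bracket P f h p := by
  have hΦ : MDifferentiableAt (𝓘(ℝ, E).prod 𝓘(ℝ, F →L[ℝ] ℝ)) (𝓘(ℝ, E).prod 𝓘(ℝ, F →L[ℝ] ℝ))
      (S.liftedAction g) p :=
    (S.contMDiffAt_liftedAction (γ := fun _ : PhaseSpace F D => g) (c := id)
      ((hsm g).contMDiffAt.comp _ contMDiffAt_snd) contMDiffAt_id).mdifferentiableAt (by simp)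
  have hd : ∀ {k : PhaseSpace F D → ℝ}, IsSmooth E k → (∀ (g : G) p, k (S.liftedAction g p) = k p) →
      ∀ w, differential E k (S.liftedAction g p) (S.liftedDeriv g p w) = differential E k p w := by
    intro k hk hkG w
    refine (differential_mfderiv (E := E) rfl (hk.mdifferentiableAt (by simp)) hΦ w).trans ?_
    rw [show k ∘ S.liftedAction g = k from funext fun p => hkG g p]
    rfl
  rw [bracket, hP, hd hf hfG]
  exact congrArg (fun b => differential E f p (P p b)) (LinearMap.ext (hd hh hhG))

variable (G) in
theorem pullback_liftedAction (f : S.ReducedSpace G → ℝ) (g : G) (p : PhaseSpace F D) :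
    S.pullback G f (S.liftedAction g p) = S.pullback G f p :=
  congrArg f (Quot.sound ⟨g, rfl⟩).symm

variable (S G) in
/-- The bracket of functions on `D*/G` that is induced by an invariant bivector on `D*`. -/
def reducedBracket
    (P : ∀ p : PhaseSpace F D, Dual ℝ (PhaseTangent E p) →ₗ[ℝ] PhaseTangent E p)
    (f h : S.ReducedSpace G → ℝ) (x : S.ReducedSpace G) : ℝ :=
  -- An arbitrary representative of the orbit; for an invariant bivector and reduced smooth f and h
  -- the choice is immaterial.
  bracket P (S.pullback G f) (S.pullback G h) (Quot.out x)

theorem IsInvariantBivector.pullback_reducedBracket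
    {P : ∀ p : PhaseSpace F D, Dual ℝ (PhaseTangent E p) →ₗ[ℝ] PhaseTangent E p}
    (hP : S.IsInvariantBivector G P)
    (hsm : ∀ g : G, ContMDiff 𝓘(ℝ, E) 𝓘(ℝ, E) ∞ (fun q : Q => g • q))
    {f h : S.ReducedSpace G → ℝ} (hf : S.IsReducedSmooth G f) (hh : S.IsReducedSmooth G h) :
    S.pullback G (S.reducedBracket G P f h) =
      bracket P (S.pullback G f) (S.pullback G h) := by
  ext p
  have hinv : ∀ p p' : PhaseSpace F D, (∃ g : G, S.liftedAction g p = p') →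
      bracket P (S.pullback G f) (S.pullback G h) p =
        bracket P (S.pullback G f) (S.pullback G h) p' := by
    rintro p _ ⟨g, rfl⟩
    exact (hP.bracket_liftedAction hsm hf hh (pullback_liftedAction G f)
      (pullback_liftedAction G h) g p).symm
  exact congrArg (Quot.lift _ hinv) (Quot.out_eq (Quot.mk _ p))

variable (EG) in
include EG in
/-- The gauge momenta commute with the invariant functions. -/
theorem IsAdaptedThreeForm.bracket_momentum_eq_zero [T2Space Q] [ProperSMul G Q]
    (hfree : Dense (freePoints G Q)) (hS : S.IsSymmetric G)
    {W : ∀ q : Q, Submodule ℝ (TangentSpace 𝓘(ℝ, E) q)} {l : ℕ} {Z : Fin l → ∀ q, D q}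
    (hZ : ∀ b q, SmoothSectionAt E F (Z b) q)
    (hZequiv : ∀ b, S.IsEquivariantOn G (Z b) Set.univ)
    (hZindep : ∀ q ∈ freePoints G Q, LinearIndependent ℝ (fun b => Z b q))
    (hZorbit : ∀ b, ∀ q ∈ freePoints G Q, S.incl q (Z b q) ∈ orbitTangent E EG G q)
    (hΛ : S.IsAdaptedThreeForm G W Z Λ) {f : PhaseSpace F D → ℝ} (hf : IsSmooth E f)
    (hfG : ∀ (g : G) p, f (S.liftedAction g p) = f p) (b : Fin l) :
    bracket (S.gaugeSharp Λ) f (momentum (Z b)) = 0 := by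
  have hm : IsSmooth E (momentum (Z b)) := fun p => contMDiffAt_momentum (hZ b p.proj)
  -- The bundle projection is open, so density of Q_f lifts to `D*`, and a continuous bracket need
  -- only vanish there.
  have hdense : Dense ((fun p : PhaseSpace F D => p.proj) ⁻¹' freePoints G Q) :=
    hfree.preimage (FiberBundle.isOpenMap_proj _ _)
  refine Continuous.ext_on hdense (S.isSmooth_bracket_gaugeSharp hΛ.smooth hf hm).continuous
    continuous_const fun p hp => ?_
  obtain ⟨U, hU, hpU, hUf, k, Y, hY⟩ := hS.exists_isAdaptedBasis EG hZ hZequiv hp (hZindep _ hp)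
  exact hΛ.differential_gaugeSharp_momentum_eq_zero EG hS hY hU hUf hpU (hZorbit b _ hp) hf hfG

end System

end Reduction

end Nonholonomic

end

/-! ### Assembly of the main theorem. -/

theorem theorem5p5
    -- the configuration manifold `Q`
    {E : Type*} [NormedAddCommGroup E] [NormedSpace ℝ E] [FiniteDimensional ℝ E]
    {Q : Type*} [TopologicalSpace Q] [T2Space Q] [SecondCountableTopology Q]
    [ChartedSpace E Q] [IsManifold 𝓘(ℝ, E) ∞ Q]
    -- the constraint distribution `D`, as a smooth vector bundle over `Q`
    {F : Type*} [NormedAddCommGroup F] [NormedSpace ℝ F] [FiniteDimensional ℝ F]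
    {D : Q → Type*} [TopologicalSpace (TotalSpace F D)]
    [∀ q, AddCommGroup (D q)] [∀ q, Module ℝ (D q)] [∀ q, TopologicalSpace (D q)]
    [FiberBundle F D] [VectorBundle ℝ F D] [ContMDiffVectorBundle ∞ F D 𝓘(ℝ, E)]
    -- the symmetry group `G` and its smooth proper action on `Q`
    {EG : Type*} [NormedAddCommGroup EG] [NormedSpace ℝ EG] [FiniteDimensional ℝ EG]
    {G : Type*} [Group G] [TopologicalSpace G] [T2Space G] [SecondCountableTopology G]
    [ChartedSpace EG G] [LieGroup 𝓘(ℝ, EG) ∞ G]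
    [MulAction G Q] [ContMDiffSMul 𝓘(ℝ, EG) 𝓘(ℝ, E) ∞ G Q] [ProperSMul G Q]
    -- generic points have trivial isotropy
    (hfree : Dense (Nonholonomic.freePoints G Q))
    -- the nonholonomic system and its symmetry
    (S : Nonholonomic.System E F D) (hS : S.IsSymmetric G)
    -- the complement `W` of `D`
    (W : ∀ q : Q, Submodule ℝ (TangentSpace 𝓘(ℝ, E) q)) (hW : S.IsInvariantComplement G W)
    -- the equivariant generators `Z_b` of the gauge momenta
    (l : ℕ) (Z : Fin l → ∀ q, D q)
    (hZsmooth : ∀ b, ContMDiff 𝓘(ℝ, E) (𝓘(ℝ, E).prod 𝓘(ℝ, F)) ∞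
      (fun q => (⟨q, Z b q⟩ : TotalSpace F D)))
    (hZequiv : ∀ b, S.IsEquivariantOn G (Z b) Set.univ)
    (hZindep : ∀ q ∈ Nonholonomic.freePoints G Q, LinearIndependent ℝ (fun b => Z b q))
    (hZgauge : ∀ b, S.IsGaugeGeneratorOn EG G (Z b) (Nonholonomic.freePoints G Q))
    -- the 3-form `Λ`
    (Λ : ∀ q : Q, TangentSpace 𝓘(ℝ, E) q [⋀^Fin 3]→L[ℝ] ℝ)
    (hΛ : S.IsAdaptedThreeForm G W Z Λ) :
    S.IsInvariantBivector G (S.gaugeSharp Λ) ∧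
      ∃ B : (S.ReducedSpace G → ℝ) → (S.ReducedSpace G → ℝ) → (S.ReducedSpace G → ℝ),
        S.IsInducedBracket G (S.gaugeSharp Λ) B ∧
        ∀ b, ∃ c : S.ReducedSpace G → ℝ,
          S.pullback G c = Nonholonomic.momentum (Z b) ∧ S.IsCasimir G B c := by
  have hsm : ∀ g : G, ContMDiff 𝓘(ℝ, E) 𝓘(ℝ, E) ∞ (fun q : Q => g • q) :=
    fun g => ContMDiffSMul.contMDiff_const_smul (I := 𝓘(ℝ, EG)) g
  have hP : S.IsInvariantBivector G (S.gaugeSharp Λ) := fun g p a =>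
    hS.gaugeSharp_liftedAction hsm
      (Nonholonomic.threeForm_invariant_of_dense hΛ.smooth hsm hfree (hΛ.invariant g)) p a
  refine ⟨hP, S.reducedBracket G (S.gaugeSharp Λ), fun f h hf hh => ?_, fun b => ?_⟩
  · have hpull := hP.pullback_reducedBracket hsm hf hh
    refine ⟨?_, hpull⟩
    rw [Nonholonomic.System.IsReducedSmooth, hpull]
    exact S.isSmooth_bracket_gaugeSharp hΛ.smooth hf hh
  · have hZ : ∀ b q, Nonholonomic.SmoothSectionAt E F (Z b) q := fun b q => hZsmooth b q
    have hinv : ∀ (g : G) p, Nonholonomic.momentum (Z b) (S.liftedAction g p) =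
        Nonholonomic.momentum (Z b) p := fun g p =>
      (hS.momentum_liftedAction hsm g (Z b) p).trans (congrArg p.2
        (hS.pullSection_of_equivariant hsm (hZequiv b) (Set.mem_univ _) (Set.mem_univ _)))
    let c : S.ReducedSpace G → ℝ := Quot.lift (Nonholonomic.momentum (Z b))
      (by rintro p _ ⟨g, rfl⟩; exact (hinv g p).symm)
    have hc : S.IsReducedSmooth G c := fun p => Nonholonomic.contMDiffAt_momentum (hZ b p.proj)
    have hzero : ∀ f, S.IsReducedSmooth G f → Nonholonomic.bracket (S.gaugeSharp Λ)
        (S.pullback G f) (Nonholonomic.momentum (Z b)) = 0 := fun f hf =>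
      hΛ.bracket_momentum_eq_zero EG hfree hS hZ hZequiv hZindep
        (fun b q hq => (hZgauge b).tangent_orbit q hq) hf
        (Nonholonomic.System.pullback_liftedAction G f) b
    refine ⟨c, rfl, hc, fun f hf => ⟨funext fun x => ?_, funext fun x => ?_⟩⟩
    · exact congrFun (hzero f hf) (Quot.out x)
    -- The other order of arguments follows by skew-symmetry.
    · refine (S.gaugeSharp_skew Λ _ _ _).trans ?_
      exact neg_eq_zero.2 (congrFun (hzero f hf) (Quot.out x))
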